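/- Consider finite two-player games given as a rooted tree. Every non-terminal state $s\in\mathcal S$ belongs to exactly one of the two players, the leader (player 1) or the follower (player 2), who chooses one of finitely many (at least one) actions there, each leading to a child; there are no chance nodes, and every terminal state $z\in\mathcal Z$ carries utilities $u_1(z),u_2(z)\in\mathbb R$. Assume $|\mathcal S|\ge 1$. A pure strategy profile $\pi\in\Pi$ assigns an action to every state. A distribution $\phi\in\Delta(\Pi)$ is *incentive compatible* if the following holds for every follower state $s$ and action $a$ at $s$. A profile $\pi$ is drawn from $\phi$, the leader plays according to $\pi$, and in each of her states that is reached the follower is told the action of $\pi$ there. Conditionally on $s$ being reached when recommendations are obeyed and $a$ being recommended there, no plan of the follower for $s$ and the states below it (based on the recommendations received so far) gives her a larger expected utility $u_2$ than obeying. A *Stackelberg extensive-form correlated equilibrium* (SEFCE) is an incentive compatible $\phi\in\Delta(\Pi)$ that maximizes the leader's expected utility $u_1$ among all incentive compatible distributions. A *minmax profile* $\sigma^m$ is a behavioral strategy profile such that in every subgame the leader's part minimizes the utility that the follower gets by best responding, and the follower's part is a best response to it. A behavioral strategy profile $\sigma$ is a *compact representation* of $\phi$ if $p_\phi(z)=p_\sigma(z)$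 for all $z\in\mathcal Z$, where $p$ denotes the probability that $z$ is reached, and if for some minmax profile $\sigma^m$ $$\phi(\pi)=\prod_{s\text{ reached by }\pi}\sigma(\pi(s))\cdot\prod_{s\text{ not reached by }\pi}\sigma^m(\pi(s))\qquad(\pi\in\Pi),$$ that is, recommendations and the leader's actions follow $\sigma$ as long as the follower obeys, and $\sigma^m$ after a deviation. **Theorem.** There are a single deterministic algorithm (a fixed program operating on linked data with exact real numbers, whose only constants are $0$ and $1$, where each arithmetic operation, comparison, pointer operation and function call costs one step) and a constant $C$ such that on every such game the algorithm outputs, in at most $C\cdot|\mathcal S|\cdot|\mathcal Z|$ steps, a behavioral strategy profile $\sigma$ that is a compact representation of some SEFCE $\phi$ of the game. Moreover, in every state $\sigma$ gives positive probability to at most two actions. -/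

import Mathlib

/-! ## Turn-based two-player games in tree form, without chance -/

/-- Player 1 is the leader, player 2 the follower. -/
inductive Player
  | leader
  | follower

/-- A finite turn-based game tree without chance nodes.  A leaf is a terminal state with the
utilities of the leader and of the follower.  An inner node is a state in which exactly one player
acts, choosing one of the `n + 1` actions; the `i`-th action leads to the subtree `child i`. -/
inductive GameTree
  | leaf (u₁ u₂ : ℝ)
  | node (p : Player) (n : ℕ) (child : Fin (n + 1) → GameTree)

/-- The non-terminal states of a game. -/
inductive GameTree.State : GameTree → Type
  | here {p : Player} {n : ℕ} {c : Fin (n + 1) → GameTree} : State (.node p n c)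
  | there {p : Player} {n : ℕ} {c : Fin (n + 1) → GameTree} (i : Fin (n + 1)) (s : State (c i)) :
      State (.node p n c)

/-- The terminal states of a game. -/
inductive GameTree.Terminal : GameTree → Type
  | here {u₁ u₂ : ℝ} : Terminal (.leaf u₁ u₂)
  | there {p : Player} {n : ℕ} {c : Fin (n + 1) → GameTree} (i : Fin (n + 1))
      (z : Terminal (c i)) : Terminal (.node p n c)

namespace GameTree

/-- The player who acts in a state. -/
def State.owner : {G : GameTree} → State G → Player
  | .node p _ _, .here => p
  | _, .there _ s => s.owner

/-- The number of actions available in a state. -/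
def State.numActions : {G : GameTree} → State G → ℕ
  | .node _ n _, .here => n + 1
  | _, .there _ s => s.numActions

/-- `s.Above t`: the state `t` is `s` or lies in the subtree below `s`. -/
inductive State.Above : {G : GameTree} → State G → State G → Prop
  | root {p : Player} {n : ℕ} {c : Fin (n + 1) → GameTree} (t : State (.node p n c)) :
      Above .here t
  | there {p : Player} {n : ℕ} {c : Fin (n + 1) → GameTree} (i : Fin (n + 1)) {s t : State (c i)} :
      Above s t → Above (State.there (p := p) i s) (State.there i t)

/-- Utility of the leader in a terminal state. -/
def Terminal.u₁ : {G : GameTree} → Terminal G → ℝ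
  | .leaf a _, .here => a
  | _, .there _ z => z.u₁

/-- Utility of the follower in a terminal state. -/
def Terminal.u₂ : {G : GameTree} → Terminal G → ℝ
  | .leaf _ b, .here => b
  | _, .there _ z => z.u₂

/-! Finiteness of the sets of states and of terminal states. -/

def stateEquiv (p : Player) (n : ℕ) (c : Fin (n + 1) → GameTree) :
    Option (Σ i, State (c i)) ≃ State (.node p n c) where
  toFun
    | none => .here
    | some ⟨i, s⟩ => .there i s
  invFun
    | .here => none
    | .there i s => some ⟨i, s⟩
  left_inv x := by rcases x with _ | ⟨i, s⟩ <;> rfl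
  right_inv s := by cases s <;> rfl

def terminalEquiv (p : Player) (n : ℕ) (c : Fin (n + 1) → GameTree) :
    (Σ i, Terminal (c i)) ≃ Terminal (.node p n c) where
  toFun x := .there x.1 x.2
  invFun | .there i z => ⟨i, z⟩
  left_inv x := rfl
  right_inv z := by cases z; rfl

noncomputable instance fintypeState : (G : GameTree) → Fintype (State G)
  | .leaf _ _ => ⟨∅, fun s => nomatch s⟩
  | .node p n c =>
    letI : ∀ i, Fintype (State (c i)) := fun i => fintypeState (c i)
    Fintype.ofEquiv _ (stateEquiv p n c)

noncomputable instance fintypeTerminal : (G : GameTree) → Fintype (Terminal G)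
  | .leaf _ _ => ⟨{.here}, fun z => by cases z; simp⟩
  | .node p n c =>
    letI : ∀ i, Fintype (Terminal (c i)) := fun i => fintypeTerminal (c i)
    Fintype.ofEquiv _ (terminalEquiv p n c)

noncomputable instance (G : GameTree) : DecidableEq (State G) := Classical.decEq _
noncomputable instance (G : GameTree) : DecidableEq (Terminal G) := Classical.decEq _

/-! ### Pure and behavioral strategy profiles -/

/-- A pure strategy profile: an action for every state (of the player who acts there). -/
abbrev Profile (G : GameTree) : Type := (s : State G) → Fin s.numActions

/-- A weight on every action of every state.  Together with `IsBehavioral` this is a profile of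
behavioral strategies. -/
abbrev Weights (G : GameTree) : Type := (s : State G) → Fin s.numActions → ℝ

/-- In every state the weights form a probability distribution over the actions. -/
def IsBehavioral {G : GameTree} (σ : Weights G) : Prop :=
  ∀ s, σ s ∈ stdSimplex ℝ (Fin s.numActions)

/-- The terminal state reached by a pure strategy profile. -/
def outcome : {G : GameTree} → Profile G → Terminal G
  | .leaf _ _, _ => .here
  | .node p n c, π =>
    let i : Fin (n + 1) := π (State.here (p := p) (c := c))
    .there i (outcome (G := c i) fun s => π (.there i s))

/-- Play according to the pure strategy profile passes through the state. -/
def Reaches : {G : GameTree} → Profile G → State G → Prop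
  | _, _, .here => True
  | .node _ _ c, π, .there i s => π .here = i ∧ Reaches (G := c i) (fun t => π (.there i t)) s

/-- The probability `p_σ(z)` that a behavioral strategy profile reaches the terminal state `z`. -/
def reachProb : {G : GameTree} → Weights G → Terminal G → ℝ
  | _, _, .here => 1
  | .node _ _ c, σ, .there i z => σ .here i * reachProb (G := c i) (fun t => σ (.there i t)) z

/-- The follower's expected utility under a behavioral strategy profile. -/
noncomputable def expU₂ {G : GameTree} (σ : Weights G) : ℝ :=
  ∑ z : Terminal G, z.u₂ * reachProb σ z

/-! ### Stackelberg extensive-form correlated equilibria -/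

/-- The leader's expected utility under a distribution on pure strategy profiles. -/
noncomputable def corrU₁ {G : GameTree} (φ : Profile G → ℝ) : ℝ :=
  ∑ π : Profile G, φ π * (outcome π).u₁

/-- The probability that a terminal state is reached under a distribution on pure profiles. -/
noncomputable def corrProb {G : GameTree} (φ : Profile G → ℝ) (z : Terminal G) : ℝ :=
  ∑ π : Profile G with outcome π = z, φ π

/-- A plan of the follower in the game with recommendations.  When play is in state `t` and
the drawn profile is `π`, the plan prescribes the action `d t π`; this may depend only on what the
follower has been told by then, that is on the recommendations in her states up to and
including `t`. -/
def IsPlan {G : GameTree} (d : (t : State G) → Profile G → Fin t.numActions) : Prop :=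
  ∀ t π π', (∀ r : State G, r.Above t → r.owner = .follower → π r = π' r) → d t π = d t π'

open Classical in
/-- The profile actually played when the profile `π` was drawn, and from the state `s` on
the follower uses the plan `d` in place of the recommendations. -/
noncomputable def deviate {G : GameTree} (s : State G)
    (d : (t : State G) → Profile G → Fin t.numActions) (π : Profile G) : Profile G :=
  fun t => if t.owner = .follower ∧ s.Above t then d t π else π t

open Classical in
/-- Whenever play reaches a state `s` of the follower and the action `a` is recommended to her
there, she cannot gain by deviating in `s` and in later states.  Both sides are
multiplied by the probability of the event that `s` is reached and `a` is recommended, so that the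
inequality compares conditional expectations given this event. -/
def IsIncentiveCompatible {G : GameTree} (φ : Profile G → ℝ) : Prop :=
  ∀ s : State G, s.owner = .follower → ∀ a : Fin s.numActions,
    ∀ d : (t : State G) → Profile G → Fin t.numActions, IsPlan d →
      ∑ π : Profile G with Reaches π s ∧ π s = a, φ π * (outcome (deviate s d π)).u₂ ≤
        ∑ π : Profile G with Reaches π s ∧ π s = a, φ π * (outcome π).u₂

/-- A Stackelberg extensive-form correlated equilibrium: a distribution on pure strategy profiles
that maximizes the leader's expected utility among the incentive compatible ones. -/
def IsSEFCE {G : GameTree} (φ : Profile G → ℝ) : Prop :=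
  φ ∈ stdSimplex ℝ (Profile G) ∧ IsIncentiveCompatible φ ∧
    ∀ φ' ∈ stdSimplex ℝ (Profile G), IsIncentiveCompatible φ' → corrU₁ φ' ≤ corrU₁ φ

/-! ### Compact representation -/

/-- In the whole game, the follower's part of `σ` is a best response to the leader's part, and
the leader's part minimizes the utility that the follower gets by best responding. -/
def IsMinmaxAtRoot {G : GameTree} (σ : Weights G) : Prop :=
  (∀ τ : Weights G, IsBehavioral τ → (∀ s, s.owner = .leader → τ s = σ s) → expU₂ τ ≤ expU₂ σ) ∧
  ∀ τ : Weights G, IsBehavioral τ →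
    ∃ τ' : Weights G, IsBehavioral τ' ∧ (∀ s, s.owner = .leader → τ' s = τ s) ∧ expU₂ σ ≤ expU₂ τ'

/-- The minmax condition holds in every subgame. -/
def IsMinmaxEverywhere : {G : GameTree} → Weights G → Prop
  | .leaf _ _, _ => True
  | .node _ _ c, σ =>
    IsMinmaxAtRoot σ ∧ ∀ i, IsMinmaxEverywhere (G := c i) fun t => σ (.there i t)

/-- A minmax profile: in each subgame the leader plays a minmax behavioral strategy for the
follower's utilities and the follower plays a best response. -/
def IsMinmax {G : GameTree} (σm : Weights G) : Prop :=
  IsBehavioral σm ∧ IsMinmaxEverywhere σm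

open Classical in
/-- The distribution on pure strategy profiles in which actions and recommendations follow `σ` in
the states reached when recommendations are obeyed, and follow `σm` in all other states. -/
noncomputable def followOrPunish {G : GameTree} (σ σm : Weights G) (π : Profile G) : ℝ :=
  ∏ s : State G, if Reaches π s then σ s (π s) else σm s (π s)

/-- The behavioral strategy profile `σ` is a compact representation of the distribution `φ`. -/
def IsCompactRep {G : GameTree} (σ : Weights G) (φ : Profile G → ℝ) : Prop :=
  IsBehavioral σ ∧ (∃ σm : Weights G, IsMinmax σm ∧ φ = followOrPunish σ σm) ∧
    ∀ z : Terminal G, corrProb φ z = reachProb σ z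

end GameTree

/-! ## The model of computation

A uniform, deterministic, unit-cost pointer machine with exact real arithmetic: data are
immutable cells holding a real number, or two pointers, or nothing, and a program is a finite
list of first-order, possibly mutually recursive, functions.  The program and its constants do not
depend on the input. -/

namespace RealMachine

/-- Data. -/
inductive Val
  | nil
  | real (x : ℝ)
  | pair (a b : Val)

/-- Expressions.  Variables are numbered from the most recently bound one. -/
inductive Expr
  | var (k : ℕ)
  | nil
  | zero
  | one
  | add (e₁ e₂ : Expr)
  | sub (e₁ e₂ : Expr)
  | mul (e₁ e₂ : Expr)
  | div (e₁ e₂ : Expr)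
  | pair (e₁ e₂ : Expr)
  | letIn (e₁ e₂ : Expr)
  /-- If `e` is empty continue with `e₁`; if it is a pair bind its components and continue
  with `e₂`. -/
  | casePair (e e₁ e₂ : Expr)
  /-- Continue with `e₃` if `e₁ ≤ e₂` and with `e₄` otherwise. -/
  | ifLe (e₁ e₂ e₃ e₄ : Expr)
  /-- Call the `f`-th function of the program. -/
  | call (f : ℕ) (e : Expr)

/-- A program is the finite list of the bodies of its functions, each with one argument. -/
abbrev Program : Type := List Expr

/-- `Eval P ρ e v t`: in the environment `ρ` the expression `e` evaluates to `v` in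
exactly `t` steps.  Every elementary operation is one step: access to a variable, creation of a
constant, an arithmetic operation, creation of a pair, a binding, a case distinction, a comparison
of two reals, a function call.  Division by zero and operations on data of the wrong kind have
no result. -/
inductive Eval (P : Program) : List Val → Expr → Val → ℕ → Prop
  | var {ρ k v} : ρ[k]? = some v → Eval P ρ (.var k) v 1
  | nil {ρ} : Eval P ρ .nil .nil 1
  | zero {ρ} : Eval P ρ .zero (.real 0) 1
  | one {ρ} : Eval P ρ .one (.real 1) 1
  | add {ρ e₁ e₂ x y t₁ t₂} : Eval P ρ e₁ (.real x) t₁ → Eval P ρ e₂ (.real y) t₂ →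
      Eval P ρ (.add e₁ e₂) (.real (x + y)) (t₁ + t₂ + 1)
  | sub {ρ e₁ e₂ x y t₁ t₂} : Eval P ρ e₁ (.real x) t₁ → Eval P ρ e₂ (.real y) t₂ →
      Eval P ρ (.sub e₁ e₂) (.real (x - y)) (t₁ + t₂ + 1)
  | mul {ρ e₁ e₂ x y t₁ t₂} : Eval P ρ e₁ (.real x) t₁ → Eval P ρ e₂ (.real y) t₂ →
      Eval P ρ (.mul e₁ e₂) (.real (x * y)) (t₁ + t₂ + 1)
  | div {ρ e₁ e₂ x y t₁ t₂} : Eval P ρ e₁ (.real x) t₁ → Eval P ρ e₂ (.real y) t₂ → y ≠ 0 →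
      Eval P ρ (.div e₁ e₂) (.real (x / y)) (t₁ + t₂ + 1)
  | pair {ρ e₁ e₂ v w t₁ t₂} : Eval P ρ e₁ v t₁ → Eval P ρ e₂ w t₂ →
      Eval P ρ (.pair e₁ e₂) (.pair v w) (t₁ + t₂ + 1)
  | letIn {ρ e₁ e₂ v w t₁ t₂} : Eval P ρ e₁ v t₁ → Eval P (v :: ρ) e₂ w t₂ →
      Eval P ρ (.letIn e₁ e₂) w (t₁ + t₂ + 1)
  | caseNil {ρ e e₁ e₂ w t t'} : Eval P ρ e .nil t → Eval P ρ e₁ w t' →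
      Eval P ρ (.casePair e e₁ e₂) w (t + t' + 1)
  | casePair {ρ e e₁ e₂ a b w t t'} : Eval P ρ e (.pair a b) t → Eval P (a :: b :: ρ) e₂ w t' →
      Eval P ρ (.casePair e e₁ e₂) w (t + t' + 1)
  | ifTrue {ρ e₁ e₂ e₃ e₄ x y w t₁ t₂ t} : Eval P ρ e₁ (.real x) t₁ → Eval P ρ e₂ (.real y) t₂ →
      x ≤ y → Eval P ρ e₃ w t → Eval P ρ (.ifLe e₁ e₂ e₃ e₄) w (t₁ + t₂ + t + 1)
  | ifFalse {ρ e₁ e₂ e₃ e₄ x y w t₁ t₂ t} : Eval P ρ e₁ (.real x) t₁ → Eval P ρ e₂ (.real y) t₂ →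
      ¬ x ≤ y → Eval P ρ e₄ w t → Eval P ρ (.ifLe e₁ e₂ e₃ e₄) w (t₁ + t₂ + t + 1)
  | call {ρ f e body v w t t'} : Eval P ρ e v t → P[f]? = some body → Eval P [v] body w t' →
      Eval P ρ (.call f e) w (t + t' + 1)

/-- The machine is deterministic: the result and the number of steps are determined by the
program and the input. -/
theorem Eval.det {P : Program} {ρ : List Val} {e : Expr} {v w : Val} {t t' : ℕ}
    (h : Eval P ρ e v t) (h' : Eval P ρ e w t') : v = w ∧ t = t' := by
  induction h generalizing w t' with
  | _ => cases h' <;> grind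

/-- Running the program on one input means calling its function number `0`. -/
def Runs (P : Program) (input output : Val) (t : ℕ) : Prop :=
  Eval P [input] (.call 0 (.var 0)) output t

/-- A linked list. -/
def Val.ofList : List Val → Val
  | [] => .nil
  | a :: l => .pair a (.ofList l)

/-- A mark that names the acting player. -/
def playerVal : Player → Val
  | .leader => .pair .nil .nil
  | .follower => .pair (.pair .nil .nil) .nil

/-- The input: the game tree as a linked structure.  A leaf is marked by `nil` and carries its two
utilities; an inner node is marked by the acting player and carries the list of its subtrees. -/
def gameVal : GameTree → Val
  | .leaf u₁ u₂ => .pair .nil (.pair (.real u₁) (.real u₂))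
  | .node p _ c => .pair (playerVal p) (.ofList (List.ofFn fun i => gameVal (c i)))

/-- The output: a tree of the same shape in which every inner node carries, for each action in
order, the probability of the action together with the output for the subtree below it. -/
def strategyVal : {G : GameTree} → G.Weights → Val
  | .leaf _ _, _ => .nil
  | .node _ n c, σ => .ofList (List.ofFn fun i : Fin (n + 1) =>
      .pair (.real (σ .here i)) (strategyVal (G := c i) fun t => σ (.there i t)))

end RealMachine

/-! Play below a state matters only through pairs (x, y) of expected utilities of the follower and
the leader. If incentive compatible play recommends an action in a follower state, the continuation
must give her at least the minmax `value` of that state, because against any correlated play of the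
leader one fixed reply secures this value (`exists_reply`, `ICOn.value_mul_le_of_follower`).
Conversely this condition on the actions in use (`Obedient`) suffices: after a deviation the leader
plays minmax, so the deviator gets at most the value (`Obedient.isIncentiveCompatible`). At leader
states the same inequality holds automatically, since the value of the node is at most that of each
child.

Hence, up to lowering y, the attainable pairs of a node form the convex hull of the union, over the
actions, of the attainable pairs of the child cut to the half-plane x ≥ `value` of the node. A list
of points stands for such a hull. `Below` describes membership through linear functionals and is
homogeneous in the probability mass, so conditioning on recommendations requires no division.
`ICOn.below` shows that the lists bound every incentive compatible distribution;
`IsRealization.glue` shows that their upper boundaries are attained by obedient behavioral profiles.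

The program computes values and lists bottom-up. Cutting a list at μ discards the points to the left
and adds the point where the upper hull crosses the line x = μ (`isClip_of_isBridge`), which never
lengthens the list; thus a list is no longer than the number of terminal states below its node. The
crossing edge of the hull, the bridge, is found in linear time and without sorting by prune and
search (`steps_bridge`): pair up the points, select the median slope of the pairs in linear time,
decide on which side of it the slope of the bridge lies, and drop one point from at least half of
the pairs. A node costs time linear in the number of terminal states below it, which sums to at most
a constant times |S|·|Z| (`sum_card_mul_card_le`).

A top-down pass starts from the point of the root list that is best for the leader. For a target x
in a node it takes the bridge over x, whose two endpoints carry the indices of the actions they come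
from; mixing these two actions hits x on the upper boundary, and the endpoints (or x itself, if both
belong to the same action) become the targets of the children. This explains why two actions per
state suffice. -/

namespace GameTree

/-! ## Subtrees -/

section Sub

variable {p : Player} {n : ℕ} {c : Fin (n + 1) → GameTree}

/-- The restriction of a pure profile to the subtree behind an action. -/
def Profile.sub (π : Profile (.node p n c)) (i : Fin (n + 1)) : Profile (c i) :=
  fun t => π (.there i t)

/-- The restriction of weights to the subtree behind an action. -/
def Weights.sub (σ : Weights (.node p n c)) (i : Fin (n + 1)) : Weights (c i) :=
  fun t => σ (.there i t)

/-- The action at the root. -/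
def Profile.root (π : Profile (.node p n c)) : Fin (n + 1) := π .here

/-- The weights of the actions at the root. -/
def Weights.root (σ : Weights (.node p n c)) : Fin (n + 1) → ℝ := σ .here

/-- A pure profile from an action at the root and profiles in the subtrees. -/
def Profile.glue (a : Fin (n + 1)) (f : ∀ i, Profile (c i)) : Profile (.node p n c)
  | .here => a
  | .there i t => f i t

/-- Weights from weights at the root and weights in the subtrees. -/
def Weights.glue (w : Fin (n + 1) → ℝ) (f : ∀ i, Weights (c i)) : Weights (.node p n c)
  | .here => w
  | .there i t => f i t

@[simp] theorem Profile.root_glue (a : Fin (n + 1)) (f : ∀ i, Profile (c i)) :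
    (Profile.glue (p := p) a f).root = a := rfl

@[simp] theorem Profile.sub_glue (a : Fin (n + 1)) (f : ∀ i, Profile (c i)) (i : Fin (n + 1)) :
    (Profile.glue (p := p) a f).sub i = f i := rfl

@[simp] theorem Weights.root_glue (w : Fin (n + 1) → ℝ) (f : ∀ i, Weights (c i)) :
    (Weights.glue (p := p) w f).root = w := rfl

@[simp] theorem Weights.sub_glue (w : Fin (n + 1) → ℝ) (f : ∀ i, Weights (c i))
    (i : Fin (n + 1)) : (Weights.glue (p := p) w f).sub i = f i := rfl

/-- A pure profile consists of an action at the root and profiles in the subtrees. -/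
def profileEquiv : (Fin (n + 1) × ∀ i, Profile (c i)) ≃ Profile (.node p n c) where
  toFun x := .glue x.1 x.2
  invFun π := (π.root, π.sub)
  left_inv _ := rfl
  right_inv π := by
    funext s
    cases s <;> rfl

theorem sum_terminal (f : Terminal (.node p n c) → ℝ) :
    ∑ z, f z = ∑ i, ∑ z, f (.there i z) := by
  rw [← (terminalEquiv p n c).sum_comp, Fintype.sum_sigma]
  rfl

theorem card_terminal : Fintype.card (Terminal (.node p n c)) =
    ∑ i, Fintype.card (Terminal (c i)) := by
  rw [← Fintype.card_congr (terminalEquiv p n c), Fintype.card_sigma]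

theorem card_state : Fintype.card (State (.node p n c)) =
    1 + ∑ i, Fintype.card (State (c i)) := by
  rw [← Fintype.card_congr (stateEquiv p n c), Fintype.card_option, Fintype.card_sigma, add_comm]

theorem prod_state (f : State (.node p n c) → ℝ) :
    ∏ s, f s = f .here * ∏ i, ∏ s, f (.there i s) := by
  rw [← (stateEquiv p n c).prod_comp, Fintype.prod_option, Fintype.prod_sigma]
  rfl

theorem outcome_u₁_of_root_eq {π : Profile (.node p n c)} {i : Fin (n + 1)} (h : π.root = i) :
    (outcome π).u₁ = (outcome (π.sub i)).u₁ := by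
  subst h; rfl

theorem outcome_u₂_of_root_eq {π : Profile (.node p n c)} {i : Fin (n + 1)} (h : π.root = i) :
    (outcome π).u₂ = (outcome (π.sub i)).u₂ := by
  subst h; rfl

theorem State.above_there_iff {i : Fin (n + 1)} {s t : State (c i)} :
    (State.there (p := p) i s).Above (.there i t) ↔ s.Above t := by
  constructor
  · intro h
    cases h with
    | there _ h => exact h
  · exact .there i

theorem State.not_above_here {i : Fin (n + 1)} {s : State (c i)} :
    ¬ (State.there (p := p) i s).Above .here := by
  intro h
  cases h

theorem State.Above.index_eq {i j : Fin (n + 1)} {s : State (c i)} {t : State (c j)}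
    (h : (State.there (p := p) i s).Above (.there j t)) : i = j := by
  cases h; rfl

theorem isBehavioral_node {σ : Weights (.node p n c)} :
    IsBehavioral σ ↔ σ.root ∈ stdSimplex ℝ (Fin (n + 1)) ∧ ∀ i, IsBehavioral (σ.sub i) := by
  constructor
  · exact fun h => ⟨h .here, fun i s => h (.there i s)⟩
  · rintro ⟨h, h'⟩ (_ | ⟨i, s⟩)
    · exact h
    · exact h' i s

end Sub

theorem card_terminal_pos : ∀ G : GameTree, 0 < Fintype.card G.Terminal
  | .leaf _ _ => Fintype.card_pos_iff.2 ⟨.here⟩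
  | .node _ _ c => by
    rw [card_terminal]
    exact Finset.sum_pos (fun i _ => card_terminal_pos (c i)) Finset.univ_nonempty

/-! ## Expected utilities -/

/-- The leader's expected utility under a behavioral strategy profile. -/
noncomputable def expU₁ {G : GameTree} (σ : Weights G) : ℝ :=
  ∑ z : Terminal G, z.u₁ * reachProb σ z

theorem expU₁_leaf {u v : ℝ} (σ : Weights (.leaf u v)) : expU₁ σ = u := by
  have : (Finset.univ : Finset (Terminal (.leaf u v))) = {.here} := rfl
  rw [expU₁, this, Finset.sum_singleton]
  simp [Terminal.u₁, reachProb]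

theorem expU₂_leaf {u v : ℝ} (σ : Weights (.leaf u v)) : expU₂ σ = v := by
  have : (Finset.univ : Finset (Terminal (.leaf u v))) = {.here} := rfl
  rw [expU₂, this, Finset.sum_singleton]
  simp [Terminal.u₂, reachProb]

theorem expU₁_node {p : Player} {n : ℕ} {c : Fin (n + 1) → GameTree} (σ : Weights (.node p n c)) :
    expU₁ σ = ∑ i, σ.root i * expU₁ (σ.sub i) := by
  rw [expU₁, sum_terminal]
  refine Finset.sum_congr rfl fun i _ => ?_
  rw [expU₁, Finset.mul_sum]
  refine Finset.sum_congr rfl fun z _ => ?_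
  simp only [Terminal.u₁, reachProb, Weights.root]
  exact mul_left_comm _ _ _

theorem expU₂_node {p : Player} {n : ℕ} {c : Fin (n + 1) → GameTree} (σ : Weights (.node p n c)) :
    expU₂ σ = ∑ i, σ.root i * expU₂ (σ.sub i) := by
  rw [expU₂, sum_terminal]
  refine Finset.sum_congr rfl fun i _ => ?_
  rw [expU₂, Finset.mul_sum]
  refine Finset.sum_congr rfl fun z _ => ?_
  simp only [Terminal.u₂, reachProb, Weights.root]
  exact mul_left_comm _ _ _

/-! ## The minmax value -/

/-- The utility of the follower if the leader minimizes it and the follower best responds. -/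
noncomputable def value : GameTree → ℝ
  | .leaf _ v => v
  | .node .leader _ c => Finset.univ.inf' Finset.univ_nonempty fun i => value (c i)
  | .node .follower _ c => Finset.univ.sup' Finset.univ_nonempty fun i => value (c i)

theorem value_leader_le {n : ℕ} (c : Fin (n + 1) → GameTree) (i : Fin (n + 1)) :
    value (.node .leader n c) ≤ value (c i) :=
  Finset.inf'_le _ (Finset.mem_univ i)

theorem le_value_follower {n : ℕ} (c : Fin (n + 1) → GameTree) (i : Fin (n + 1)) :
    value (c i) ≤ value (.node .follower n c) :=
  Finset.le_sup' (fun i => value (c i)) (Finset.mem_univ i)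

theorem exists_value_eq (p : Player) {n : ℕ} (c : Fin (n + 1) → GameTree) :
    ∃ i, value (c i) = value (.node p n c) := by
  cases p
  · obtain ⟨i, -, h⟩ := Finset.exists_mem_eq_inf' (Finset.univ_nonempty) fun i => value (c i)
    exact ⟨i, h.symm⟩
  · obtain ⟨i, -, h⟩ := Finset.exists_mem_eq_sup' (Finset.univ_nonempty) fun i => value (c i)
    exact ⟨i, h.symm⟩

/-- An action that attains the minmax value. -/
noncomputable def optAction (p : Player) {n : ℕ} (c : Fin (n + 1) → GameTree) : Fin (n + 1) :=
  (exists_value_eq p c).choose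

theorem value_optAction (p : Player) {n : ℕ} (c : Fin (n + 1) → GameTree) :
    value (c (optAction p c)) = value (.node p n c) :=
  (exists_value_eq p c).choose_spec

/-- A pure minmax profile. -/
noncomputable def punishment : (G : GameTree) → Weights G
  | .leaf _ _ => fun s => nomatch s
  | .node p _ c => .glue (Pi.single (optAction p c) 1) fun i => punishment (c i)

theorem punishment_isBehavioral : ∀ G : GameTree, IsBehavioral (punishment G)
  | .leaf _ _ => fun s => nomatch s
  | .node _ _ c => isBehavioral_node.2
      ⟨single_mem_stdSimplex ℝ _, fun i => punishment_isBehavioral (c i)⟩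

theorem expU₂_punishment : ∀ G : GameTree, expU₂ (punishment G) = value G
  | .leaf _ _ => expU₂_leaf _
  | .node p n c => by
    have ih (i) : expU₂ ((punishment (.node p n c)).sub i) = value (c i) := expU₂_punishment (c i)
    have h : (punishment (.node p n c)).root = Pi.single (optAction p c) 1 := rfl
    simp only [expU₂_node, h, ih, Pi.single_apply, ite_mul, one_mul, zero_mul,
      Finset.sum_ite_eq', Finset.mem_univ, if_true, value_optAction]

/-- The bound is required only where the weight is positive, because play and obedience are
controlled only on actions in use. -/
theorem sum_stdSimplex_mul_le {n : ℕ} {w f : Fin (n + 1) → ℝ} {v : ℝ}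
    (hw : w ∈ stdSimplex ℝ (Fin (n + 1))) (h : ∀ i, 0 < w i → f i ≤ v) : ∑ i, w i * f i ≤ v := by
  calc ∑ i, w i * f i ≤ ∑ i, w i * v := by
        refine Finset.sum_le_sum fun i _ => ?_
        rcases (hw.1 i).eq_or_lt with h0 | h0
        · rw [← h0]; simp
        · exact mul_le_mul_of_nonneg_left (h i h0) h0.le
    _ = v := by rw [← Finset.sum_mul, hw.2, one_mul]

/-- Backward induction: at a leader root the punishment is a point mass on a minimizing action, so a
single subtree counts; at a follower root every subtree is bounded by the maximum. -/
theorem expU₂_le_value : ∀ {G : GameTree} (τ : Weights G), IsBehavioral τ →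
    (∀ s, s.owner = .leader → τ s = punishment G s) → expU₂ τ ≤ value G
  | .leaf _ _, τ, _, _ => (expU₂_leaf τ).le
  | .node p n c, τ, hτ, h => by
    rw [isBehavioral_node] at hτ
    have ih (i) : expU₂ (τ.sub i) ≤ value (c i) :=
      expU₂_le_value _ (hτ.2 i) fun s hs => h (.there i s) hs
    rw [expU₂_node]
    refine sum_stdSimplex_mul_le hτ.1 fun i hi => ?_
    cases p
    · have h1 : τ.root = Pi.single (optAction .leader c) 1 := h .here rfl
      have : i = optAction .leader c := by
        by_contra h2
        rw [h1, Pi.single_eq_of_ne h2] at hi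
        exact lt_irrefl _ hi
      rw [← value_optAction, ← this]
      exact ih i
    · exact (ih i).trans (le_value_follower c i)

/-- The other half of the minmax property, by backward induction: the follower moves to a child of
maximal value, and averaging over leader actions cannot fall below the minimum. -/
theorem exists_best_response : ∀ {G : GameTree} (τ : Weights G), IsBehavioral τ →
    ∃ τ' : Weights G, IsBehavioral τ' ∧ (∀ s, s.owner = .leader → τ' s = τ s) ∧ value G ≤ expU₂ τ'
  | .leaf _ _, τ, hτ => ⟨τ, hτ, fun _ _ => rfl, (expU₂_leaf τ).ge⟩
  | .node p n c, τ, hτ => by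
    rw [isBehavioral_node] at hτ
    choose f hf hl hv using fun i => exists_best_response (τ.sub i) (hτ.2 i)
    cases p
    · refine ⟨.glue τ.root f, isBehavioral_node.2 ⟨hτ.1, hf⟩, ?_, ?_⟩
      · rintro (_ | ⟨i, s⟩) hs
        · rfl
        · exact hl i s hs
      · rw [expU₂_node, ← neg_le_neg_iff, ← Finset.sum_neg_distrib]
        simp only [← mul_neg]
        exact sum_stdSimplex_mul_le hτ.1 fun i _ =>
          neg_le_neg ((value_leader_le c i).trans (hv i))
    · refine ⟨.glue (Pi.single (optAction .follower c) 1) f,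
        isBehavioral_node.2 ⟨single_mem_stdSimplex ℝ _, hf⟩, ?_, ?_⟩
      · rintro (_ | ⟨i, s⟩) hs
        · cases hs
        · exact hl i s hs
      · simp only [expU₂_node, Weights.root_glue, Weights.sub_glue, Pi.single_apply, ite_mul,
          one_mul, zero_mul, Finset.sum_ite_eq', Finset.mem_univ, if_true]
        rw [← value_optAction]
        exact hv _

theorem punishment_isMinmaxAtRoot (G : GameTree) : IsMinmaxAtRoot (punishment G) := by
  rw [IsMinmaxAtRoot, expU₂_punishment]
  exact ⟨expU₂_le_value, exists_best_response⟩

theorem punishment_isMinmax (G : GameTree) : IsMinmax (punishment G) := by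
  refine ⟨punishment_isBehavioral G, ?_⟩
  induction G with
  | leaf => trivial
  | node p n c ih => exact ⟨punishment_isMinmaxAtRoot _, ih⟩

/-! ## Frontiers -/

/-- A pair of utilities that is attainable in a game: `x` for the follower and `y` for the leader,
with a mark for the action at the root by which it is attained. -/
structure Pt where
  x : ℝ
  y : ℝ
  tag : ℝ

/-- The point `(x, y)` lies in the `w`-fold of the downward closure of the convex hull of `L`. -/
def Below (L : List Pt) (w x y : ℝ) : Prop :=
  ∀ α β h : ℝ, 0 ≤ α → (∀ P ∈ L, α * P.y + β * P.x ≤ h) → α * y + β * x ≤ h * w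

theorem Below.of_mem {L : List Pt} {P : Pt} (h : P ∈ L) : Below L 1 P.x P.y :=
  fun _ _ _ _ hL => (hL P h).trans (mul_one _).ge

/-- Masses add along with the utilities, so contributions of different root actions can be summed
unnormalized. This takes the place of forming convex combinations. -/
theorem Below.sum {ι : Type*} {L : List Pt} {T : Finset ι} {w x y : ι → ℝ}
    (h : ∀ i ∈ T, Below L (w i) (x i) (y i)) :
    Below L (∑ i ∈ T, w i) (∑ i ∈ T, x i) (∑ i ∈ T, y i) := by
  intro α β k hα hL
  simp only [Finset.mul_sum, ← Finset.sum_add_distrib]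
  exact Finset.sum_le_sum fun i hi => h i hi α β k hα hL

/-- Finiteness turns pointwise strict bounds into a uniform gap, even for the empty list; a test
functional in `Below` can then give a strict contradiction. -/
theorem exists_lt_of_forall_lt {α : Type*} (L : List α) (f : α → ℝ) {b : ℝ}
    (h : ∀ P ∈ L, f P < b) : ∃ m < b, ∀ P ∈ L, f P ≤ m := by
  induction L with
  | nil => exact ⟨b - 1, by simp⟩
  | cons P L ih =>
    obtain ⟨m, hm, hL⟩ := ih fun Q hQ => h Q (List.mem_cons_of_mem _ hQ)
    refine ⟨max m (f P), max_lt hm (h P List.mem_cons_self), ?_⟩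
    intro Q hQ
    rcases List.mem_cons.1 hQ with rfl | hQ
    · exact le_max_right _ _
    · exact (hL Q hQ).trans (le_max_left _ _)

theorem exists_forall_le {α : Type*} (L : List α) (f : α → ℝ) : ∃ h, ∀ P ∈ L, f P ≤ h := by
  obtain ⟨h, hh⟩ := (L.finite_toSet.image f).bddAbove
  exact ⟨h, fun P hP => hh ⟨P, hP, rfl⟩⟩

theorem Below.exists_x_le {L : List Pt} {x y : ℝ} (h : Below L 1 x y) : ∃ P ∈ L, P.x ≤ x := by
  by_contra! h'
  obtain ⟨m, hm, hL⟩ := exists_lt_of_forall_lt L (fun P => -P.x) fun P hP => neg_lt_neg (h' P hP)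
  have := h 0 (-1) m le_rfl fun P hP => by linarith [hL P hP]
  linarith

theorem Below.exists_le_x {L : List Pt} {x y : ℝ} (h : Below L 1 x y) : ∃ P ∈ L, x ≤ P.x := by
  by_contra! h'
  obtain ⟨m, hm, hL⟩ := exists_lt_of_forall_lt L Pt.x h'
  have := h 0 1 m le_rfl fun P hP => by linarith [hL P hP]
  linarith

/-- The points of `L` are attainable in a node with value `v` whose subtrees have the frontiers
`Ls`, and they dominate all attainable points. -/
structure IsNodeFrontier {n : ℕ} (v : ℝ) (Ls : Fin (n + 1) → List Pt) (L : List Pt) : Prop where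
  sound : ∀ P ∈ L, ∃ i : Fin (n + 1), P.tag = (i : ℕ) ∧ v ≤ P.x ∧ Below (Ls i) 1 P.x P.y
  complete : ∀ i w x y, 0 ≤ w → v * w ≤ x → Below (Ls i) w x y → Below L w x y

/-- A list of points whose convex hull has the same upper boundary as the set of all pairs of
utilities attainable with incentive compatible play. -/
inductive IsFrontier : GameTree → List Pt → Prop
  | leaf (u v : ℝ) : IsFrontier (.leaf u v) [⟨v, u, 0⟩]
  | node {p : Player} {n : ℕ} {c : Fin (n + 1) → GameTree} {Ls : Fin (n + 1) → List Pt}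
      {L : List Pt} (hs : ∀ i, IsFrontier (c i) (Ls i))
      (h : IsNodeFrontier (value (.node p n c)) Ls L) : IsFrontier (.node p n c) L

/-! ## Bounds for incentive compatible play -/

theorem State.numActions_pos {G : GameTree} (s : State G) : 0 < s.numActions := by
  induction s with
  | here => exact Nat.succ_pos _
  | there _ _ ih => exact ih

section Bounds

variable {Ω : Type*}

open Classical in
/-- Incentive compatibility of a random profile `X` under the weights `φ` on `T`. -/
def ICOn {G : GameTree} (T : Finset Ω) (φ : Ω → ℝ) (X : Ω → Profile G) : Prop :=
  ∀ s : State G, s.owner = .follower → ∀ a : Fin s.numActions,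
    ∀ d : (t : State G) → Profile G → Fin t.numActions, IsPlan d →
      ∑ ω ∈ T with Reaches (X ω) s ∧ X ω s = a, φ ω * (outcome (deviate s d (X ω))).u₂ ≤
        ∑ ω ∈ T with Reaches (X ω) s ∧ X ω s = a, φ ω * (outcome (X ω)).u₂

theorem isIncentiveCompatible_iff {G : GameTree} {φ : Profile G → ℝ} :
    IsIncentiveCompatible φ ↔ ICOn Finset.univ φ id := Iff.rfl

/-! ### Incentive compatibility passes to subtrees -/

section Node

variable {p : Player} {n : ℕ} {c : Fin (n + 1) → GameTree}

/-- The plan that follows `dd i` in the `i`-th subtree and uses the action `f π.root` at the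
root. -/
def liftPlan (f : Fin (n + 1) → Fin (n + 1))
    (dd : ∀ i, (t : State (c i)) → Profile (c i) → Fin t.numActions) :
    (t : State (.node p n c)) → Profile (.node p n c) → Fin t.numActions
  | .here, π => f π.root
  | .there i t, π => dd i t (π.sub i)

theorem isPlan_liftPlan {f : Fin (n + 1) → Fin (n + 1)}
    {dd : ∀ i, (t : State (c i)) → Profile (c i) → Fin t.numActions} (hd : ∀ i, IsPlan (dd i))
    (hf : p = .follower ∨ ∀ a b, f a = f b) : IsPlan (liftPlan (p := p) f dd) := by
  rintro (_ | ⟨i, t⟩) π π' h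
  · rcases hf with rfl | hf
    · exact congrArg f (h .here (.root _) rfl)
    · exact hf _ _
  · exact hd i t _ _ fun r hr ho => h (.there i r) (.there i hr) ho

theorem root_deviate_there {i : Fin (n + 1)} {s : State (c i)}
    {d : (t : State (.node p n c)) → Profile (.node p n c) → Fin t.numActions}
    (π : Profile (.node p n c)) : (deviate (.there i s) d π).root = π.root := by
  unfold Profile.root deviate
  rw [if_neg fun h => State.not_above_here h.2]

theorem sub_deviate_there {i : Fin (n + 1)} {s : State (c i)} {f : Fin (n + 1) → Fin (n + 1)}
    {dd : ∀ i, (t : State (c i)) → Profile (c i) → Fin t.numActions} (π : Profile (.node p n c)) :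
    (deviate (.there i s) (liftPlan f dd) π).sub i = deviate s (dd i) (π.sub i) := by
  funext t
  by_cases h : t.owner = .follower ∧ s.Above t
  · exact (if_pos ⟨h.1, .there i h.2⟩).trans (if_pos h).symm
  · exact (if_neg fun h' => h ⟨h'.1, State.above_there_iff.1 h'.2⟩).trans (if_neg h).symm

/-- A plan in the subtree extends to a plan in the whole game, and a deviation that starts inside
the subtree does not touch the root. Conditioning on the root action only shrinks the index set `T`;
this is why `ICOn` allows arbitrary weights on an arbitrary index type. -/
theorem ICOn.sub {T : Finset Ω} {φ : Ω → ℝ} {X : Ω → Profile (.node p n c)} (h : ICOn T φ X)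
    (i : Fin (n + 1)) : ICOn {ω ∈ T | (X ω).root = i} φ fun ω => (X ω).sub i := by
  classical
  intro s hs a d hd
  -- Outside the chosen subtree any plan will do; a constant action is admissible for every
  -- information.
  let dd : ∀ i, (t : State (c i)) → Profile (c i) → Fin t.numActions :=
    Function.update (fun _ t _ => ⟨0, t.numActions_pos⟩) i d
  have hdd : dd i = d := Function.update_self ..
  have hplan : ∀ j, IsPlan (dd j) := by
    intro j
    by_cases hj : j = i
    · subst hj; rwa [hdd]
    · intro t π π' _
      simp only [dd, Function.update_of_ne hj]
  have key := h (.there i s) hs a (liftPlan (fun _ => 0) dd)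
    (isPlan_liftPlan hplan (.inr fun _ _ => rfl))
  refine (Eq.le ?_).trans (key.trans (Eq.le ?_))
  · refine Finset.sum_congr ?_ fun ω hω => ?_
    · ext ω
      simp only [Finset.mem_filter, and_assoc]
      exact and_congr_right fun _ => and_assoc.symm
    · simp only [Finset.mem_filter] at hω
      rw [outcome_u₂_of_root_eq ((root_deviate_there _).trans hω.2.1.1), sub_deviate_there, hdd]
  · refine Finset.sum_congr ?_ fun ω hω => ?_
    · ext ω
      simp only [Finset.mem_filter, and_assoc]
      exact and_congr_right fun _ => and_assoc
    · simp only [Finset.mem_filter] at hω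
      rw [outcome_u₂_of_root_eq hω.1.2]

end Node

open Classical in
/-- The profile in which the follower plays `g` and the leader plays `π`. -/
noncomputable def reply {G : GameTree} (g π : Profile G) : Profile G :=
  fun t => if t.owner = .follower then g t else π t

theorem sum_root {p : Player} {n : ℕ} {c : Fin (n + 1) → GameTree} (T : Finset Ω)
    (X : Ω → Profile (.node p n c)) (f : Ω → ℝ) :
    ∑ ω ∈ T, f ω = ∑ i, ∑ ω ∈ T with (X ω).root = i, f ω :=
  (Finset.sum_fiberwise T (fun ω => (X ω).root) f).symm

/-- One reply, fixed before any recommendation, secures the value against correlated play of the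
leader. In a tree it can be chosen by backward induction: each leader action leads to its own
subtree, so the replies there can be adapted to the conditional weights independently. -/
theorem exists_reply {G : GameTree} (T : Finset Ω) (φ : Ω → ℝ) (hφ : ∀ ω, 0 ≤ φ ω)
    (X : Ω → Profile G) :
    ∃ g, value G * ∑ ω ∈ T, φ ω ≤ ∑ ω ∈ T, φ ω * (outcome (reply g (X ω))).u₂ := by
  induction G generalizing T with
  | leaf u v =>
    refine ⟨fun s => (nomatch s), ?_⟩
    simp only [value, outcome, Terminal.u₂, ← Finset.sum_mul, mul_comm v, le_refl]
  | node p n c ih =>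
    cases p
    · choose g hg using fun i => ih i {ω ∈ T | (X ω).root = i} fun ω => (X ω).sub i
      -- The root belongs to the leader, so the action 0 entered there for the follower is never
      -- played.
      refine ⟨.glue 0 g, ?_⟩
      rw [sum_root T X, sum_root T X, Finset.mul_sum]
      refine Finset.sum_le_sum fun i _ => ?_
      refine (mul_le_mul_of_nonneg_right (value_leader_le c i)
        (Finset.sum_nonneg fun ω _ => hφ ω)).trans ((hg i).trans_eq ?_)
      refine Finset.sum_congr rfl fun ω hω => ?_
      have hr : (reply (.glue 0 g) (X ω)).root = i := by
        rw [← (Finset.mem_filter.1 hω).2]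
        exact if_neg (by simp [State.owner])
      rw [outcome_u₂_of_root_eq hr]
      rfl
    · obtain ⟨g, hg⟩ := ih (optAction .follower c) T fun ω => (X ω).sub (optAction .follower c)
      classical
      -- These replies merely fill the subtrees that the follower avoids.
      choose g₀ _ using fun i => ih i T fun ω => (X ω).sub i
      refine ⟨.glue (optAction .follower c) (Function.update g₀ _ g), ?_⟩
      rw [← value_optAction]
      refine hg.trans_eq (Finset.sum_congr rfl fun ω _ => ?_)
      have hr : (reply (.glue (optAction .follower c) (Function.update g₀ _ g)) (X ω)).root =
          optAction .follower c := if_pos rfl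
      rw [outcome_u₂_of_root_eq hr]
      congr 3
      funext t
      by_cases ht : t.owner = .follower
      · refine (if_pos ht).trans (Eq.trans ?_ (if_pos ht).symm)
        exact (congrFun (Function.update_self (optAction .follower c) g g₀) t).symm
      · exact (if_neg ht).trans (if_neg ht).symm

/-- The necessary condition at a follower state. On the event that action `i` is recommended, the
follower may switch to the reply of `exists_reply` for exactly this event; incentive compatibility
says that obeying is at least as good. -/
theorem ICOn.value_mul_le_of_follower {n : ℕ} {c : Fin (n + 1) → GameTree} {T : Finset Ω}
    {φ : Ω → ℝ} (hφ : ∀ ω, 0 ≤ φ ω) {X : Ω → Profile (.node .follower n c)} (h : ICOn T φ X)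
    (i : Fin (n + 1)) :
    value (.node .follower n c) * ∑ ω ∈ T with (X ω).root = i, φ ω ≤
      ∑ ω ∈ T with (X ω).root = i, φ ω * (outcome ((X ω).sub i)).u₂ := by
  classical
  obtain ⟨g, hg⟩ := exists_reply {ω ∈ T | (X ω).root = i} φ hφ X
  refine hg.trans ?_
  -- A plan that ignores all recommendations trivially respects the information structure.
  have key := h .here rfl i (fun t _ => g t) fun _ _ _ _ => rfl
  refine (Eq.le ?_).trans (key.trans (Eq.le ?_))
  · refine Finset.sum_congr ?_ fun ω _ => ?_
    · ext ω
      simp only [Finset.mem_filter]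
      exact and_congr_right fun _ => (and_iff_right trivial).symm
    · congr 3
      funext t
      simp only [reply, deviate, State.Above.root, and_true]
  · refine Finset.sum_congr ?_ fun ω hω => ?_
    · ext ω
      simp only [Finset.mem_filter]
      exact and_congr_right fun _ => and_iff_right trivial
    · simp only [Finset.mem_filter] at hω
      rw [outcome_u₂_of_root_eq hω.2]

theorem ICOn.value_mul_le {G : GameTree} {T : Finset Ω} {φ : Ω → ℝ} (hφ : ∀ ω, 0 ≤ φ ω)
    {X : Ω → Profile G} (h : ICOn T φ X) :
    value G * ∑ ω ∈ T, φ ω ≤ ∑ ω ∈ T, φ ω * (outcome (X ω)).u₂ := by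
  induction G generalizing T with
  | leaf u v =>
    simp only [value, outcome, Terminal.u₂, ← Finset.sum_mul, mul_comm v, le_refl]
  | node p n c ih =>
    rw [sum_root T X, sum_root T X, Finset.mul_sum]
    refine Finset.sum_le_sum fun i _ => ?_
    have (ω) (hω : ω ∈ {ω ∈ T | (X ω).root = i}) :
        φ ω * (outcome (X ω)).u₂ = φ ω * (outcome ((X ω).sub i)).u₂ := by
      rw [outcome_u₂_of_root_eq (Finset.mem_filter.1 hω).2]
    rw [Finset.sum_congr rfl this]
    cases p
    · exact (mul_le_mul_of_nonneg_right (value_leader_le c i)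
        (Finset.sum_nonneg fun ω _ => hφ ω)).trans (ih i (h.sub i))
    · exact h.value_mul_le_of_follower hφ i

theorem ICOn.value_node_mul_le {p : Player} {n : ℕ} {c : Fin (n + 1) → GameTree} {T : Finset Ω}
    {φ : Ω → ℝ} (hφ : ∀ ω, 0 ≤ φ ω) {X : Ω → Profile (.node p n c)} (h : ICOn T φ X)
    (i : Fin (n + 1)) :
    value (.node p n c) * ∑ ω ∈ T with (X ω).root = i, φ ω ≤
      ∑ ω ∈ T with (X ω).root = i, φ ω * (outcome ((X ω).sub i)).u₂ := by
  cases p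
  · exact (mul_le_mul_of_nonneg_right (value_leader_le c i)
      (Finset.sum_nonneg fun ω _ => hφ ω)).trans ((h.sub i).value_mul_le hφ)
  · exact h.value_mul_le_of_follower hφ i

/-- The utilities of incentive compatible play lie below the frontier. -/
theorem ICOn.below {G : GameTree} {L : List Pt} (hL : IsFrontier G L) {T : Finset Ω} {φ : Ω → ℝ}
    (hφ : ∀ ω, 0 ≤ φ ω) {X : Ω → Profile G} (h : ICOn T φ X) :
    Below L (∑ ω ∈ T, φ ω) (∑ ω ∈ T, φ ω * (outcome (X ω)).u₂)
      (∑ ω ∈ T, φ ω * (outcome (X ω)).u₁) := by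
  induction hL generalizing T with
  | leaf u v =>
    simp only [outcome, Terminal.u₂, Terminal.u₁, ← Finset.sum_mul]
    intro α β k _ hk
    have h1 := hk _ List.mem_cons_self
    have h2 := mul_le_mul_of_nonneg_right h1 (Finset.sum_nonneg fun ω (_ : ω ∈ T) => hφ ω)
    dsimp only at h2
    linarith
  | @node p n c Ls L _ hF ih =>
    rw [sum_root T X, sum_root T X (fun ω => _ * Terminal.u₂ _),
      sum_root T X (fun ω => _ * Terminal.u₁ _)]
    refine Below.sum fun i _ => ?_
    have h₁ (ω) (hω : ω ∈ {ω ∈ T | (X ω).root = i}) :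
        φ ω * (outcome (X ω)).u₁ = φ ω * (outcome ((X ω).sub i)).u₁ := by
      rw [outcome_u₁_of_root_eq (Finset.mem_filter.1 hω).2]
    have h₂ (ω) (hω : ω ∈ {ω ∈ T | (X ω).root = i}) :
        φ ω * (outcome (X ω)).u₂ = φ ω * (outcome ((X ω).sub i)).u₂ := by
      rw [outcome_u₂_of_root_eq (Finset.mem_filter.1 hω).2]
    rw [Finset.sum_congr rfl h₁, Finset.sum_congr rfl h₂]
    -- The child's pair lies below the child's frontier by induction and right of the value by
    -- incentive compatibility, hence survives the cut.
    exact hF.complete i _ _ _ (Finset.sum_nonneg fun ω _ => hφ ω) (h.value_node_mul_le hφ i)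
      (ih i (h.sub i))

end Bounds

/-! ## Obedient strategy profiles -/

/-- The probability of a pure profile if the actions are drawn independently. -/
noncomputable def profileProb {G : GameTree} (σ : Weights G) (π : Profile G) : ℝ :=
  ∏ s : State G, σ s (π s)

/-- Every action that a reached follower state uses gives the follower at least the value of the
state. -/
def Obedient : {G : GameTree} → Weights G → Prop
  | .leaf _ _, _ => True
  | .node p n c, σ => ∀ i : Fin (n + 1), 0 < σ .here i →
      Obedient (G := c i) (fun t => σ (.there i t)) ∧
      (p = .follower → value (.node p n c) ≤ expU₂ (G := c i) fun t => σ (.there i t))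

/-! ### Product distributions on profiles -/

section Sums

/-- Marginalization: absorbing `H` into the factor `b` makes the sum factor over the coordinates,
and all other factors have total mass 1. -/
theorem sum_pi_prod_mul {ι : Type*} [Fintype ι] [DecidableEq ι] {β : ι → Type*}
    [∀ i, Fintype (β i)] (g : ∀ i, β i → ℝ) (b : ι) (hg : ∀ i, i ≠ b → ∑ y, g i y = 1)
    (H : β b → ℝ) : ∑ x : ∀ i, β i, (∏ i, g i (x i)) * H (x b) = ∑ y, g b y * H y := by
  let g' : ∀ i, β i → ℝ := Function.update g b fun y => g b y * H y
  have h₁ (x : ∀ i, β i) : (∏ i, g i (x i)) * H (x b) = ∏ i, g' i (x i) := by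
    rw [← Finset.mul_prod_erase _ _ (Finset.mem_univ b),
      ← Finset.mul_prod_erase _ (fun i => g' i (x i)) (Finset.mem_univ b)]
    have : ∏ i ∈ Finset.univ.erase b, g' i (x i) = ∏ i ∈ Finset.univ.erase b, g i (x i) :=
      Finset.prod_congr rfl fun i hi => by
        simp only [g', Function.update_of_ne (Finset.ne_of_mem_erase hi)]
    rw [this]
    simp only [g', Function.update_self]
    ring
  rw [Finset.sum_congr rfl fun x _ => h₁ x, ← Fintype.piFinset_univ, ← Finset.prod_univ_sum,
    ← Finset.mul_prod_erase _ _ (Finset.mem_univ b), Finset.prod_eq_one, mul_one]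
  · simp only [g', Function.update_self]
  · intro i hi
    simp only [g', Function.update_of_ne (Finset.ne_of_mem_erase hi)]
    exact hg i (Finset.ne_of_mem_erase hi)

variable {p : Player} {n : ℕ} {c : Fin (n + 1) → GameTree}

theorem sum_profile_root (a : Fin (n + 1)) (f : Profile (.node p n c) → ℝ) :
    ∑ π with π.root = a, f π = ∑ x : ∀ i, Profile (c i), f (.glue a x) := by
  rw [Finset.sum_filter, ← profileEquiv.sum_comp, Fintype.sum_prod_type, Finset.sum_eq_single a]
  · exact Finset.sum_congr rfl fun x _ => if_pos rfl
  · intro b _ hb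
    exact Finset.sum_eq_zero fun x _ => if_neg hb
  · exact fun h => (h (Finset.mem_univ a)).elim

theorem sum_profile (f : Profile (.node p n c) → ℝ) :
    ∑ π, f π = ∑ a, ∑ π with π.root = a, f π :=
  (Finset.sum_fiberwise _ Profile.root f).symm

theorem profileProb_glue (σ : Weights (.node p n c)) (a : Fin (n + 1)) (x : ∀ i, Profile (c i)) :
    profileProb σ (.glue a x) = σ.root a * ∏ i, profileProb (σ.sub i) (x i) :=
  prod_state _

/-- The recursive structure of the distribution: once the root action `a` is drawn, the subtrees are
independent, the one behind `a` is again of the same kind, and all others carry pure punishment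
because no state in them is reached. -/
theorem followOrPunish_glue (σ σm : Weights (.node p n c)) (a : Fin (n + 1))
    (x : ∀ i, Profile (c i)) :
    followOrPunish σ σm (.glue a x) = σ.root a *
      ∏ i, if i = a then followOrPunish (σ.sub i) (σm.sub i) (x i)
        else profileProb (σm.sub i) (x i) := by
  rw [followOrPunish, prod_state]
  congr 1
  · exact if_pos trivial
  · refine Finset.prod_congr rfl fun i _ => ?_
    split_ifs with h
    · refine Finset.prod_congr rfl fun s _ => ?_
      by_cases hs : Reaches (x i) s
      · exact (if_pos ⟨h.symm, hs⟩).trans (if_pos hs).symm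
      · exact (if_neg fun h' => hs h'.2).trans (if_neg hs).symm
    · exact Finset.prod_congr rfl fun s _ => if_neg fun h' => h h'.1.symm

theorem sum_profileProb : ∀ {G : GameTree} {σ : Weights G}, IsBehavioral σ →
    ∑ π, profileProb σ π = 1
  | .leaf u v, σ, _ => by
    have : IsEmpty (State (.leaf u v)) := ⟨fun s => nomatch s⟩
    simp [profileProb]
  | .node p n c, σ, h => by
    rw [isBehavioral_node] at h
    rw [sum_profile, ← h.1.2]
    refine Finset.sum_congr rfl fun a _ => ?_
    rw [sum_profile_root]
    simp only [profileProb_glue]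
    rw [← Finset.mul_sum]
    have := sum_pi_prod_mul (fun i => profileProb (σ.sub i)) a
      (fun i _ => sum_profileProb (h.2 i)) fun _ => 1
    simp only [mul_one] at this
    rw [this, sum_profileProb (h.2 a), mul_one]

theorem sum_profileProb_mul {σ : Weights (.node p n c)} (h : IsBehavioral σ) (a b : Fin (n + 1))
    (H : Profile (c b) → ℝ) :
    ∑ π with π.root = a, profileProb σ π * H (π.sub b) =
      σ.root a * ∑ π, profileProb (σ.sub b) π * H π := by
  rw [sum_profile_root]
  simp only [profileProb_glue, Profile.sub_glue, mul_assoc]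
  rw [← Finset.mul_sum, sum_pi_prod_mul (fun i => profileProb (σ.sub i)) b
    fun i _ => sum_profileProb ((isBehavioral_node.1 h).2 i)]

theorem sum_followOrPunish {G : GameTree} {σ σm : Weights G} (h : IsBehavioral σ)
    (hm : IsBehavioral σm) : ∑ π, followOrPunish σ σm π = 1 := by
  induction G with
  | leaf u v =>
    have : IsEmpty (State (.leaf u v)) := ⟨fun s => nomatch s⟩
    simp [followOrPunish]
  | node p n c ih =>
    rw [isBehavioral_node] at h hm
    rw [sum_profile, ← h.1.2]
    refine Finset.sum_congr rfl fun a _ => ?_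
    rw [sum_profile_root]
    simp only [followOrPunish_glue]
    rw [← Finset.mul_sum]
    have := sum_pi_prod_mul (fun i π => if i = a then followOrPunish (σ.sub i) (σm.sub i) π
        else profileProb (σm.sub i) π) a
      (fun i hi => by simp only [if_neg hi]; exact sum_profileProb (hm.2 i)) fun _ => 1
    simp only [mul_one, if_true] at this
    rw [this, ih a (h.2 a) (hm.2 a), mul_one]

/-- What a deviator meets: in a subtree other than the recommended one the play is distributed
according to `σm`, independently of the recommendation. -/
theorem sum_followOrPunish_mul_of_ne {σ σm : Weights (.node p n c)} (h : IsBehavioral σ)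
    (hm : IsBehavioral σm) {a b : Fin (n + 1)} (hb : b ≠ a) (H : Profile (c b) → ℝ) :
    ∑ π with π.root = a, followOrPunish σ σm π * H (π.sub b) =
      σ.root a * ∑ π, profileProb (σm.sub b) π * H π := by
  rw [sum_profile_root]
  simp only [followOrPunish_glue, Profile.sub_glue, mul_assoc]
  rw [isBehavioral_node] at h hm
  rw [← Finset.mul_sum, sum_pi_prod_mul (fun i π => if i = a then
    followOrPunish (σ.sub i) (σm.sub i) π else profileProb (σm.sub i) π) b]
  · simp only [if_neg hb]
  · intro i _
    split_ifs with hi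
    · exact sum_followOrPunish (h.2 i) (hm.2 i)
    · exact sum_profileProb (hm.2 i)

theorem sum_followOrPunish_mul {σ σm : Weights (.node p n c)}
    (hm : IsBehavioral σm) (a : Fin (n + 1)) (H : Profile (c a) → ℝ) :
    ∑ π with π.root = a, followOrPunish σ σm π * H (π.sub a) =
      σ.root a * ∑ π, followOrPunish (σ.sub a) (σm.sub a) π * H π := by
  rw [sum_profile_root]
  simp only [followOrPunish_glue, Profile.sub_glue, mul_assoc]
  rw [isBehavioral_node] at hm
  rw [← Finset.mul_sum, sum_pi_prod_mul (fun i π => if i = a then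
    followOrPunish (σ.sub i) (σm.sub i) π else profileProb (σm.sub i) π) a]
  · simp only [if_true]
  · intro i hi
    simp only [if_neg hi]
    exact sum_profileProb (hm.2 i)

end Sums

theorem followOrPunish_nonneg {G : GameTree} {σ σm : Weights G} (h : IsBehavioral σ)
    (hm : IsBehavioral σm) (π : Profile G) : 0 ≤ followOrPunish σ σm π :=
  Finset.prod_nonneg fun s _ => by
    split_ifs
    · exact (h s).1 _
    · exact (hm s).1 _

theorem corrProb_followOrPunish : ∀ {G : GameTree} {σ σm : Weights G}, IsBehavioral σ →
    IsBehavioral σm → ∀ z, corrProb (followOrPunish σ σm) z = reachProb σ z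
  | .leaf _ _, σ, σm, h, hm, .here => by
    rw [corrProb, reachProb, ← sum_followOrPunish h hm]
    exact Finset.sum_congr (Finset.filter_true_of_mem fun _ _ => rfl) fun _ _ => rfl
  | .node p n c, σ, σm, h, hm, .there i z => by
    classical
    have h' := isBehavioral_node.1 h
    have hm' := isBehavioral_node.1 hm
    have key := sum_followOrPunish_mul (σ := σ) hm i fun π => if outcome π = z then 1 else 0
    simp only [mul_ite, mul_one, mul_zero, ← Finset.sum_filter] at key
    refine Eq.trans ?_ (key.trans (congrArg _ (corrProb_followOrPunish (h'.2 i) (hm'.2 i) z)))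
    refine Finset.sum_congr ?_ fun _ _ => rfl
    ext π
    simp only [Finset.mem_filter, Finset.mem_univ, true_and]
    constructor
    · intro hz
      have hr : π.root = i := (Terminal.there.inj hz).1
      subst hr
      exact ⟨rfl, eq_of_heq (Terminal.there.inj hz).2⟩
    · rintro ⟨rfl, rfl⟩
      rfl

theorem sum_mul_outcome {G : GameTree} (φ : Profile G → ℝ) (u : Terminal G → ℝ) :
    ∑ π, φ π * u (outcome π) = ∑ z, u z * corrProb φ z := by
  rw [← Finset.sum_fiberwise _ outcome]
  refine Finset.sum_congr rfl fun z _ => ?_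
  rw [corrProb, Finset.mul_sum]
  refine Finset.sum_congr rfl fun π hπ => ?_
  rw [(Finset.mem_filter.1 hπ).2, mul_comm]

theorem corrU₁_followOrPunish {G : GameTree} {σ σm : Weights G} (h : IsBehavioral σ)
    (hm : IsBehavioral σm) : corrU₁ (followOrPunish σ σm) = expU₁ σ := by
  rw [corrU₁, sum_mul_outcome]
  simp only [corrProb_followOrPunish h hm, expU₁]

theorem corrU₂_followOrPunish {G : GameTree} {σ σm : Weights G} (h : IsBehavioral σ)
    (hm : IsBehavioral σm) :
    ∑ π, followOrPunish σ σm π * (outcome π).u₂ = expU₂ σ := by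
  rw [sum_mul_outcome]
  simp only [corrProb_followOrPunish h hm, expU₂]

/-! ### Plans -/

open Classical in
/-- The profile in which the follower uses the plan `d`, given the recommendations `π`, and the
leader plays `π`. -/
noncomputable def follow {G : GameTree} (d : (t : State G) → Profile G → Fin t.numActions)
    (π : Profile G) : Profile G :=
  fun t => if t.owner = .follower then d t π else π t

section Plans

variable {p : Player} {n : ℕ} {c : Fin (n + 1) → GameTree}

/-- Some pure profile. -/
def Profile.default {G : GameTree} : Profile G := fun s => ⟨0, s.numActions_pos⟩

/-- The plan `d` in the `i`-th subtree after the recommendation `a` at the root. -/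
def subPlan (d : (t : State (.node p n c)) → Profile (.node p n c) → Fin t.numActions)
    (a i : Fin (n + 1)) : (t : State (c i)) → Profile (c i) → Fin t.numActions :=
  fun t π => d (.there i t) (.glue a (Function.update (fun _ => Profile.default) i π))

theorem glue_update_there (a : Fin (n + 1)) (f : ∀ i, Profile (c i)) {i : Fin (n + 1)}
    (π : Profile (c i)) (t : State (c i)) :
    Profile.glue (p := p) a (Function.update f i π) (.there i t) = π t := by
  change Function.update f i π i t = π t
  rw [Function.update_self]

variable {d : (t : State (.node p n c)) → Profile (.node p n c) → Fin t.numActions}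

theorem IsPlan.subPlan (hd : IsPlan d) (a i : Fin (n + 1)) : IsPlan (subPlan d a i) := by
  intro t π π' h
  refine hd _ _ _ ?_
  rintro (_ | ⟨j, r⟩) hr ho
  · rfl
  · obtain rfl := hr.index_eq
    rw [glue_update_there, glue_update_there]
    exact h r (State.above_there_iff.1 hr) ho

/-- States in sibling subtrees are not above `t`, so the default values that `subPlan` puts there
cannot influence the plan. A plan therefore decomposes along the tree. -/
theorem IsPlan.apply_there (hd : IsPlan d) (i : Fin (n + 1)) (t : State (c i))
    (π : Profile (.node p n c)) : d (.there i t) π = GameTree.subPlan d π.root i t (π.sub i) := by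
  refine hd _ _ _ ?_
  rintro (_ | ⟨j, r⟩) hr ho
  · rfl
  · obtain rfl := hr.index_eq
    exact (glue_update_there (p := p) _ _ (π.sub j) r).symm

theorem IsPlan.apply_here (hd : IsPlan d) (π : Profile (.node p n c)) :
    d .here π = d .here (.glue π.root fun _ => Profile.default) := by
  refine hd _ _ _ ?_
  rintro (_ | ⟨j, r⟩) hr ho
  · rfl
  · cases hr

theorem sub_follow (hd : IsPlan d) (π : Profile (.node p n c)) (i : Fin (n + 1)) :
    (follow d π).sub i = follow (subPlan d π.root i) (π.sub i) := by
  funext t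
  by_cases h : t.owner = .follower
  · exact (if_pos h).trans ((hd.apply_there i t π).trans (if_pos h).symm)
  · exact (if_neg h).trans (if_neg h).symm

theorem sub_deviate (hd : IsPlan d) (π : Profile (.node p n c)) (i : Fin (n + 1))
    (s : State (c i)) :
    (deviate (.there i s) d π).sub i = deviate s (subPlan d π.root i) (π.sub i) := by
  funext t
  by_cases h : t.owner = .follower ∧ s.Above t
  · exact (if_pos ⟨h.1, .there i h.2⟩).trans ((hd.apply_there i t π).trans (if_pos h).symm)
  · exact (if_neg fun h' => h ⟨h'.1, State.above_there_iff.1 h'.2⟩).trans (if_neg h).symm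

theorem outcome_follow_leader {d : (t : State (.node .leader n c)) →
    Profile (.node .leader n c) → Fin t.numActions} (hd : IsPlan d)
    {π : Profile (.node .leader n c)} {a : Fin (n + 1)} (ha : π.root = a) :
    (outcome (follow d π)).u₂ = (outcome (follow (subPlan d a a) (π.sub a))).u₂ := by
  have : (follow d π).root = a := (if_neg (by simp [State.owner])).trans ha
  rw [outcome_u₂_of_root_eq this, sub_follow hd, ha]

/-- The action of the plan `d` at the root after the recommendation `a`. -/
def rootAction (d : (t : State (.node p n c)) → Profile (.node p n c) → Fin t.numActions)
    (a : Fin (n + 1)) : Fin (n + 1) :=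
  d .here (.glue a fun _ => Profile.default)

theorem outcome_follow_follower {d : (t : State (.node .follower n c)) →
    Profile (.node .follower n c) → Fin t.numActions} (hd : IsPlan d)
    {π : Profile (.node .follower n c)} {a : Fin (n + 1)} (ha : π.root = a) :
    (outcome (follow d π)).u₂ =
      (outcome (follow (subPlan d a (rootAction d a)) (π.sub (rootAction d a)))).u₂ := by
  have : (follow d π).root = rootAction d a := by
    rw [← ha]
    exact (if_pos rfl).trans (hd.apply_here π)
  rw [outcome_u₂_of_root_eq this, sub_follow hd, ha]

end Plans

/-- Against the minmax play of the leader no plan gives the follower more than the value. -/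
theorem sum_profileProb_follow_le : ∀ {G : GameTree}
    {d : (t : State G) → Profile G → Fin t.numActions}, IsPlan d →
    ∑ π, profileProb (punishment G) π * (outcome (follow d π)).u₂ ≤ value G
  | .leaf u v, d, _ => by
    simp only [outcome, Terminal.u₂, ← Finset.sum_mul, value,
      sum_profileProb (punishment_isBehavioral _), one_mul, le_refl]
  | .node .leader n c, d, hd => by
    have hb := punishment_isBehavioral (.node .leader n c)
    rw [sum_profile]
    refine (Finset.sum_congr rfl fun a _ => ?_).trans_le (sum_stdSimplex_mul_le
      (f := fun a => ∑ π, profileProb (punishment (c a)) π *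
        (outcome (follow (subPlan d a a) π)).u₂) (isBehavioral_node.1 hb).1 fun a ha => ?_)
    · refine Eq.trans ?_ (sum_profileProb_mul hb a a fun π =>
        (outcome (follow (subPlan d a a) π)).u₂)
      refine Finset.sum_congr rfl fun π hπ => ?_
      rw [outcome_follow_leader hd (Finset.mem_filter.1 hπ).2]
    -- The punishment uses only the minimizing action, so positive weight identifies `a`.
    · have : a = optAction .leader c := by
        by_contra h
        have h0 : (punishment (.node .leader n c)).root a = 0 := Pi.single_eq_of_ne h _
        rw [h0] at ha
        exact lt_irrefl _ ha
      rw [← value_optAction, ← this]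
      exact sum_profileProb_follow_le (hd.subPlan a a)
  | .node .follower n c, d, hd => by
    have hb := punishment_isBehavioral (.node .follower n c)
    rw [sum_profile]
    refine (Finset.sum_congr rfl fun a _ => ?_).trans_le (sum_stdSimplex_mul_le
      (f := fun a => ∑ π, profileProb (punishment (c (rootAction d a))) π *
        (outcome (follow (subPlan d a (rootAction d a)) π)).u₂) (isBehavioral_node.1 hb).1
        fun a _ => ?_)
    · refine Eq.trans ?_ (sum_profileProb_mul hb a (rootAction d a) fun π =>
        (outcome (follow (subPlan d a (rootAction d a)) π)).u₂)
      refine Finset.sum_congr rfl fun π hπ => ?_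
      rw [outcome_follow_follower hd (Finset.mem_filter.1 hπ).2]
    · exact (sum_profileProb_follow_le (hd.subPlan a _)).trans (le_value_follower c _)

/-- Given the recommendation `a`, a plan either takes `a` and is bounded by the assumption on that
subtree, or moves elsewhere and meets punishment. In the second case it earns at most the value of
that child, hence at most the value of the node, hence by obedience at most what `a` promises. -/
theorem sum_followOrPunish_follow_le_of_follower {n : ℕ} {c : Fin (n + 1) → GameTree}
    {σ : Weights (.node .follower n c)} (hσ : IsBehavioral σ) (ho : Obedient σ)
    (h : ∀ a, 0 < σ.root a → ∀ {d : (t : State (c a)) → Profile (c a) → Fin t.numActions},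
      IsPlan d → ∑ π, followOrPunish (σ.sub a) (punishment (c a)) π * (outcome (follow d π)).u₂ ≤
        expU₂ (σ.sub a))
    {d : (t : State (.node .follower n c)) → Profile (.node .follower n c) → Fin t.numActions}
    (hd : IsPlan d) (a : Fin (n + 1)) :
    ∑ π with π.root = a,
        followOrPunish σ (punishment (.node .follower n c)) π * (outcome (follow d π)).u₂ ≤
      σ.root a * expU₂ (σ.sub a) := by
  have hb := punishment_isBehavioral (.node .follower n c)
  have h₀ := ((isBehavioral_node.1 hσ).1.1 a).eq_or_lt
  have h₁ : ∑ π with π.root = a,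
      followOrPunish σ (punishment (.node .follower n c)) π * (outcome (follow d π)).u₂ =
      ∑ π with π.root = a, followOrPunish σ (punishment (.node .follower n c)) π *
        (outcome (follow (subPlan d a (rootAction d a)) (π.sub (rootAction d a)))).u₂ := by
    refine Finset.sum_congr rfl fun π hπ => ?_
    rw [outcome_follow_follower hd (Finset.mem_filter.1 hπ).2]
  rw [h₁]
  by_cases hr : rootAction d a = a
  · rw [hr, sum_followOrPunish_mul hb a fun π => (outcome (follow (subPlan d a a) π)).u₂]
    rcases h₀ with h0 | h0
    · rw [← h0, zero_mul, zero_mul]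
    · exact mul_le_mul_of_nonneg_left (h a h0 (hd.subPlan a a)) h0.le
  · rw [sum_followOrPunish_mul_of_ne hσ hb hr fun π =>
      (outcome (follow (subPlan d a (rootAction d a)) π)).u₂]
    rcases h₀ with h0 | h0
    · rw [← h0, zero_mul, zero_mul]
    · refine mul_le_mul_of_nonneg_left ?_ h0.le
      exact (sum_profileProb_follow_le (hd.subPlan a _)).trans
        ((le_value_follower c _).trans ((ho a h0).2 rfl))

/-- Deviations at every follower state at once are no better than obeying. The induction for later
states inside the recommended subtree needs this full strength, not only single deviations. -/
theorem sum_followOrPunish_follow_le : ∀ {G : GameTree} {σ : Weights G}, IsBehavioral σ →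
    Obedient σ → ∀ {d : (t : State G) → Profile G → Fin t.numActions}, IsPlan d →
    ∑ π, followOrPunish σ (punishment G) π * (outcome (follow d π)).u₂ ≤ expU₂ σ
  | .leaf u v, σ, hσ, _, d, _ => by
    simp only [outcome, Terminal.u₂, ← Finset.sum_mul, expU₂_leaf,
      sum_followOrPunish hσ (punishment_isBehavioral _), one_mul, le_refl]
  | .node .leader n c, σ, hσ, ho, d, hd => by
    rw [sum_profile, expU₂_node]
    refine Finset.sum_le_sum fun a _ => ?_
    have h₁ := sum_followOrPunish_mul (σ := σ) (punishment_isBehavioral _) a fun π =>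
      (outcome (follow (subPlan d a a) π)).u₂
    have h₂ : ∑ π with π.root = a,
        followOrPunish σ (punishment (.node .leader n c)) π * (outcome (follow d π)).u₂ =
        ∑ π with π.root = a, followOrPunish σ (punishment (.node .leader n c)) π *
          (outcome (follow (subPlan d a a) (π.sub a))).u₂ := by
      refine Finset.sum_congr rfl fun π hπ => ?_
      rw [outcome_follow_leader hd (Finset.mem_filter.1 hπ).2]
    rw [h₂, h₁]
    rcases ((isBehavioral_node.1 hσ).1.1 a).eq_or_lt with h0 | h0
    · rw [← h0, zero_mul, zero_mul]
    · exact mul_le_mul_of_nonneg_left (sum_followOrPunish_follow_le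
        ((isBehavioral_node.1 hσ).2 a) (ho a h0).1 (hd.subPlan a a)) h0.le
  | .node .follower n c, σ, hσ, ho, d, hd => by
    rw [sum_profile, expU₂_node]
    exact Finset.sum_le_sum fun a _ => sum_followOrPunish_follow_le_of_follower hσ ho
      (fun a h0 _ hd => sum_followOrPunish_follow_le
        ((isBehavioral_node.1 hσ).2 a) (ho a h0).1 hd) hd a

/-- Obedient strategy profiles with punishments are incentive compatible. -/
theorem Obedient.isIncentiveCompatible : ∀ {G : GameTree} {σ : Weights G}, IsBehavioral σ →
    Obedient σ → IsIncentiveCompatible (followOrPunish σ (punishment G))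
  | .node p n c, σ, hσ, ho, .here, hs, a, d, hd => by
    obtain rfl : p = .follower := hs
    have hb := isBehavioral_node.1 hσ
    have key := sum_followOrPunish_follow_le_of_follower hσ ho
      (fun a h0 _ hd => sum_followOrPunish_follow_le (hb.2 a) (ho a h0).1 hd) hd a
    have h₁ := sum_followOrPunish_mul (σ := σ) (punishment_isBehavioral (.node .follower n c)) a
      fun π => (outcome π).u₂
    have h₂ := corrU₂_followOrPunish (hb.2 a) (punishment_isBehavioral (c a))
    refine (Eq.le ?_).trans (key.trans (Eq.le ?_))
    · refine Finset.sum_congr ?_ fun π hπ => ?_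
      · ext π
        simp only [Finset.mem_filter]
        exact and_congr_right fun _ => and_iff_right trivial
      · congr 3
        funext t
        by_cases ht : t.owner = .follower
        · exact (if_pos ⟨ht, .root t⟩).trans (if_pos ht).symm
        · exact (if_neg fun h => ht h.1).trans (if_neg ht).symm
    · rw [← h₂]
      refine h₁.symm.trans (Finset.sum_congr ?_ fun π hπ => ?_)
      · ext π
        simp only [Finset.mem_filter]
        exact and_congr_right fun _ => (and_iff_right trivial).symm
      · simp only [Finset.mem_filter] at hπ
        rw [outcome_u₂_of_root_eq hπ.2.2]
  | .node p n c, σ, hσ, ho, .there i s, hs, a, d, hd => by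
    classical
    have hb := isBehavioral_node.1 hσ
    -- A state below action `i` is reached only if `i` is drawn at the root, so both sides of the
    -- inequality are `σ.root i` times the corresponding sums in the subtree.
    have hl := sum_followOrPunish_mul (σ := σ) (punishment_isBehavioral (.node p n c)) i fun π =>
      if Reaches π s ∧ π s = a then (outcome (deviate s (subPlan d i i) π)).u₂ else 0
    have hr := sum_followOrPunish_mul (σ := σ) (punishment_isBehavioral (.node p n c)) i fun π =>
      if Reaches π s ∧ π s = a then (outcome π).u₂ else 0
    simp only [mul_ite, mul_zero, ← Finset.sum_filter] at hl hr
    refine (Eq.le (Eq.trans ?_ hl)).trans (le_trans ?_ (Eq.le (hr.symm.trans ?_)))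
    · refine Finset.sum_congr ?_ fun π hπ => ?_
      · ext π
        simp only [Finset.mem_filter, and_assoc]
        exact and_congr_right fun _ => and_assoc
      · have : π.root = i := by
          simp only [Finset.mem_filter] at hπ
          exact hπ.1.2
        rw [outcome_u₂_of_root_eq ((root_deviate_there _).trans this), sub_deviate hd, this]
    · rcases (hb.1.1 i).eq_or_lt with h0 | h0
      · rw [← h0, zero_mul, zero_mul]
      · refine mul_le_mul_of_nonneg_left ?_ h0.le
        have := Obedient.isIncentiveCompatible (hb.2 i) (ho i h0).1 s hs a _ (hd.subPlan i i)
        refine (Eq.le (Finset.sum_congr ?_ fun _ _ => rfl)).trans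
          (this.trans (Eq.le (Finset.sum_congr ?_ fun _ _ => rfl)))
        all_goals
          ext π
          simp only [Finset.mem_filter]
    · refine Finset.sum_congr ?_ fun π hπ => ?_
      · ext π
        simp only [Finset.mem_filter, and_assoc]
        exact and_congr_right fun _ => and_assoc.symm
      · have : π.root = i := by
          simp only [Finset.mem_filter] at hπ
          exact hπ.2.1.1
        rw [outcome_u₂_of_root_eq this]

/-- An obedient strategy profile that is optimal for the leader among the attainable points
represents a Stackelberg extensive-form correlated equilibrium. -/
theorem Obedient.exists_isSEFCE {G : GameTree} {L : List Pt} (hL : IsFrontier G L)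
    {σ : Weights G} (hσ : IsBehavioral σ) (ho : Obedient σ) (hopt : ∀ P ∈ L, P.y ≤ expU₁ σ) :
    ∃ φ : Profile G → ℝ, IsSEFCE φ ∧ IsCompactRep σ φ := by
  have hm := punishment_isBehavioral G
  refine ⟨followOrPunish σ (punishment G),
    ⟨⟨followOrPunish_nonneg hσ hm, sum_followOrPunish hσ hm⟩, ho.isIncentiveCompatible hσ, ?_⟩,
    hσ, ⟨_, punishment_isMinmax G, rfl⟩, corrProb_followOrPunish hσ hm⟩
  intro φ hφ hic
  -- The functional that reads off the leader's utility alone.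
  have := ICOn.below hL hφ.1 (isIncentiveCompatible_iff.1 hic) 1 0 (expU₁ σ) zero_le_one
    fun P hP => by linarith [hopt P hP]
  rw [hφ.2] at this
  rw [corrU₁_followOrPunish hσ hm, corrU₁]
  simp only [id] at this
  linarith

/-! ## Bridges -/

/-- The height of a point above the line of slope `a` through the origin. -/
def Pt.ht (a : ℝ) (P : Pt) : ℝ := P.y - a * P.x

/-- `l` and `r` lie on the two sides of the vertical line at `μ`, and no point of `L` lies above
the line through them. -/
structure IsBridge (μ : ℝ) (L : List Pt) (l r : Pt) : Prop where
  mem_left : l ∈ L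
  mem_right : r ∈ L
  left_le : l.x ≤ μ
  le_right : μ ≤ r.x
  exists_slope : ∃ a, l.ht a = r.ht a ∧ ∀ P ∈ L, P.ht a ≤ l.ht a

/-- `A` is highest among the points of `L` with the property `p`. -/
structure IsBest (a : ℝ) (p : Pt → Prop) (L : List Pt) (A : Pt) : Prop where
  mem : A ∈ L
  prop : p A
  le : ∀ P ∈ L, p P → P.ht a ≤ A.ht a

/-! ### Which points can be discarded in the search for a bridge -/

section Prune

variable {μ a : ℝ} {L L' : List Pt} {A B : Pt}

/-- Equal heights on both sides mean that the supporting line of slope `a` touches the hull on both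
sides of `μ`. -/
theorem isBridge_of_ht_eq (hA : IsBest a (fun P => P.x ≤ μ) L A)
    (hB : IsBest a (fun P => μ < P.x) L B) (h : A.ht a = B.ht a) : IsBridge μ L A B := by
  refine ⟨hA.mem, hB.mem, hA.prop, hB.prop.le, a, h, fun P hP => ?_⟩
  rcases le_or_gt P.x μ with hx | hx
  · exact hA.le P hP hx
  · exact h ▸ hB.le P hP hx

/-- A point at least as high as `A` is higher than every point right of `μ`, so it lies on the left;
pruning thus keeps a point on that side. -/
theorem exists_left_of_dominates (hB : IsBest a (fun P => μ < P.x) L B)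
    (h : B.ht a < A.ht a) (hL : L' ⊆ L)
    (hd : ∃ Q ∈ L', A.ht a ≤ Q.ht a) : ∃ Q ∈ L', Q.x ≤ μ ∧ A.ht a ≤ Q.ht a := by
  obtain ⟨Q, hQ, hq⟩ := hd
  refine ⟨Q, hQ, le_of_not_gt fun hx => ?_, hq⟩
  exact absurd (hB.le Q (hL hQ) hx) (not_le.2 (h.trans_le hq))

theorem exists_right_of_dominates (hA : IsBest a (fun P => P.x ≤ μ) L A)
    (h : A.ht a < B.ht a) (hL : L' ⊆ L)
    (hd : ∃ Q ∈ L', B.ht a ≤ Q.ht a) : ∃ Q ∈ L', μ < Q.x ∧ B.ht a ≤ Q.ht a := by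
  obtain ⟨Q, hQ, hq⟩ := hd
  refine ⟨Q, hQ, lt_of_not_ge fun hx => ?_, hq⟩
  exact absurd (hA.le Q (hL hQ) hx) (not_le.2 (h.trans_le hq))

/-- If the highest point in direction `a` lies on the left, the bridge has slope at most `a`. For
such slopes a point that is farther right and at least as high with respect to `a` is at least as
high, so the dominated points do not affect the bridge. -/
theorem IsBridge.of_dominates_right (hA : IsBest a (fun P => P.x ≤ μ) L A)
    (hB : IsBest a (fun P => μ < P.x) L B) (h : B.ht a < A.ht a) (hL : L' ⊆ L)
    (hd : ∀ P ∈ L, ∃ Q ∈ L', P.x ≤ Q.x ∧ P.ht a ≤ Q.ht a) {l r : Pt} (hlr : IsBridge μ L' l r)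
    (hr : μ < r.x) : IsBridge μ L l r := by
  obtain ⟨Q, hQ, hQx, hQa⟩ := exists_left_of_dominates hB h hL
    ((hd A hA.mem).imp fun Q hQ => ⟨hQ.1, hQ.2.2⟩)
  obtain ⟨b, hb, hmax⟩ := hlr.exists_slope
  refine ⟨hL hlr.mem_left, hL hlr.mem_right, hlr.left_le, hlr.le_right, b, hb, fun P hP => ?_⟩
  -- `r` is at least as high as `Q` for slope `b` but strictly lower for slope `a`, and `Q` lies
  -- strictly to its left.
  have hba : b ≤ a := by
    have h₁ := hmax Q hQ
    have h₂ := hB.le r (hL hlr.mem_right) hr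
    simp only [Pt.ht] at *
    by_contra! hlt
    nlinarith [mul_pos (sub_pos.2 hlt) (sub_pos.2 (hQx.trans_lt hr))]
  obtain ⟨R, hR, hx, hRa⟩ := hd P hP
  refine le_trans ?_ (hmax R hR)
  simp only [Pt.ht] at *
  nlinarith [mul_nonneg (sub_nonneg.2 hba) (sub_nonneg.2 hx)]

/-- The mirror image: the bridge has slope at least `a`, and domination goes to the left. The strict
gap in abscissas now comes from the dominator of `B`. -/
theorem IsBridge.of_dominates_left (hA : IsBest a (fun P => P.x ≤ μ) L A)
    (hB : IsBest a (fun P => μ < P.x) L B) (h : A.ht a < B.ht a) (hL : L' ⊆ L)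
    (hd : ∀ P ∈ L, ∃ Q ∈ L', Q.x ≤ P.x ∧ P.ht a ≤ Q.ht a) {l r : Pt} (hlr : IsBridge μ L' l r) :
    IsBridge μ L l r := by
  obtain ⟨Q, hQ, hQx, hQa⟩ := exists_right_of_dominates hA h hL
    ((hd B hB.mem).imp fun Q hQ => ⟨hQ.1, hQ.2.2⟩)
  obtain ⟨b, hb, hmax⟩ := hlr.exists_slope
  refine ⟨hL hlr.mem_left, hL hlr.mem_right, hlr.left_le, hlr.le_right, b, hb, fun P hP => ?_⟩
  have hba : a ≤ b := by
    have h₁ := hmax Q hQ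
    have h₂ := hA.le l (hL hlr.mem_left) hlr.left_le
    simp only [Pt.ht] at *
    by_contra! hlt
    nlinarith [mul_pos (sub_pos.2 hlt) (sub_pos.2 (hlr.left_le.trans_lt hQx))]
  obtain ⟨R, hR, hx, hRa⟩ := hd P hP
  refine le_trans ?_ (hmax R hR)
  simp only [Pt.ht] at *
  nlinarith [mul_nonneg (sub_nonneg.2 hba) (sub_nonneg.2 hx)]

end Prune

/-- A highest point on the right end of `L`. -/
theorem isBridge_of_forall_le {μ : ℝ} {L : List Pt} {Z : Pt} (hL : ∀ P ∈ L, P.x ≤ μ)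
    (hZ : IsBest 0 (fun P => μ ≤ P.x) L Z) : IsBridge μ L Z Z := by
  -- At the right end any sufficiently steep descending line supports the hull; `h` bounds the
  -- required steepness. Points with abscissa `μ` give division by zero and are compared with `Z`
  -- directly.
  obtain ⟨h, hh⟩ := exists_forall_le L fun P => (P.y - Z.y) / (μ - P.x)
  have hx : Z.x = μ := le_antisymm (hL Z hZ.mem) hZ.prop
  refine ⟨hZ.mem, hZ.mem, hx.le, hx.ge, -h, rfl, fun P hP => ?_⟩
  have h₁ := hh P hP
  have h₂ := hZ.le P hP
  simp only [Pt.ht, hx, zero_mul, sub_zero] at h₂ ⊢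
  rcases (hL P hP).eq_or_lt with he | hlt
  · have := h₂ he.ge
    rw [he]
    linarith
  · rw [div_le_iff₀ (sub_pos.2 hlt)] at h₁
    linarith

/-! ## Cutting off the points to the left of a line -/

/-- `K'` represents the part of `K` to the right of the vertical line at `μ`. -/
structure IsClip (μ : ℝ) (K K' : List Pt) : Prop where
  sound : ∀ P ∈ K', μ ≤ P.x ∧ Below K 1 P.x P.y
  complete : ∀ w x y, 0 ≤ w → μ * w ≤ x → Below K w x y → Below K' w x y
  length_le : K'.length ≤ K.length

/-- The point above `μ` on the line through `l` and `r`. -/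
noncomputable def interpolate (μ : ℝ) (l r : Pt) : Pt :=
  ⟨μ, l.y + (r.y - l.y) * ((μ - l.x) / (r.x - l.x)), 0⟩

/-- Only the vertical line itself can survive. If the list has points on it, the highest of them
bounds everything; otherwise the cut is empty and only the mass 0 satisfies the hypotheses. -/
theorem isClip_of_forall_le {μ : ℝ} {K : List Pt} (hK : ∀ P ∈ K, P.x ≤ μ) :
    IsClip μ K (K.filter fun P => μ ≤ P.x) := by
  refine ⟨fun P hP => ?_, fun w x y hw hx hB => ?_, List.length_filter_le _ _⟩
  · rw [List.mem_filter, decide_eq_true_iff] at hP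
    exact ⟨hP.2, .of_mem hP.1⟩
  · by_cases hZ : ∃ Z, IsBest 0 (fun P => μ ≤ P.x) K Z
    · obtain ⟨Z, hZ⟩ := hZ
      have hZx : Z.x = μ := le_antisymm (hK Z hZ.mem) hZ.prop
      obtain ⟨a, -, ha⟩ := (isBridge_of_forall_le hK hZ).exists_slope
      simp only [Pt.ht, hZx] at ha
      -- The horizontal functional gives `x ≤ μ * w`, which the cut condition turns into equality.
      have h₁ := hB 0 1 μ le_rfl fun P hP => by linarith [hK P hP]
      have h₂ := hB 1 (-a) (Z.y - a * μ) zero_le_one fun P hP => by linarith [ha P hP]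
      have hxw : x = μ * w := by linarith
      intro α β h hα hb
      have h₃ := hb Z (List.mem_filter.2 ⟨hZ.mem, decide_eq_true hZ.prop⟩)
      have h₄ : y ≤ Z.y * w := by rw [hxw] at h₂; linarith
      calc α * y + β * x ≤ α * (Z.y * w) + β * (μ * w) := by
            rw [hxw]; linarith [mul_le_mul_of_nonneg_left h₄ hα]
        _ = (α * Z.y + β * Z.x) * w := by rw [hZx]; ring
        _ ≤ h * w := mul_le_mul_of_nonneg_right h₃ hw
    · have hlt (P) (hP : P ∈ K) : P.x < μ := by
        by_contra! hP'
        obtain ⟨Z, hZ', hmax⟩ := Set.exists_max_image {P | P ∈ K ∧ μ ≤ P.x} (Pt.ht 0)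
          (K.finite_toSet.subset fun _ h => h.1) ⟨P, hP, hP'⟩
        exact hZ ⟨Z, hZ'.1, hZ'.2, fun P hP hx => hmax P ⟨hP, hx⟩⟩
      obtain ⟨m, hm, hKm⟩ := exists_lt_of_forall_lt K Pt.x hlt
      obtain ⟨k, hk⟩ := exists_forall_le K Pt.y
      have h₁ := hB 0 1 m le_rfl fun P hP => by linarith [hKm P hP]
      have h₂ := hB 1 0 k zero_le_one fun P hP => by linarith [hk P hP]
      -- All abscissas are at most `m < μ`, so a positive mass would contradict `μ * w ≤ x`.
      have hw0 : w = 0 := by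
        refine le_antisymm (le_of_not_gt fun h => ?_) hw
        linarith [mul_lt_mul_of_pos_right hm h]
      intro α β h hα _
      rw [hw0] at h₁ h₂ hx ⊢
      have : x = 0 := by linarith
      rw [this]
      nlinarith

theorem isClip_of_forall_lt {μ : ℝ} {K : List Pt} (hK : ∀ P ∈ K, μ < P.x) : IsClip μ K K :=
  ⟨fun P hP => ⟨(hK P hP).le, .of_mem hP⟩, fun _ _ _ _ _ h => h, le_rfl⟩

theorem Below.of_isBridge {μ : ℝ} {K : List Pt} {l r : Pt} (h : IsBridge μ K l r)
    (hlr : l.x < r.x) : Below K 1 μ (interpolate μ l r).y := by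
  intro α β k _ hk
  have hd : 0 < r.x - l.x := sub_pos.2 hlr
  have hl := hk l h.mem_left
  have hr := hk r h.mem_right
  have hw : 0 ≤ (μ - l.x) / (r.x - l.x) := div_nonneg (sub_nonneg.2 h.left_le) hd.le
  have hw' : (μ - l.x) / (r.x - l.x) ≤ 1 := by
    rw [div_le_one hd]
    linarith [h.le_right]
  have hμ : μ = l.x + (r.x - l.x) * ((μ - l.x) / (r.x - l.x)) := by
    rw [mul_div_cancel₀ _ hd.ne']
    ring
  simp only [interpolate]
  generalize (μ - l.x) / (r.x - l.x) = w at *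
  subst hμ
  nlinarith [mul_le_mul_of_nonneg_left hr hw, mul_le_mul_of_nonneg_left hl (sub_nonneg.2 hw')]

/-- The upper hull right of `μ` is spanned by the points strictly to the right together with the
crossing point `C` on the bridge. A functional is split as a multiple of the height above the
bridge's slope plus a multiple of the abscissa; the sign of the latter decides the argument. -/
theorem isClip_of_isBridge {μ : ℝ} {K : List Pt} {l r : Pt} (h : IsBridge μ K l r)
    (hr : μ < r.x) : IsClip μ K (interpolate μ l r :: K.filter fun P => μ < P.x) := by
  have hlr : l.x < r.x := h.left_le.trans_lt hr
  refine ⟨?_, ?_, ?_⟩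
  · intro P hP
    rcases List.mem_cons.1 hP with rfl | hP
    · exact ⟨le_rfl, .of_isBridge h hlr⟩
    · rw [List.mem_filter, decide_eq_true_iff] at hP
      exact ⟨hP.2.le, .of_mem hP.1⟩
  · intro w x y hw hx hB α β k hα hk
    obtain ⟨a, hlra, ha⟩ := h.exists_slope
    have hC : (interpolate μ l r).ht a = l.ht a := by
      have hd : r.x - l.x ≠ 0 := (sub_pos.2 hlr).ne'
      simp only [Pt.ht, interpolate] at hlra ⊢
      have : r.y - l.y = a * (r.x - l.x) := by linarith
      rw [this]
      field_simp
      ring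
    rw [← hC] at ha
    have hCx : (interpolate μ l r).x = μ := rfl
    generalize interpolate μ l r = C at *
    have hCk := hk C List.mem_cons_self
    simp only [Pt.ht, hCx] at ha hCk
    have h₁ := hB 1 (-a) (C.y - a * μ) zero_le_one fun P hP => by linarith [ha P hP]
    -- If the functional decreases along the bridge, `C` maximizes it over the half-plane. If it
    -- increases, every point left of `μ` is beaten by `C`, so the bound for the cut list extends to
    -- all of `K`.
    rcases le_total (β + α * a) 0 with hs | hs
    · nlinarith [mul_le_mul_of_nonneg_left h₁ hα, mul_le_mul_of_nonneg_right hCk hw,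
        mul_nonneg (sub_nonneg.2 hx) (neg_nonneg.2 hs)]
    · refine hB α β k hα fun P hP => ?_
      rcases lt_or_ge μ P.x with hPx | hPx
      · exact hk P (List.mem_cons_of_mem _ (List.mem_filter.2 ⟨hP, decide_eq_true hPx⟩))
      · nlinarith [mul_le_mul_of_nonneg_left (ha P hP) hα, mul_nonneg (sub_nonneg.2 hPx) hs]
  -- The left end of the bridge is removed, which makes room for the new point.
  · have : (K.filter fun P => μ < P.x).length < K.length :=
      List.length_filter_lt_length_iff_exists.2 ⟨l, h.mem_left, by simpa using h.left_le⟩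
    exact this

end GameTree

namespace RealMachine

open GameTree

/-! ## The program -/

namespace Expr

/-- Continue with `e₁` if two numbers are equal and with `e₂` otherwise. -/
def ifEq (a b e₁ e₂ : Expr) : Expr := .ifLe a b (.ifLe b a e₁ e₂) e₂

/-- The number two. -/
def two : Expr := .add .one .one

/-- Input: the game.  Output: the strategy profile. -/
def main : Expr :=
  .letIn (.call 1 (.var 0)) <| .casePair (.var 0) .nil <| .casePair (.var 1) .nil <|
  .letIn (.call 12 (.pair .zero (.var 0))) <| .casePair (.var 0) .nil <|
  .call 21 (.pair (.var 7) (.var 0))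

/-- Input: a game.  Output: the game, annotated with values and frontiers. -/
def annotate : Expr :=
  .casePair (.var 0) .nil <| .casePair (.var 0)
    (.casePair (.var 1) .nil <| .pair (.var 1)
      (.pair (.pair (.pair (.var 1) (.pair (.var 0) .zero)) .nil) .nil)) <|
  .letIn (.call 2 (.var 3)) <|
  .letIn (.casePair (.var 1) (.call 3 (.var 0)) (.call 4 (.var 2))) <|
  .pair (.var 0) (.pair (.call 5 (.pair (.var 0) (.pair .zero (.var 1)))) (.var 1))

/-- Input: a list of games.  Output: the list of annotated games. -/
def annotateAll : Expr :=
  .casePair (.var 0) .nil <| .pair (.call 1 (.var 0)) (.call 2 (.var 1))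

/-- Input: a list of annotated games.  Output: the least value. -/
def minValue : Expr :=
  .casePair (.var 0) .nil <| .casePair (.var 0) .nil <| .casePair (.var 3) (.var 0) <|
  .letIn (.call 3 (.var 5)) <| .ifLe (.var 3) (.var 0) (.var 3) (.var 0)

/-- Input: a list of annotated games.  Output: the greatest value. -/
def maxValue : Expr :=
  .casePair (.var 0) .nil <| .casePair (.var 0) .nil <| .casePair (.var 3) (.var 0) <|
  .letIn (.call 4 (.var 5)) <| .ifLe (.var 3) (.var 0) (.var 0) (.var 3)

/-- Input: a number, an index, and a list of annotated games.  Output: the union of the frontiers,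
cut off at the number and marked with consecutive indices. -/
def clipAll : Expr :=
  .casePair (.var 0) .nil <| .casePair (.var 1) .nil <| .casePair (.var 1) .nil <|
  .casePair (.var 0) .nil <| .casePair (.var 1) .nil <|
  .call 6 (.pair (.var 6) (.pair (.call 7 (.pair (.var 8) (.var 0)))
    (.call 5 (.pair (.var 8) (.pair (.add (.var 6) .one) (.var 5))))))

/-- Input: an index and two lists of points.  Output: the concatenation of the lists, with the
points of the first one marked by the index. -/
def retag : Expr :=
  .casePair (.var 0) .nil <| .casePair (.var 1) .nil <| .casePair (.var 0) (.var 1) <|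
  .casePair (.var 0) .nil <| .casePair (.var 1) .nil <|
  .pair (.pair (.var 2) (.pair (.var 0) (.var 8)))
    (.call 6 (.pair (.var 8) (.pair (.var 5) (.var 7))))

/-- Input: a number and a list of points.  Output: the list, cut off at the number. -/
def clip : Expr :=
  .casePair (.var 0) .nil <| .letIn (.call 9 (.pair (.var 0) (.var 1))) <|
  .casePair (.var 0) (.call 10 (.pair (.var 1) (.var 2))) <|
  .letIn (.call 8 (.pair (.var 3) (.var 4))) <| .casePair (.var 0) (.var 3) <|
  .letIn (.call 13 (.pair (.var 6) (.var 7))) <|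
  .pair (.call 26 (.pair (.var 7) (.var 0))) (.var 6)

/-- Input: a number and a list of items with keys.  Output: the sublist of the items that pass
the test `e`, which the program calls with the number `f`. -/
def filter (f : ℕ) (e : Expr) : Expr :=
  .casePair (.var 0) .nil <| .casePair (.var 1) .nil <|
  .letIn (.call f (.pair (.var 2) (.var 1))) <| .casePair (.var 1) .nil e

/-- Items with key at most the number. -/
def filterLe : Expr := filter 8 (.ifLe (.var 0) (.var 5) (.pair (.var 3) (.var 2)) (.var 2))

/-- Items with key greater than the number. -/
def filterGt : Expr := filter 9 (.ifLe (.var 0) (.var 5) (.var 2) (.pair (.var 3) (.var 2)))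

/-- Items with key at least the number. -/
def filterGe : Expr := filter 10 (.ifLe (.var 5) (.var 0) (.pair (.var 3) (.var 2)) (.var 2))

/-- Items with key less than the number. -/
def filterLt : Expr := filter 11 (.ifLe (.var 5) (.var 0) (.var 2) (.pair (.var 3) (.var 2)))

/-- Input: a slope and a nonempty list of points.  Output: a highest point. -/
def best : Expr :=
  .casePair (.var 0) .nil <| .casePair (.var 1) .nil <| .casePair (.var 1) (.var 0) <|
  .letIn (.call 12 (.pair (.var 4) (.var 3))) <|
  .ifLe (.call 24 (.pair (.var 5) (.var 3))) (.call 24 (.pair (.var 5) (.var 0))) (.var 0) (.var 3)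

/-- Input: a number and a list of points on both sides of it.  Output: a bridge. -/
def bridge : Expr :=
  .casePair (.var 0) .nil <| .letIn (.call 14 (.var 1)) <| .casePair (.var 0) .nil <|
  .casePair (.var 0) (.call 13 (.pair (.var 3) (.var 1))) <|
  .letIn (.call 17 (.pair (.div (.call 18 (.var 2)) two) (.var 2))) <|
  .letIn (.call 12 (.pair (.var 0) (.call 8 (.pair (.var 6) (.var 7))))) <|
  .letIn (.call 12 (.pair (.var 1) (.call 9 (.pair (.var 7) (.var 8))))) <|
  .letIn (.call 24 (.pair (.var 2) (.var 1))) <| .letIn (.call 24 (.pair (.var 3) (.var 1))) <|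
  .ifLe (.var 1) (.var 0)
    (.ifLe (.var 0) (.var 1) (.pair (.var 3) (.var 2))
      (.call 13 (.pair (.var 10) (.call 16 (.pair (.var 4) (.pair (.var 7) (.var 8)))))))
    (.call 13 (.pair (.var 10) (.call 15 (.pair (.var 4) (.pair (.var 7) (.var 8))))))

/-- Input: a list of points.  Output: pairs of points with the slopes of their lines, and points
that were not paired. -/
def pairUp : Expr :=
  .casePair (.var 0) (.pair .nil .nil) <| .casePair (.var 1) (.pair .nil (.pair (.var 0) .nil)) <|
  .call 25 (.pair (.var 2) (.pair (.var 0) (.call 14 (.var 1))))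

/-- Input: a slope, a list of pairs of points with slopes, a list of points.  Output: all points,
except for the left ones in the pairs with at least the slope. -/
def dropLeft : Expr :=
  .casePair (.var 0) .nil <| .casePair (.var 1) .nil <| .casePair (.var 0) (.var 1) <|
  .letIn (.call 15 (.pair (.var 4) (.pair (.var 1) (.var 3)))) <|
  .casePair (.var 1) .nil <| .casePair (.var 1) .nil <|
  .ifLe (.var 9) (.var 2) (.pair (.var 1) (.var 4)) (.pair (.var 0) (.pair (.var 1) (.var 4)))

/-- Input: a slope, a list of pairs of points with slopes, a list of points.  Output: all points,
except for the right ones in the pairs with at most the slope. -/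
def dropRight : Expr :=
  .casePair (.var 0) .nil <| .casePair (.var 1) .nil <| .casePair (.var 0) (.var 1) <|
  .letIn (.call 16 (.pair (.var 4) (.pair (.var 1) (.var 3)))) <|
  .casePair (.var 1) .nil <| .casePair (.var 1) .nil <|
  .ifLe (.var 2) (.var 9) (.pair (.var 0) (.var 4)) (.pair (.var 0) (.pair (.var 1) (.var 4)))

/-- Input: a rank and a list of items with keys.  Output: a key of this rank. -/
def select : Expr :=
  .casePair (.var 0) .nil <| .letIn (.call 19 (.var 1)) <|
  .letIn (.casePair (.var 0) (.casePair (.var 2) .nil <| .casePair (.var 0) .nil (.var 0))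
    (.call 17 (.pair (.div (.call 18 (.var 2)) two) (.var 2)))) <|
  .letIn (.call 11 (.pair (.var 0) (.var 3))) <| .letIn (.call 18 (.var 0)) <|
  .ifLe (.var 4) (.var 0) (.call 17 (.pair (.var 4) (.var 1))) <|
  .letIn (.call 9 (.pair (.var 2) (.var 5))) <|
  .letIn (.sub (.call 18 (.var 6)) (.call 18 (.var 0))) <|
  .ifLe (.var 6) (.var 0) (.var 4) (.call 17 (.pair (.sub (.var 6) (.var 0)) (.var 1)))

/-- Input: a list.  Output: its length. -/
def length : Expr := .casePair (.var 0) .zero (.add .one (.call 18 (.var 1)))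

/-- Input: a list of items with keys.  Output: the medians of groups of five. -/
def medians : Expr :=
  .casePair (.var 0) .nil <| .casePair (.var 1) .nil <| .casePair (.var 1) .nil <|
  .casePair (.var 1) .nil <| .casePair (.var 1) .nil <|
  .letIn (.call 20 (.pair (.var 8) (.call 20 (.pair (.var 6) (.call 20 (.pair (.var 4)
    (.call 20 (.pair (.var 2) (.call 20 (.pair (.var 0) .nil)))))))))) <|
  .casePair (.var 0) .nil <| .casePair (.var 1) .nil <| .casePair (.var 1) .nil <|
  .pair (.var 0) (.call 19 (.var 8))

/-- Input: an item and a sorted list of items.  Output: the sorted list of all of them. -/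
def insert : Expr :=
  .casePair (.var 0) .nil <| .casePair (.var 1) (.pair (.var 0) .nil) <|
  .casePair (.var 2) .nil <| .casePair (.var 2) .nil <|
  .ifLe (.var 2) (.var 0) (.pair (.var 6) (.var 7))
    (.pair (.var 4) (.call 20 (.pair (.var 6) (.var 5))))

/-- Input: an annotated game and a utility of the follower.  Output: an optimal strategy profile
for the leader among those that give the follower this utility. -/
def realize : Expr :=
  .casePair (.var 0) .nil <| .casePair (.var 0) .nil <| .casePair (.var 1) .nil <|
  .casePair (.var 1) .nil <| .letIn (.call 9 (.pair (.var 7) (.var 2))) <|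
  .casePair (.var 0)
    (.letIn (.call 12 (.pair .zero (.call 10 (.pair (.var 8) (.var 3))))) <|
      .call 22 (.pair (.var 5) (.pair .zero (.pair (.var 9) (.pair (.var 0) (.var 0)))))) <|
  .call 22 (.pair (.var 6) (.pair .zero (.pair (.var 10) (.call 13 (.pair (.var 10) (.var 5))))))

/-- Input: a list of annotated games, an index, a utility and a bridge.  Output: for each game a
probability and a strategy profile. -/
def realizeAll : Expr :=
  .casePair (.var 0) .nil <| .casePair (.var 0) .nil <| .casePair (.var 3) .nil <|
  .letIn (.call 23 (.pair (.var 0) (.pair (.var 1) (.var 2)))) <| .casePair (.var 0) .nil <|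
  .pair (.pair (.var 0) (.call 21 (.pair (.var 5) (.var 1))))
    (.call 22 (.pair (.var 6) (.pair (.add (.var 3) .one) (.var 4))))

/-- Input: an index, a utility and a bridge, and an annotated game.  Output: the probability of
the game and the utility of the follower in it. -/
def assign : Expr :=
  .casePair (.var 0) .nil <| .casePair (.var 1) .nil <| .casePair (.var 0) .nil <|
  .casePair (.var 1) .nil <| .casePair (.var 0) .nil <| .casePair (.var 1) .nil <|
  .casePair (.var 5) .nil <| .casePair (.var 1) .nil <|
  ifEq (.var 5) (.var 14)
    (ifEq (.var 1) (.var 14) (.pair .one (.var 10))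
      (.pair (.div (.sub (.var 2) (.var 10)) (.sub (.var 2) (.var 6))) (.var 6)))
    (ifEq (.var 1) (.var 14)
      (.pair (.div (.sub (.var 10) (.var 6)) (.sub (.var 2) (.var 6))) (.var 2))
      (.casePair (.var 13) .nil <| .casePair (.var 1) .nil <| .casePair (.var 0) .nil <|
        .casePair (.var 0) .nil <| .pair .zero (.var 0)))

/-- Input: a slope and a point.  Output: the height of the point. -/
def ht : Expr :=
  .casePair (.var 0) .nil <| .casePair (.var 1) .nil <| .casePair (.var 1) .nil <|
  .sub (.var 0) (.mul (.var 4) (.var 2))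

/-- Input: two points, a list of pairs and a list of points.  Output: the lists with the two
points added. -/
def addPair : Expr :=
  .casePair (.var 0) .nil <| .casePair (.var 1) .nil <| .casePair (.var 1) .nil <|
  .casePair (.var 4) .nil <| .casePair (.var 1) .nil <| .casePair (.var 6) .nil <|
  .casePair (.var 1) .nil <|
  .ifLe (.var 6) (.var 2)
    (.ifLe (.var 2) (.var 6)
      (.ifLe (.var 4) (.var 0) (.pair (.var 8) (.pair (.var 10) (.var 9)))
        (.pair (.var 8) (.pair (.var 12) (.var 9))))
      (.pair (.pair (.pair (.div (.sub (.var 0) (.var 4)) (.sub (.var 2) (.var 6)))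
        (.pair (.var 12) (.var 10))) (.var 8)) (.var 9)))
    (.pair (.pair (.pair (.div (.sub (.var 4) (.var 0)) (.sub (.var 6) (.var 2)))
      (.pair (.var 10) (.var 12))) (.var 8)) (.var 9))

/-- Input: a number and a bridge.  Output: the point of the bridge above the number. -/
def interpolate : Expr :=
  .casePair (.var 0) .nil <| .casePair (.var 1) .nil <| .casePair (.var 0) .nil <|
  .casePair (.var 1) .nil <| .casePair (.var 5) .nil <| .casePair (.var 1) .nil <|
  .pair (.var 10) (.pair (.add (.var 4) (.mul (.sub (.var 0) (.var 4))
    (.div (.sub (.var 10) (.var 6)) (.sub (.var 2) (.var 6))))) .zero)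

end Expr

/-- The program that computes a Stackelberg extensive-form correlated equilibrium. -/
def prog : Program :=
  [.main, .annotate, .annotateAll, .minValue, .maxValue, .clipAll, .retag, .clip,
    .filterLe, .filterGt, .filterGe, .filterLt, .best, .bridge, .pairUp, .dropLeft, .dropRight,
    .select, .length, .medians, .insert, .realize, .realizeAll, .assign, .ht, .addPair,
    .interpolate]

/-- The function `body` of the program maps `v` to `w` in at most `T` steps. -/
def Steps (body : Expr) (v w : Val) (T : ℕ) : Prop := ∃ t ≤ T, Eval prog [v] body w t

/-! ## Elementary functions -/

/-- An item consisting of a key and further data. -/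
def itemVal {α : Type*} (key : α → ℝ) (rest : α → Val) (a : α) : Val :=
  .pair (.real (key a)) (rest a)

/-- A list of items. -/
def itemsVal {α : Type*} (key : α → ℝ) (rest : α → Val) (l : List α) : Val :=
  .ofList (l.map (itemVal key rest))

/-- A point. -/
def ptVal : Pt → Val := itemVal Pt.x fun P => .pair (.real P.y) (.real P.tag)

/-- A list of points. -/
def ptsVal : List Pt → Val := itemsVal Pt.x fun P => .pair (.real P.y) (.real P.tag)

section Items

variable {α : Type*} {key : α → ℝ} {rest : α → Val}

/-- The four filters differ only in the test `e`; its environment is stated explicitly so that all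
variable lookups hold by `rfl`. The program is verified throughout by writing out such evaluation
derivations and adding up their costs. -/
theorem steps_filter {f : ℕ} {e : Expr} (hf : prog[f]? = some (.filter f e)) (μ : ℝ)
    (p : α → Bool)
    (he : ∀ a q r ρ, ∃ t ≤ 6, Eval prog (.real (key a) :: rest a :: q :: itemVal key rest a :: r ::
      .real μ :: ρ) e (if p a then .pair (itemVal key rest a) q else q) t) (l : List α) :
    Steps (.filter f e) (.pair (.real μ) (itemsVal key rest l)) (itemsVal key rest (l.filter p))
      (20 * l.length + 5) := by
  induction l with
  | nil => exact ⟨_, by simp, .casePair (.var rfl) (.caseNil (.var rfl) .nil)⟩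
  | cons a l ih =>
    obtain ⟨t, ht, h⟩ := ih
    obtain ⟨t', ht', h'⟩ := he a (itemsVal key rest (l.filter p))
      (itemsVal key rest l) [itemsVal key rest (a :: l),
        .pair (.real μ) (itemsVal key rest (a :: l))]
    have : itemsVal key rest ((a :: l).filter p) =
        if p a then .pair (itemVal key rest a) (itemsVal key rest (l.filter p))
          else itemsVal key rest (l.filter p) := by
      rw [List.filter_cons]
      split_ifs <;> rfl
    rw [this]
    exact ⟨_, by simp only [List.length_cons]; omega, .casePair (.var rfl) (.casePair (.var rfl)
      (.letIn (.call (.pair (.var rfl) (.var rfl)) hf h) (.casePair (.var rfl) h')))⟩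

theorem steps_filterLe (μ : ℝ) (l : List α) :
    Steps .filterLe (.pair (.real μ) (itemsVal key rest l))
      (itemsVal key rest (l.filter fun a => key a ≤ μ)) (20 * l.length + 5) := by
  refine steps_filter rfl μ (fun a => key a ≤ μ) (fun a q r ρ => ?_) l
  by_cases h : key a ≤ μ
  · rw [if_pos (decide_eq_true h)]
    exact ⟨_, by norm_num, .ifTrue (.var rfl) (.var rfl) h (.pair (.var rfl) (.var rfl))⟩
  · rw [if_neg fun h' => h (of_decide_eq_true h')]
    exact ⟨_, by norm_num, .ifFalse (.var rfl) (.var rfl) h (.var rfl)⟩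

theorem steps_filterGt (μ : ℝ) (l : List α) :
    Steps .filterGt (.pair (.real μ) (itemsVal key rest l))
      (itemsVal key rest (l.filter fun a => μ < key a)) (20 * l.length + 5) := by
  refine steps_filter rfl μ (fun a => μ < key a) (fun a q r ρ => ?_) l
  by_cases h : key a ≤ μ
  · rw [if_neg fun h' => not_lt.2 h (of_decide_eq_true h')]
    exact ⟨_, by norm_num, .ifTrue (.var rfl) (.var rfl) h (.var rfl)⟩
  · rw [if_pos (decide_eq_true (not_le.1 h))]
    exact ⟨_, by norm_num, .ifFalse (.var rfl) (.var rfl) h (.pair (.var rfl) (.var rfl))⟩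

theorem steps_filterGe (μ : ℝ) (l : List α) :
    Steps .filterGe (.pair (.real μ) (itemsVal key rest l))
      (itemsVal key rest (l.filter fun a => μ ≤ key a)) (20 * l.length + 5) := by
  refine steps_filter rfl μ (fun a => μ ≤ key a) (fun a q r ρ => ?_) l
  by_cases h : μ ≤ key a
  · rw [if_pos (decide_eq_true h)]
    exact ⟨_, by norm_num, .ifTrue (.var rfl) (.var rfl) h (.pair (.var rfl) (.var rfl))⟩
  · rw [if_neg fun h' => h (of_decide_eq_true h')]
    exact ⟨_, by norm_num, .ifFalse (.var rfl) (.var rfl) h (.var rfl)⟩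

theorem steps_filterLt (μ : ℝ) (l : List α) :
    Steps .filterLt (.pair (.real μ) (itemsVal key rest l))
      (itemsVal key rest (l.filter fun a => key a < μ)) (20 * l.length + 5) := by
  refine steps_filter rfl μ (fun a => key a < μ) (fun a q r ρ => ?_) l
  by_cases h : μ ≤ key a
  · rw [if_neg fun h' => not_lt.2 h (of_decide_eq_true h')]
    exact ⟨_, by norm_num, .ifTrue (.var rfl) (.var rfl) h (.var rfl)⟩
  · rw [if_pos (decide_eq_true (not_le.1 h))]
    exact ⟨_, by norm_num, .ifFalse (.var rfl) (.var rfl) h (.pair (.var rfl) (.var rfl))⟩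

theorem steps_length (l : List α) :
    Steps .length (itemsVal key rest l) (.real l.length) (10 * l.length + 5) := by
  induction l with
  | nil =>
    rw [List.length_nil, Nat.cast_zero]
    exact ⟨_, by simp, .caseNil (.var rfl) .zero⟩
  | cons a l ih =>
    obtain ⟨t, ht, h⟩ := ih
    rw [List.length_cons, Nat.cast_succ, add_comm]
    exact ⟨_, by omega, .casePair (.var rfl) (.add .one (.call (.var rfl) rfl h))⟩

theorem steps_insert (a : α) (l : List α) :
    Steps .insert (.pair (itemVal key rest a) (itemsVal key rest l))
      (itemsVal key rest (l.orderedInsert (fun a b => key a ≤ key b) a)) (20 * l.length + 10) := by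
  induction l with
  | nil =>
    exact ⟨_, by simp, .casePair (.var rfl) (.caseNil (.var rfl) (.pair (.var rfl) .nil))⟩
  | cons b l ih =>
    obtain ⟨t, ht, h⟩ := ih
    rw [List.orderedInsert_cons]
    split_ifs with hab
    · exact ⟨_, by simp only [List.length_cons]; omega,
        .casePair (.var rfl) (.casePair (.var rfl) (.casePair (.var rfl) (.casePair (.var rfl)
          (.ifTrue (.var rfl) (.var rfl) hab (.pair (.var rfl) (.var rfl))))))⟩
    · exact ⟨_, by simp only [List.length_cons]; omega,
        .casePair (.var rfl) (.casePair (.var rfl) (.casePair (.var rfl) (.casePair (.var rfl)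
          (.ifFalse (.var rfl) (.var rfl) hab (.pair (.var rfl)
            (.call (.pair (.var rfl) (.var rfl)) rfl h))))))⟩

/-! ## Selection -/

/-- `M` consists of the medians of disjoint groups of five items of `l`. -/
structure IsMedians (key : α → ℝ) (l M : List α) : Prop where
  subset : M ⊆ l
  length : M.length = l.length / 5
  low : ∀ x, 3 * M.countP (fun a => key a ≤ x) ≤ l.countP fun a => key a ≤ x
  high : ∀ x, 3 * M.countP (fun a => x ≤ key a) ≤ l.countP fun a => x ≤ key a

theorem isMedians_of_length_lt {l : List α} (h : l.length < 5) : IsMedians key l [] :=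
  ⟨by simp, by simp; omega, by simp, by simp⟩

/-- If the median of five is at most `x`, so are two further items, and dually; this is the factor 3
in `low` and `high`. -/
theorem IsMedians.group {l M : List α} (h : IsMedians key l M) {g : List α} {a b c d e : α}
    (hp : g.Perm [a, b, c, d, e]) (hab : key a ≤ key b) (hbc : key b ≤ key c)
    (hcd : key c ≤ key d) (hde : key d ≤ key e) : IsMedians key (g ++ l) (c :: M) := by
  refine ⟨?_, ?_, fun x => ?_, fun x => ?_⟩
  · intro x hx
    rcases List.mem_cons.1 hx with rfl | hx
    · exact List.mem_append_left _ (hp.mem_iff.2 (by simp))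
    · exact List.mem_append_right _ (h.subset hx)
  · rw [List.length_cons, List.length_append, hp.length_eq, h.length]
    simp only [List.length_cons, List.length_nil]
    omega
  · have := h.low x
    rw [List.countP_append, hp.countP_eq, List.countP_cons]
    by_cases hc : key c ≤ x
    · simp only [List.countP_cons, hc, hbc.trans hc, hab.trans (hbc.trans hc), decide_true, if_true]
      omega
    · simp only [hc, decide_false]
      simp only [Bool.false_eq_true, if_false]
      omega
  · have := h.high x
    rw [List.countP_append, hp.countP_eq, List.countP_cons]
    by_cases hc : x ≤ key c
    · simp only [List.countP_cons, hc, hc.trans hcd, hc.trans (hcd.trans hde), decide_true, if_true]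
      omega
    · simp only [hc, decide_false]
      simp only [Bool.false_eq_true, if_false]
      omega

theorem steps_medians (l : List α) : ∃ M, IsMedians key l M ∧
    Steps .medians (itemsVal key rest l) (itemsVal key rest M) (100 * l.length + 20) := by
  match l with
  | [] => exact ⟨[], isMedians_of_length_lt (by simp), _, by simp, .caseNil (.var rfl) .nil⟩
  | [_] =>
    exact ⟨[], isMedians_of_length_lt (by simp), _, by simp,
      .casePair (.var rfl) (.caseNil (.var rfl) .nil)⟩
  | [_, _] =>
    exact ⟨[], isMedians_of_length_lt (by simp), _, by simp,
      .casePair (.var rfl) (.casePair (.var rfl) (.caseNil (.var rfl) .nil))⟩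
  | [_, _, _] =>
    exact ⟨[], isMedians_of_length_lt (by simp), _, by simp, .casePair (.var rfl)
      (.casePair (.var rfl) (.casePair (.var rfl) (.caseNil (.var rfl) .nil)))⟩
  | [_, _, _, _] =>
    exact ⟨[], isMedians_of_length_lt (by simp), _, by simp, .casePair (.var rfl)
      (.casePair (.var rfl) (.casePair (.var rfl) (.casePair (.var rfl)
        (.caseNil (.var rfl) .nil))))⟩
  | a :: b :: c :: d :: e :: l =>
    obtain ⟨M, hM, t, ht, h⟩ := steps_medians l
    let r : α → α → Prop := fun a b => key a ≤ key b
    have : IsTrans α r := ⟨fun _ _ _ => le_trans⟩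
    have : Std.Total r := ⟨fun a b => le_total (key a) (key b)⟩
    obtain ⟨t₁, ht₁, h₁⟩ := steps_insert (key := key) (rest := rest) e []
    obtain ⟨t₂, ht₂, h₂⟩ := steps_insert (key := key) (rest := rest) d ([e].insertionSort r)
    obtain ⟨t₃, ht₃, h₃⟩ := steps_insert (key := key) (rest := rest) c ([d, e].insertionSort r)
    obtain ⟨t₄, ht₄, h₄⟩ := steps_insert (key := key) (rest := rest) b ([c, d, e].insertionSort r)
    obtain ⟨t₅, ht₅, h₅⟩ :=
      steps_insert (key := key) (rest := rest) a ([b, c, d, e].insertionSort r)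
    have hs := List.pairwise_insertionSort r [a, b, c, d, e]
    have hp := List.perm_insertionSort r [a, b, c, d, e]
    -- The five nested insertions are definitionally an insertion sort, from which sortedness and
    -- the permutation property are inherited.
    change Eval prog _ _ (itemsVal key rest ([a, b, c, d, e].insertionSort r)) _ at h₅
    simp only [List.length_insertionSort, List.length_cons, List.length_nil] at ht₁ ht₂ ht₃ ht₄ ht₅
    have hl := hp.length_eq
    generalize [a, b, c, d, e].insertionSort r = s at *
    match s, hl with
    | [a', b', c', d', e'], _ =>
      simp only [List.pairwise_cons, List.mem_cons, forall_eq_or_imp] at hs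
      refine ⟨c' :: M, hM.group hp.symm hs.1.1 hs.2.1.1 hs.2.2.1.1 hs.2.2.2.1.1, _, ?_,
        .casePair (.var rfl) (.casePair (.var rfl) (.casePair (.var rfl) (.casePair (.var rfl)
        (.casePair (.var rfl) (.letIn (.call (.pair (.var rfl) (.call (.pair (.var rfl)
        (.call (.pair (.var rfl) (.call (.pair (.var rfl) (.call (.pair (.var rfl) .nil) rfl h₁))
        rfl h₂)) rfl h₃)) rfl h₄)) rfl h₅)
        (.casePair (.var rfl) (.casePair (.var rfl) (.casePair (.var rfl)
        (.pair (.var rfl) (.call (.var rfl) rfl h))))))))))⟩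
      simp only [List.length_cons]
      omega

/-- A bound for the number of recursive steps of the selection algorithm. -/
def selectCost (n : ℕ) : ℕ := if n < 24 then n ^ 2 else 24 * n

theorem selectCost_le (n : ℕ) : selectCost n ≤ 24 * n := by
  unfold selectCost
  split_ifs with h
  · nlinarith
  · exact le_rfl

/-- The recurrence of median-of-medians selection. Since 1/5 + 7/10 < 1, a linear bound absorbs the
additive 12 once `n ≥ 24`; below that the size may shrink only by one, which the quadratic bound
covers. -/
theorem selectCost_add_le {n m : ℕ} (h : m < n) (h' : 10 * m ≤ 7 * n + 12) :
    selectCost (n / 5) + selectCost m + n ≤ selectCost n := by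
  have h₁ := selectCost_le (n / 5)
  have h₂ := selectCost_le m
  by_cases hn : n < 24
  · have hm : selectCost m ≤ (n - 1) ^ 2 := by
      rw [selectCost, if_pos (by omega)]
      exact Nat.pow_le_pow_left (by omega) 2
    have hq : selectCost (n / 5) = (n / 5) ^ 2 := by rw [selectCost, if_pos (by omega)]
    rw [hq, selectCost.eq_def n, if_pos hn]
    refine (Nat.add_le_add_right (Nat.add_le_add_left hm _) _).trans ?_
    clear h₁ h₂ hm hq
    have : 0 < n := by omega
    clear h h'
    interval_cases n <;> norm_num
  · rw [selectCost.eq_def n, if_neg hn]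
    omega

end Items

/-! ### Ranks, pivots and the cost of selection -/

section Items

variable {α : Type*} {key : α → ℝ} {rest : α → Val}

theorem countP_lt_add_countP_le (key : α → ℝ) (l : List α) (x : ℝ) :
    (l.countP fun a => key a < x) + (l.countP fun a => x ≤ key a) = l.length := by
  rw [List.length_eq_countP_add_countP (fun a => decide (key a < x))]
  congr 2
  funext a
  simp

theorem countP_le_add_countP_lt (key : α → ℝ) (l : List α) (x : ℝ) :
    (l.countP fun a => key a ≤ x) + (l.countP fun a => x < key a) = l.length := by
  rw [List.length_eq_countP_add_countP (fun a => decide (key a ≤ x))]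
  congr 2
  funext a
  simp

/-- The number `x` is a key of rank `k` in the list. -/
structure IsRank (key : α → ℝ) (l : List α) (k x : ℝ) : Prop where
  mem : ∃ a ∈ l, key a = x
  le : k ≤ l.countP fun a => key a ≤ x
  ge : (l.countP fun a => key a < x) ≤ k

theorem IsRank.length_le_two_mul {l : List α} {x : ℝ} (h : IsRank key l (l.length / 2) x) :
    l.length ≤ 2 * (l.countP fun a => key a ≤ x) ∧
      l.length ≤ 2 * (l.countP fun a => x ≤ key a) := by
  have h₁ := h.le
  have h₂ := h.ge
  have h₃ := countP_lt_add_countP_le key l x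
  rw [div_le_iff₀ two_pos] at h₁
  rw [le_div_iff₀ two_pos] at h₂
  norm_cast at h₁ h₂
  omega

/-- The number `x` splits the list into two parts that are not too large. -/
structure IsPivot (key : α → ℝ) (l : List α) (x : ℝ) : Prop where
  mem : ∃ a ∈ l, key a = x
  lt : 10 * (l.countP fun a => key a < x) ≤ 7 * l.length + 12
  gt : 10 * (l.countP fun a => x < key a) ≤ 7 * l.length + 12

theorem IsPivot.countP_lt_lt {l : List α} {x : ℝ} (h : IsPivot key l x) :
    (l.countP fun a => key a < x) < l.length ∧ (l.countP fun a => x < key a) < l.length := by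
  obtain ⟨a, ha, rfl⟩ := h.mem
  have h₁ := countP_lt_add_countP_le key l (key a)
  have h₂ := countP_le_add_countP_lt key l (key a)
  have h₃ : 0 < l.countP fun b => key a ≤ key b := List.countP_pos_iff.2 ⟨a, ha, by simp⟩
  have h₄ : 0 < l.countP fun b => key b ≤ key a := List.countP_pos_iff.2 ⟨a, ha, by simp⟩
  omega

/-- At least half of the `l.length / 5` medians lie on each closed side of `x`, and each median
carries three items. With at most four ungrouped items this leaves at most (7n + 12)/10 items on
either open side. -/
theorem IsMedians.isPivot {l M : List α} {x : ℝ} (hM : IsMedians key l M)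
    (h : IsRank key M (M.length / 2) x) : IsPivot key l x := by
  obtain ⟨a, ha, hx⟩ := h.mem
  have h₁ := countP_lt_add_countP_le key l x
  have h₂ := countP_le_add_countP_lt key l x
  have h₃ := h.length_le_two_mul
  have h₄ := hM.low x
  have h₅ := hM.high x
  have h₆ := hM.length
  exact ⟨⟨a, hM.subset ha, hx⟩, by omega, by omega⟩

theorem IsRank.of_filter_lt {l : List α} {k x y : ℝ}
    (h : IsRank key (l.filter fun a => key a < x) k y) : IsRank key l k y := by
  obtain ⟨a, ha, rfl⟩ := h.mem
  simp only [List.mem_filter, decide_eq_true_iff] at ha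
  refine ⟨⟨a, ha.1, rfl⟩, h.le.trans ?_, le_trans ?_ h.ge⟩
  · exact_mod_cast List.filter_sublist.countP_le
  · rw [List.countP_filter]
    refine le_of_eq ?_
    congr 2
    funext b
    by_cases hb : key b < key a
    · simp [hb, hb.trans ha.2]
    · simp [hb]

theorem IsRank.of_filter_gt {l : List α} {k x y : ℝ}
    (h : IsRank key (l.filter fun a => x < key a) (k - l.countP fun a => key a ≤ x) y) :
    IsRank key l k y := by
  obtain ⟨a, ha, rfl⟩ := h.mem
  simp only [List.mem_filter, decide_eq_true_iff] at ha
  -- If a test accepts every key up to `x`, its count splits into the discarded items and those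
  -- counted in the filtered list; this gives the shift of the rank.
  have key₁ (q : α → Bool) (hq : ∀ b, key b ≤ x → q b = true) :
      (l.countP fun b => key b ≤ x) + (l.filter fun b => x < key b).countP q = l.countP q := by
    clear h ha
    induction l with
    | nil => simp
    | cons b l ih =>
      by_cases hb : key b ≤ x
      · simp only [List.countP_cons, hb, not_lt.2 hb, hq b hb, decide_true, decide_false,
          List.filter_cons, if_true, Bool.false_eq_true, if_false]
        omega
      · simp only [List.countP_cons, hb, not_le.1 hb, decide_true, decide_false,
          List.filter_cons, if_true, Bool.false_eq_true, if_false]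
        omega
  have h₁ := key₁ (fun b => key b ≤ key a) fun b hb => decide_eq_true (hb.trans ha.2.le)
  have h₂ := key₁ (fun b => key b < key a) fun b hb => decide_eq_true (hb.trans_lt ha.2)
  have h₃ := h.le
  have h₄ := h.ge
  refine ⟨⟨a, ha.1, rfl⟩, ?_, ?_⟩
  · rw [← h₁, Nat.cast_add]
    linarith
  · rw [← h₂, Nat.cast_add]
    linarith

theorem eval_half {ρ : List Val} {k : ℕ} {l : List α} (h : ρ[k]? = some (itemsVal key rest l)) :
    ∃ t ≤ 10 * l.length + 11,
      Eval prog ρ (.div (.call 18 (.var k)) .two) (.real (l.length / 2)) t := by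
  obtain ⟨t, ht, h'⟩ := steps_length (key := key) (rest := rest) l
  rw [show (2 : ℝ) = 1 + 1 by norm_num]
  exact ⟨_, by omega, .div (.call (.var h) rfl h') (.add .one .one) (by norm_num)⟩

/-- Median of medians: the pivot is the median of the medians of five, and the search continues in
the smaller or the larger keys unless the pivot has the rank. Ranks are real because half a length
is computed by division and need not be an integer. -/
theorem steps_select (l : List α) (k : ℝ) (hk : 0 < k) (hk' : k ≤ l.length) :
    ∃ x, IsRank key l k x ∧ Steps .select (.pair (.real k) (itemsVal key rest l)) (.real x)
      (500 * selectCost l.length) := by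
  induction hn : l.length using Nat.strong_induction_on generalizing l k with
  | _ n ih =>
  subst hn
  have hpos : 0 < l.length := by exact_mod_cast hk.trans_le hk'
  obtain ⟨M, hM, tM, htM, hM'⟩ := steps_medians (key := key) (rest := rest) l
  have hpivot : ∃ x, IsPivot key l x ∧
      ∃ t ≤ 500 * selectCost (l.length / 5) + 10 * l.length + 40,
        Eval prog [itemsVal key rest M, .real k, itemsVal key rest l,
            .pair (.real k) (itemsVal key rest l)]
          (.casePair (.var 0) (.casePair (.var 2) .nil <| .casePair (.var 0) .nil (.var 0))
            (.call 17 (.pair (.div (.call 18 (.var 2)) .two) (.var 2)))) (.real x) t := by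
    match M, hM with
    -- No group means fewer than five items; any of them, here the first, is a pivot thanks to the
    -- additive 12.
    | [], hM =>
      have hl := hM.length
      match l, hpos with
      | a :: l, _ =>
        have h₁ := countP_lt_add_countP_le key (a :: l) (key a)
        have h₂ := countP_le_add_countP_lt key (a :: l) (key a)
        simp only [List.length_cons, List.length_nil] at hl h₁ h₂
        exact ⟨key a, ⟨⟨a, by simp, rfl⟩, by simp only [List.length_cons]; omega,
          by simp only [List.length_cons]; omega⟩, _, by simp only [List.length_cons]; omega,
          .caseNil (.var rfl) (.casePair (.var rfl) (.casePair (.var rfl) (.var rfl)))⟩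
    | a :: M, hM =>
      have hl := hM.length
      have hlt : (a :: M).length < l.length := by omega
      obtain ⟨x, hx, t, ht, h⟩ := ih _ hlt (a :: M) ((a :: M).length / 2)
        (by simp only [List.length_cons]; positivity) (half_le_self (by positivity)) rfl
      obtain ⟨t', ht', h'⟩ := eval_half (key := key) (rest := rest) (k := 2) (l := a :: M)
        (ρ := [itemVal key rest a, itemsVal key rest M, itemsVal key rest (a :: M), .real k,
          itemsVal key rest l, .pair (.real k) (itemsVal key rest l)]) rfl
      rw [hl] at ht
      exact ⟨x, hM.isPivot hx, _, by omega,
        .casePair (.var rfl) (.call (.pair h' (.var rfl)) rfl h)⟩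
  obtain ⟨x, hx, tx, htx, hx'⟩ := hpivot
  obtain ⟨t₁, ht₁, h₁⟩ := steps_filterLt (key := key) (rest := rest) x l
  obtain ⟨t₂, ht₂, h₂⟩ := steps_length (key := key) (rest := rest) (l.filter fun a => key a < x)
  obtain ⟨t₃, ht₃, h₃⟩ := steps_filterGt (key := key) (rest := rest) x l
  obtain ⟨t₄, ht₄, h₄⟩ := steps_length (key := key) (rest := rest) (l.filter fun a => x < key a)
  obtain ⟨t₅, ht₅, h₅⟩ := steps_length (key := key) (rest := rest) l
  have hlt := hx.lt
  have hgt := hx.gt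
  have hlt' := hx.countP_lt_lt
  simp only [List.countP_eq_length_filter] at hlt hgt hlt'
  by_cases hc : k ≤ (l.filter fun a => key a < x).length
  · obtain ⟨y, hy, t, ht, h⟩ := ih _ hlt'.1 (l.filter fun a => key a < x) k hk hc rfl
    have := selectCost_add_le hlt'.1 hlt
    exact ⟨y, hy.of_filter_lt, _, by omega, .casePair (.var rfl) (.letIn (.call (.var rfl) rfl hM')
      (.letIn hx' (.letIn (.call (.pair (.var rfl) (.var rfl)) rfl h₁)
      (.letIn (.call (.var rfl) rfl h₂) (.ifTrue (.var rfl) (.var rfl) hc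
      (.call (.pair (.var rfl) (.var rfl)) rfl h))))))⟩
  -- The program obtains the number of keys up to `x` by subtraction, without a further filter.
  · have hsub : (l.length : ℝ) - (l.filter fun a => x < key a).length =
        l.countP fun a => key a ≤ x := by
      rw [← countP_le_add_countP_lt key l x, List.countP_eq_length_filter (l := l) (p := fun a => decide (x < key a))]
      push_cast
      ring
    have hpre {w : Val} {t : ℕ} (h : Eval prog [.real (l.countP fun a => key a ≤ x),
        itemsVal key rest (l.filter fun a => x < key a),
        .real (l.filter fun a => key a < x).length,
        itemsVal key rest (l.filter fun a => key a < x), .real x, itemsVal key rest M, .real k,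
        itemsVal key rest l, .pair (.real k) (itemsVal key rest l)]
        (.ifLe (.var 6) (.var 0) (.var 4)
          (.call 17 (.pair (.sub (.var 6) (.var 0)) (.var 1)))) w t) :
        Steps .select (.pair (.real k) (itemsVal key rest l)) w
          (500 * selectCost (l.length / 5) + 250 * l.length + 200 + t) := by
      rw [← hsub] at h
      exact ⟨_, by omega, .casePair (.var rfl) (.letIn (.call (.var rfl) rfl hM')
        (.letIn hx' (.letIn (.call (.pair (.var rfl) (.var rfl)) rfl h₁)
        (.letIn (.call (.var rfl) rfl h₂) (.ifFalse (.var rfl) (.var rfl) hc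
        (.letIn (.call (.pair (.var rfl) (.var rfl)) rfl h₃)
        (.letIn (.sub (.call (.var rfl) rfl h₅) (.call (.var rfl) rfl h₄)) h)))))))⟩
    have hcost := selectCost_add_le hlt'.2 hgt
    by_cases hc' : k ≤ l.countP fun a => key a ≤ x
    · obtain ⟨t, ht, h⟩ := hpre (.ifTrue (.var rfl) (.var rfl) hc' (.var rfl))
      refine ⟨x, ⟨hx.mem, hc', ?_⟩, t, by omega, h⟩
      rw [List.countP_eq_length_filter]
      exact (not_le.1 hc).le
    · have hk₂ : k - (l.countP fun a => key a ≤ x) ≤ (l.filter fun a => x < key a).length := by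
        rw [← hsub]
        linarith
      obtain ⟨y, hy, t, ht, h⟩ := ih _ hlt'.2 (l.filter fun a => x < key a)
        (k - l.countP fun a => key a ≤ x) (sub_pos.2 (not_le.1 hc')) hk₂ rfl
      obtain ⟨t', ht', h'⟩ := hpre (.ifFalse (.var rfl) (.var rfl) hc'
        (.call (.pair (.sub (.var rfl) (.var rfl)) (.var rfl)) rfl h))
      exact ⟨y, hy.of_filter_gt, t', by omega, h'⟩

end Items

/-! ## Bridges -/

theorem steps_ht (a : ℝ) (P : Pt) : Steps .ht (.pair (.real a) (ptVal P)) (.real (P.ht a)) 15 :=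
  ⟨_, by norm_num, .casePair (.var rfl) (.casePair (.var rfl) (.casePair (.var rfl)
    (.sub (.var rfl) (.mul (.var rfl) (.var rfl)))))⟩

theorem steps_best (a : ℝ) (l : List Pt) (hl : l ≠ []) :
    ∃ A ∈ l, (∀ P ∈ l, P.ht a ≤ A.ht a) ∧
      Steps .best (.pair (.real a) (ptsVal l)) (ptVal A) (100 * l.length) := by
  induction l with
  | nil => exact absurd rfl hl
  | cons P l ih =>
    cases l with
    | nil =>
      exact ⟨P, by simp, by simp, _, by simp,
        .casePair (.var rfl) (.casePair (.var rfl) (.caseNil (.var rfl) (.var rfl)))⟩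
    | cons Q l =>
      obtain ⟨A, hA, hmax, t, ht, h⟩ := ih (by simp)
      obtain ⟨t₁, ht₁, h₁⟩ := steps_ht a P
      obtain ⟨t₂, ht₂, h₂⟩ := steps_ht a A
      by_cases hPA : P.ht a ≤ A.ht a
      · refine ⟨A, List.mem_cons_of_mem _ hA, ?_, _, ?_, .casePair (.var rfl) (.casePair (.var rfl)
          (.casePair (.var rfl) (.letIn (.call (.pair (.var rfl) (.var rfl)) rfl h)
          (.ifTrue (.call (.pair (.var rfl) (.var rfl)) rfl h₁)
          (.call (.pair (.var rfl) (.var rfl)) rfl h₂) hPA (.var rfl)))))⟩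
        · intro R hR
          rcases List.mem_cons.1 hR with rfl | hR
          · exact hPA
          · exact hmax R hR
        · simp only [List.length_cons] at *
          omega
      · refine ⟨P, List.mem_cons_self, ?_, _, ?_, .casePair (.var rfl) (.casePair (.var rfl)
          (.casePair (.var rfl) (.letIn (.call (.pair (.var rfl) (.var rfl)) rfl h)
          (.ifFalse (.call (.pair (.var rfl) (.var rfl)) rfl h₁)
          (.call (.pair (.var rfl) (.var rfl)) rfl h₂) hPA (.var rfl)))))⟩
        · intro R hR
          rcases List.mem_cons.1 hR with rfl | hR
          · exact le_rfl
          · exact (hmax R hR).trans (not_le.1 hPA).le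
        · simp only [List.length_cons] at *
          omega

/-! ### Chords and the pairing of points -/

/-- A pair of points with the slope of the line through them. -/
structure Chord where
  slope : ℝ
  left : Pt
  right : Pt

/-- The points of a chord. -/
def Chord.rest (τ : Chord) : Val := .pair (ptVal τ.left) (ptVal τ.right)

/-- A list of chords. -/
def chordsVal : List Chord → Val := itemsVal Chord.slope Chord.rest

/-- The slope of a chord is the slope of the line through its points. -/
structure Chord.IsProper (τ : Chord) : Prop where
  lt : τ.left.x < τ.right.x
  slope_mul : τ.slope * (τ.right.x - τ.left.x) = τ.right.y - τ.left.y

/-- The chords `T` and the points `U` make up `L`, up to points below other ones. -/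
structure IsPairing (L : List Pt) (T : List Chord) (U : List Pt) : Prop where
  proper : ∀ τ ∈ T, τ.IsProper
  mem_left : ∀ τ ∈ T, τ.left ∈ L
  mem_right : ∀ τ ∈ T, τ.right ∈ L
  subset : U ⊆ L
  cover : ∀ P ∈ L, (∃ τ ∈ T, P = τ.left ∨ P = τ.right) ∨ ∃ Q ∈ U, Q.x = P.x ∧ P.y ≤ Q.y
  length_le : 2 * T.length + U.length ≤ L.length
  le_length : 2 * T.length + 2 * U.length ≤ L.length + 1

theorem IsPairing.addChord {L : List Pt} {T : List Chord} {U : List Pt} (h : IsPairing L T U)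
    {τ : Chord} (hτ : τ.IsProper) {P Q : Pt}
    (hPQ : τ.left = P ∧ τ.right = Q ∨ τ.left = Q ∧ τ.right = P) :
    IsPairing (P :: Q :: L) (τ :: T) U := by
  have hsub : L ⊆ P :: Q :: L := fun R hR => List.mem_cons_of_mem _ (List.mem_cons_of_mem _ hR)
  refine ⟨?_, ?_, ?_, fun R hR => hsub (h.subset hR), ?_, ?_, ?_⟩
  · simpa only [List.forall_mem_cons] using ⟨hτ, h.proper⟩
  · rw [List.forall_mem_cons]
    refine ⟨?_, fun τ hτ => hsub (h.mem_left τ hτ)⟩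
    rcases hPQ with ⟨rfl, rfl⟩ | ⟨rfl, rfl⟩ <;> simp
  · rw [List.forall_mem_cons]
    refine ⟨?_, fun τ hτ => hsub (h.mem_right τ hτ)⟩
    rcases hPQ with ⟨rfl, rfl⟩ | ⟨rfl, rfl⟩ <;> simp
  · intro R hR
    simp only [List.mem_cons] at hR
    rcases hR with rfl | rfl | hR
    · refine .inl ⟨τ, List.mem_cons_self, ?_⟩
      rcases hPQ with h | h
      · exact .inl h.1.symm
      · exact .inr h.2.symm
    · refine .inl ⟨τ, List.mem_cons_self, ?_⟩
      rcases hPQ with h | h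
      · exact .inr h.2.symm
      · exact .inl h.1.symm
    · exact (h.cover R hR).imp_left fun ⟨τ', h', h''⟩ => ⟨τ', List.mem_cons_of_mem _ h', h''⟩
  · have := h.length_le
    simp only [List.length_cons]
    omega
  · have := h.le_length
    simp only [List.length_cons]
    omega

theorem IsPairing.addPoint {L : List Pt} {T : List Chord} {U : List Pt} (h : IsPairing L T U)
    {P Q R : Pt} (hR : R = P ∨ R = Q) (hP : R.x = P.x ∧ P.y ≤ R.y) (hQ : R.x = Q.x ∧ Q.y ≤ R.y) :
    IsPairing (P :: Q :: L) T (R :: U) := by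
  have hsub : L ⊆ P :: Q :: L := fun R hR => List.mem_cons_of_mem _ (List.mem_cons_of_mem _ hR)
  refine ⟨h.proper, fun τ hτ => hsub (h.mem_left τ hτ), fun τ hτ => hsub (h.mem_right τ hτ),
    ?_, ?_, ?_, ?_⟩
  · intro S hS
    rcases List.mem_cons.1 hS with rfl | hS
    · rcases hR with rfl | rfl <;> simp
    · exact hsub (h.subset hS)
  · intro S hS
    simp only [List.mem_cons] at hS
    rcases hS with rfl | rfl | hS
    · exact .inr ⟨R, List.mem_cons_self, hP⟩
    · exact .inr ⟨R, List.mem_cons_self, hQ⟩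
    · exact (h.cover S hS).imp_right fun ⟨S', h', h''⟩ => ⟨S', List.mem_cons_of_mem _ h', h''⟩
  · have := h.length_le
    simp only [List.length_cons]
    omega
  · have := h.le_length
    simp only [List.length_cons]
    omega

/-- Two points with the same abscissa have no slope; the lower one is irrelevant for every bridge
and is dropped, so such a pair shrinks at once. -/
theorem steps_addPair {L : List Pt} {T : List Chord} {U : List Pt} (h : IsPairing L T U)
    (P Q : Pt) : ∃ T' U', IsPairing (P :: Q :: L) T' U' ∧
      Steps .addPair (.pair (ptVal P) (.pair (ptVal Q) (.pair (chordsVal T) (ptsVal U))))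
        (.pair (chordsVal T') (ptsVal U')) 60 := by
  have hpre {w : Val} {t : ℕ} {e : Expr} (ht : t ≤ 46) (h : Eval prog [.real Q.y, .real Q.tag, .real Q.x,
      .pair (.real Q.y) (.real Q.tag), .real P.y, .real P.tag, .real P.x,
      .pair (.real P.y) (.real P.tag), chordsVal T, ptsVal U, ptVal Q,
      .pair (chordsVal T) (ptsVal U), ptVal P,
      .pair (ptVal Q) (.pair (chordsVal T) (ptsVal U)),
      .pair (ptVal P) (.pair (ptVal Q) (.pair (chordsVal T) (ptsVal U)))] e w t) :
      ∃ t' ≤ 60, Eval prog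
        [.pair (ptVal P) (.pair (ptVal Q) (.pair (chordsVal T) (ptsVal U)))]
        (.casePair (.var 0) .nil <| .casePair (.var 1) .nil <| .casePair (.var 1) .nil <|
          .casePair (.var 4) .nil <| .casePair (.var 1) .nil <| .casePair (.var 6) .nil <|
          .casePair (.var 1) .nil e) w t' :=
    ⟨_, by omega, .casePair (.var rfl) (.casePair (.var rfl) (.casePair (.var rfl)
      (.casePair (.var rfl) (.casePair (.var rfl) (.casePair (.var rfl)
      (.casePair (.var rfl) h))))))⟩
  by_cases h₁ : P.x ≤ Q.x
  · by_cases h₂ : Q.x ≤ P.x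
    · have hx := le_antisymm h₁ h₂
      by_cases h₃ : P.y ≤ Q.y
      · exact ⟨T, Q :: U, h.addPoint (.inr rfl) ⟨hx.symm, h₃⟩ ⟨rfl, le_rfl⟩,
          hpre (by norm_num) (.ifTrue (.var rfl) (.var rfl) h₁ (.ifTrue (.var rfl) (.var rfl) h₂
            (.ifTrue (.var rfl) (.var rfl) h₃
              (.pair (.var rfl) (.pair (.var rfl) (.var rfl))))))⟩
      · exact ⟨T, P :: U, h.addPoint (.inl rfl) ⟨rfl, le_rfl⟩ ⟨hx, (not_le.1 h₃).le⟩,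
          hpre (by norm_num) (.ifTrue (.var rfl) (.var rfl) h₁ (.ifTrue (.var rfl) (.var rfl) h₂
            (.ifFalse (.var rfl) (.var rfl) h₃
              (.pair (.var rfl) (.pair (.var rfl) (.var rfl))))))⟩
    · have hd := sub_pos.2 (not_le.1 h₂)
      exact ⟨⟨(Q.y - P.y) / (Q.x - P.x), P, Q⟩ :: T, U,
        h.addChord ⟨not_le.1 h₂, div_mul_cancel₀ _ hd.ne'⟩ (.inl ⟨rfl, rfl⟩),
        hpre (by norm_num) (.ifTrue (.var rfl) (.var rfl) h₁ (.ifFalse (.var rfl) (.var rfl) h₂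
          (.pair (.pair (.pair (.div (.sub (.var rfl) (.var rfl)) (.sub (.var rfl) (.var rfl))
            hd.ne') (.pair (.var rfl) (.var rfl))) (.var rfl)) (.var rfl))))⟩
  · have hd := sub_pos.2 (not_le.1 h₁)
    exact ⟨⟨(P.y - Q.y) / (P.x - Q.x), Q, P⟩ :: T, U,
      h.addChord ⟨not_le.1 h₁, div_mul_cancel₀ _ hd.ne'⟩ (.inr ⟨rfl, rfl⟩),
      hpre (by norm_num) (.ifFalse (.var rfl) (.var rfl) h₁
        (.pair (.pair (.pair (.div (.sub (.var rfl) (.var rfl)) (.sub (.var rfl) (.var rfl))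
          hd.ne') (.pair (.var rfl) (.var rfl))) (.var rfl)) (.var rfl)))⟩

theorem steps_pairUp (L : List Pt) : ∃ T U, IsPairing L T U ∧
    Steps .pairUp (ptsVal L) (.pair (chordsVal T) (ptsVal U)) (100 * L.length + 10) := by
  match L with
  | [] =>
    exact ⟨[], [], ⟨by simp, by simp, by simp, by simp, by simp, by simp, by simp⟩, _, by simp,
      .caseNil (.var rfl) (.pair .nil .nil)⟩
  | [P] =>
    exact ⟨[], [P], ⟨by simp, by simp, by simp, by simp, by simp, by simp, by simp⟩, _, by simp,
      .casePair (.var rfl) (.caseNil (.var rfl) (.pair .nil (.pair (.var rfl) .nil)))⟩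
  | P :: Q :: L =>
    obtain ⟨T, U, h, t, ht, h'⟩ := steps_pairUp L
    obtain ⟨T', U', hTU, t₁, ht₁, h₁⟩ := steps_addPair h P Q
    exact ⟨T', U', hTU, _, by simp only [List.length_cons]; omega,
      .casePair (.var rfl) (.casePair (.var rfl) (.call (.pair (.var rfl) (.pair (.var rfl)
        (.call (.var rfl) rfl h'))) rfl h₁))⟩

/-- Along a chord at least as steep as the reference line, height does not decrease to the right;
this justifies dropping the left endpoint. -/
theorem Chord.IsProper.ht_le_of_le {τ : Chord} (h : τ.IsProper) {a : ℝ} (ha : a ≤ τ.slope) :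
    τ.left.ht a ≤ τ.right.ht a := by
  have := h.slope_mul
  simp only [Pt.ht]
  nlinarith [mul_nonneg (sub_nonneg.2 ha) (sub_pos.2 h.lt).le]

theorem Chord.IsProper.ht_le_of_ge {τ : Chord} (h : τ.IsProper) {a : ℝ} (ha : τ.slope ≤ a) :
    τ.right.ht a ≤ τ.left.ht a := by
  have := h.slope_mul
  simp only [Pt.ht]
  nlinarith [mul_nonneg (sub_nonneg.2 ha) (sub_pos.2 h.lt).le]

theorem steps_dropLeft (a : ℝ) (T : List Chord) (U : List Pt) : ∃ L,
    (∀ P, P ∈ L ↔ P ∈ U ∨ ∃ τ ∈ T, P = τ.right ∨ P = τ.left ∧ τ.slope < a) ∧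
    L.length + (T.countP fun τ => a ≤ τ.slope) = U.length + 2 * T.length ∧
    Steps .dropLeft (.pair (.real a) (.pair (chordsVal T) (ptsVal U))) (ptsVal L)
      (40 * T.length + 10) := by
  induction T with
  | nil =>
    exact ⟨U, by simp, by simp, _, by simp,
      .casePair (.var rfl) (.casePair (.var rfl) (.caseNil (.var rfl) (.var rfl)))⟩
  | cons τ T ih =>
    obtain ⟨L, hL, hlen, t, ht, h⟩ := ih
    by_cases hτ : a ≤ τ.slope
    · refine ⟨τ.right :: L, fun P => ?_, ?_, _, ?_, .casePair (.var rfl) (.casePair (.var rfl)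
        (.casePair (.var rfl) (.letIn (.call (.pair (.var rfl) (.pair (.var rfl) (.var rfl))) rfl h)
        (.casePair (.var rfl) (.casePair (.var rfl) (.ifTrue (.var rfl) (.var rfl) hτ
        (.pair (.var rfl) (.var rfl))))))))⟩
      · simp only [List.mem_cons, hL, exists_eq_or_imp, not_lt.2 hτ, and_false, or_false]
        exact or_left_comm
      · simp only [List.length_cons, List.countP_cons, hτ, decide_true, if_true]
        omega
      · simp only [List.length_cons]
        omega
    · refine ⟨τ.left :: τ.right :: L, fun P => ?_, ?_, _, ?_, .casePair (.var rfl)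
        (.casePair (.var rfl) (.casePair (.var rfl)
        (.letIn (.call (.pair (.var rfl) (.pair (.var rfl) (.var rfl))) rfl h)
        (.casePair (.var rfl) (.casePair (.var rfl) (.ifFalse (.var rfl) (.var rfl) hτ
        (.pair (.var rfl) (.pair (.var rfl) (.var rfl)))))))))⟩
      · simp only [List.mem_cons, hL, exists_eq_or_imp, not_le.1 hτ, and_true]
        grind
      · simp only [List.length_cons, List.countP_cons, hτ, decide_false, Bool.false_eq_true,
          if_false]
        omega
      · simp only [List.length_cons]
        omega

theorem steps_dropRight (a : ℝ) (T : List Chord) (U : List Pt) : ∃ L,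
    (∀ P, P ∈ L ↔ P ∈ U ∨ ∃ τ ∈ T, P = τ.left ∨ P = τ.right ∧ a < τ.slope) ∧
    L.length + (T.countP fun τ => τ.slope ≤ a) = U.length + 2 * T.length ∧
    Steps .dropRight (.pair (.real a) (.pair (chordsVal T) (ptsVal U))) (ptsVal L)
      (40 * T.length + 10) := by
  induction T with
  | nil =>
    exact ⟨U, by simp, by simp, _, by simp,
      .casePair (.var rfl) (.casePair (.var rfl) (.caseNil (.var rfl) (.var rfl)))⟩
  | cons τ T ih =>
    obtain ⟨L, hL, hlen, t, ht, h⟩ := ih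
    by_cases hτ : τ.slope ≤ a
    · refine ⟨τ.left :: L, fun P => ?_, ?_, _, ?_, .casePair (.var rfl) (.casePair (.var rfl)
        (.casePair (.var rfl) (.letIn (.call (.pair (.var rfl) (.pair (.var rfl) (.var rfl))) rfl h)
        (.casePair (.var rfl) (.casePair (.var rfl) (.ifTrue (.var rfl) (.var rfl) hτ
        (.pair (.var rfl) (.var rfl))))))))⟩
      · simp only [List.mem_cons, hL, exists_eq_or_imp, not_lt.2 hτ, and_false, or_false]
        exact or_left_comm
      · simp only [List.length_cons, List.countP_cons, hτ, decide_true, if_true]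
        omega
      · simp only [List.length_cons]
        omega
    · refine ⟨τ.left :: τ.right :: L, fun P => ?_, ?_, _, ?_, .casePair (.var rfl)
        (.casePair (.var rfl) (.casePair (.var rfl)
        (.letIn (.call (.pair (.var rfl) (.pair (.var rfl) (.var rfl))) rfl h)
        (.casePair (.var rfl) (.casePair (.var rfl) (.ifFalse (.var rfl) (.var rfl) hτ
        (.pair (.var rfl) (.pair (.var rfl) (.var rfl)))))))))⟩
      · simp only [List.mem_cons, hL, exists_eq_or_imp, not_le.1 hτ, and_true]
        grind
      · simp only [List.length_cons, List.countP_cons, hτ, decide_false, Bool.false_eq_true,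
          if_false]
        omega
      · simp only [List.length_cons]
        omega

/-! ### Linear-time bridge search and clipping -/

theorem steps_best_filter {f : ℕ} {e : Expr} (hf : prog[f]? = some e) (a μ : ℝ) (L : List Pt)
    (p : Pt → Prop) [DecidablePred p]
    (h : Steps e (.pair (.real μ) (ptsVal L)) (ptsVal (L.filter p)) (20 * L.length + 5))
    (hL : ∃ P ∈ L, p P) {ρ : List Val} {i j k : Expr} {ti tj tk : ℕ}
    (hi : Eval prog ρ i (.real a) ti) (hj : Eval prog ρ j (.real μ) tj)
    (hk : Eval prog ρ k (ptsVal L) tk) : ∃ A, IsBest a p L A ∧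
    ∃ t ≤ 120 * L.length + 10 + ti + tj + tk,
      Eval prog ρ (.call 12 (.pair i (.call f (.pair j k)))) (ptVal A) t := by
  obtain ⟨P, hP, hpP⟩ := hL
  obtain ⟨t, ht, h⟩ := h
  obtain ⟨A, hA, hmax, t', ht', h'⟩ := steps_best a (L.filter p)
    (List.ne_nil_of_mem (List.mem_filter.2 ⟨hP, decide_eq_true hpP⟩))
  have hlen := List.length_filter_le p L
  rw [List.mem_filter, decide_eq_true_iff] at hA
  exact ⟨A, ⟨hA.1, hA.2, fun Q hQ hpQ => hmax Q (List.mem_filter.2 ⟨hQ, decide_eq_true hpQ⟩)⟩,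
    _, by omega, .call (.pair hi (.call (.pair hj hk) hf h)) rfl h'⟩

/-- Prune and search with the median slope `a` of the chords. Comparing the highest points on both
sides of `μ` shows on which side of `a` the slope of the bridge lies; at least half of the chords
lie on the other side of `a` (or have slope `a`) and lose an endpoint. By the length bounds of
`IsPairing` the remaining list has at most about three quarters of the points, so the costs form a
geometric series. -/
theorem steps_bridge (μ : ℝ) (L : List Pt) (hl : ∃ P ∈ L, P.x ≤ μ) (hr : ∃ P ∈ L, μ < P.x) :
    ∃ l r, IsBridge μ L l r ∧ μ < r.x ∧
      Steps .bridge (.pair (.real μ) (ptsVal L)) (.pair (ptVal l) (ptVal r))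
        (120000 * L.length) := by
  induction hn : L.length using Nat.strong_induction_on generalizing L with
  | _ n ih =>
  subst hn
  have hn : 2 ≤ L.length := by
    by_contra! hlt
    obtain ⟨P, hP, hPx⟩ := hl
    obtain ⟨Q, hQ, hQx⟩ := hr
    match L, hlt with
    | [], _ => simp at hP
    | [R], _ =>
      rw [List.mem_singleton.1 hP] at hPx
      rw [List.mem_singleton.1 hQ] at hQx
      exact absurd hPx (not_le.2 hQx)
  obtain ⟨T, U, hTU, tp, htp, hp⟩ := steps_pairUp L
  have hlen₁ := hTU.length_le
  have hlen₂ := hTU.le_length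
  match T, hTU with
  -- Every pair shared its abscissa, so pairing alone halves the list up to rounding.
  | [], hTU =>
    simp only [List.length_nil] at hlen₁ hlen₂
    have hcover (P) (hP : P ∈ L) : ∃ Q ∈ U, Q.x = P.x ∧ P.y ≤ Q.y := by
      simpa using hTU.cover P hP
    have hl' : ∃ P ∈ U, P.x ≤ μ := by
      obtain ⟨P, hP, hx⟩ := hl
      obtain ⟨Q, hQ, h⟩ := hcover P hP
      exact ⟨Q, hQ, h.1 ▸ hx⟩
    have hr' : ∃ P ∈ U, μ < P.x := by
      obtain ⟨P, hP, hx⟩ := hr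
      obtain ⟨Q, hQ, h⟩ := hcover P hP
      exact ⟨Q, hQ, h.1 ▸ hx⟩
    obtain ⟨l, r, hlr, hrx, t, ht, h⟩ := ih U.length (by omega) U hl' hr' rfl
    refine ⟨l, r, ?_, hrx, _, ?_, .casePair (.var rfl) (.letIn (.call (.var rfl) rfl hp)
      (.casePair (.var rfl) (.caseNil (.var rfl) (.call (.pair (.var rfl) (.var rfl)) rfl h))))⟩
    · obtain ⟨a, ha, hmax⟩ := hlr.exists_slope
      refine ⟨hTU.subset hlr.mem_left, hTU.subset hlr.mem_right, hlr.left_le, hlr.le_right,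
        a, ha, fun P hP => ?_⟩
      obtain ⟨Q, hQ, hx, hy⟩ := hcover P hP
      refine le_trans ?_ (hmax Q hQ)
      simp only [Pt.ht, hx]
      linarith
    · omega
  | τ :: T, hTU =>
    obtain ⟨a, ha, ts, hts, hs⟩ := steps_select (key := Chord.slope) (rest := Chord.rest) (τ :: T)
      ((τ :: T).length / 2) (by simp only [List.length_cons]; positivity)
      (half_le_self (by positivity))
    have hcost := selectCost_le (τ :: T).length
    obtain ⟨th, hth, hh⟩ := eval_half (key := Chord.slope) (rest := Chord.rest) (k := 2)
      (l := τ :: T) (ρ := [itemVal Chord.slope Chord.rest τ, chordsVal T, chordsVal (τ :: T),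
        ptsVal U, .pair (chordsVal (τ :: T)) (ptsVal U), .real μ, ptsVal L,
        .pair (.real μ) (ptsVal L)]) rfl
    obtain ⟨A, hA, tA, htA, hA'⟩ := steps_best_filter (f := 8) rfl a μ L (fun P => P.x ≤ μ)
      (steps_filterLe μ L) hl (i := .var 0) (j := .var 6) (k := .var 7) (ρ := [.real a,
        itemVal Chord.slope Chord.rest τ, chordsVal T, chordsVal (τ :: T), ptsVal U,
        .pair (chordsVal (τ :: T)) (ptsVal U), .real μ, ptsVal L, .pair (.real μ) (ptsVal L)])
      (.var rfl) (.var rfl) (.var rfl)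
    obtain ⟨B, hB, tB, htB, hB'⟩ := steps_best_filter (f := 9) rfl a μ L (fun P => μ < P.x)
      (steps_filterGt μ L) hr (i := .var 1) (j := .var 7) (k := .var 8) (ρ := [ptVal A, .real a,
        itemVal Chord.slope Chord.rest τ, chordsVal T, chordsVal (τ :: T), ptsVal U,
        .pair (chordsVal (τ :: T)) (ptsVal U), .real μ, ptsVal L, .pair (.real μ) (ptsVal L)])
      (.var rfl) (.var rfl) (.var rfl)
    obtain ⟨t₁, ht₁, h₁⟩ := steps_ht a A
    obtain ⟨t₂, ht₂, h₂⟩ := steps_ht a B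
    have hpre {w : Val} {t : ℕ} (h : Eval prog [.real (B.ht a), .real (A.ht a), ptVal B, ptVal A,
        .real a, itemVal Chord.slope Chord.rest τ, chordsVal T, chordsVal (τ :: T), ptsVal U,
        .pair (chordsVal (τ :: T)) (ptsVal U), .real μ, ptsVal L, .pair (.real μ) (ptsVal L)]
        (.ifLe (.var 1) (.var 0)
          (.ifLe (.var 0) (.var 1) (.pair (.var 3) (.var 2))
            (.call 13 (.pair (.var 10) (.call 16 (.pair (.var 4) (.pair (.var 7) (.var 8)))))))
          (.call 13 (.pair (.var 10) (.call 15 (.pair (.var 4) (.pair (.var 7) (.var 8))))))) w t) :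
        Steps .bridge (.pair (.real μ) (ptsVal L)) w (500 * L.length + 12100 * (τ :: T).length +
          100 + t) :=
      ⟨_, by omega, .casePair (.var rfl) (.letIn (.call (.var rfl) rfl hp)
        (.casePair (.var rfl) (.casePair (.var rfl)
        (.letIn (.call (.pair hh (.var rfl)) rfl hs) (.letIn hA' (.letIn hB'
        (.letIn (.call (.pair (.var rfl) (.var rfl)) rfl h₁)
        (.letIn (.call (.pair (.var rfl) (.var rfl)) rfl h₂) h))))))))⟩
    have hhalf := ha.length_le_two_mul
    have hT : 0 < (τ :: T).length := by simp
    by_cases hAB : A.ht a ≤ B.ht a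
    · by_cases hBA : B.ht a ≤ A.ht a
      · obtain ⟨t, ht, h⟩ := hpre (.ifTrue (.var rfl) (.var rfl) hAB
          (.ifTrue (.var rfl) (.var rfl) hBA (.pair (.var rfl) (.var rfl))))
        exact ⟨A, B, isBridge_of_ht_eq hA hB (le_antisymm hAB hBA), hB.prop, t, by omega, h⟩
      · rw [not_le] at hBA
        obtain ⟨L', hL', hlen, td, htd, hd⟩ := steps_dropRight a (τ :: T) U
        have hsub : L' ⊆ L := by
          intro P hP
          rcases (hL' P).1 hP with hP | ⟨τ', hτ', rfl | ⟨rfl, -⟩⟩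
          · exact hTU.subset hP
          · exact hTU.mem_left _ hτ'
          · exact hTU.mem_right _ hτ'
        have hdom (P) (hP : P ∈ L) : ∃ Q ∈ L', Q.x ≤ P.x ∧ P.ht a ≤ Q.ht a := by
          rcases hTU.cover P hP with ⟨τ', hτ', rfl | rfl⟩ | ⟨Q, hQ, hx, hy⟩
          · exact ⟨_, (hL' _).2 (.inr ⟨τ', hτ', .inl rfl⟩), le_rfl, le_rfl⟩
          · rcases le_or_gt τ'.slope a with hs | hs
            · exact ⟨τ'.left, (hL' _).2 (.inr ⟨τ', hτ', .inl rfl⟩), (hTU.proper _ hτ').lt.le,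
                (hTU.proper _ hτ').ht_le_of_ge hs⟩
            · exact ⟨_, (hL' _).2 (.inr ⟨τ', hτ', .inr ⟨rfl, hs⟩⟩), le_rfl, le_rfl⟩
          · refine ⟨Q, (hL' _).2 (.inl hQ), hx.le, ?_⟩
            simp only [Pt.ht, hx]
            linarith
        -- Domination goes to the left and could leave the right side; the height of `B` prevents
        -- this, so the recursive call still has points on both sides.
        obtain ⟨R, hR, hRx, -⟩ := exists_right_of_dominates hA hBA hsub
          ((hdom B hB.mem).imp fun Q hQ => ⟨hQ.1, hQ.2.2⟩)
        have hl' : ∃ P ∈ L', P.x ≤ μ :=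
          (hdom A hA.mem).imp fun Q hQ => ⟨hQ.1, hQ.2.1.trans hA.prop⟩
        obtain ⟨l, r, hlr, hrx, t, ht, h⟩ := ih L'.length (by omega) L' hl' ⟨R, hR, hRx⟩ rfl
        obtain ⟨t', ht', h'⟩ := hpre (.ifTrue (.var rfl) (.var rfl) hAB
          (.ifFalse (.var rfl) (.var rfl) (not_le.2 hBA) (.call (.pair (.var rfl)
            (.call (.pair (.var rfl) (.pair (.var rfl) (.var rfl))) rfl hd)) rfl h)))
        exact ⟨l, r, .of_dominates_left hA hB hBA hsub hdom hlr, hrx, t', by omega, h'⟩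
    · have hBA := not_le.1 hAB
      obtain ⟨L', hL', hlen, td, htd, hd⟩ := steps_dropLeft a (τ :: T) U
      have hsub : L' ⊆ L := by
        intro P hP
        rcases (hL' P).1 hP with hP | ⟨τ', hτ', rfl | ⟨rfl, -⟩⟩
        · exact hTU.subset hP
        · exact hTU.mem_right _ hτ'
        · exact hTU.mem_left _ hτ'
      have hdom (P) (hP : P ∈ L) : ∃ Q ∈ L', P.x ≤ Q.x ∧ P.ht a ≤ Q.ht a := by
        rcases hTU.cover P hP with ⟨τ', hτ', rfl | rfl⟩ | ⟨Q, hQ, hx, hy⟩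
        · rcases le_or_gt a τ'.slope with hs | hs
          · exact ⟨τ'.right, (hL' _).2 (.inr ⟨τ', hτ', .inl rfl⟩), (hTU.proper _ hτ').lt.le,
              (hTU.proper _ hτ').ht_le_of_le hs⟩
          · exact ⟨_, (hL' _).2 (.inr ⟨τ', hτ', .inr ⟨rfl, hs⟩⟩), le_rfl, le_rfl⟩
        · exact ⟨_, (hL' _).2 (.inr ⟨τ', hτ', .inl rfl⟩), le_rfl, le_rfl⟩
        · refine ⟨Q, (hL' _).2 (.inl hQ), hx.ge, ?_⟩
          simp only [Pt.ht, hx]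
          linarith
      obtain ⟨R, hR, hRx, -⟩ := exists_left_of_dominates hB hBA hsub
        ((hdom A hA.mem).imp fun Q hQ => ⟨hQ.1, hQ.2.2⟩)
      have hr' : ∃ P ∈ L', μ < P.x :=
        (hdom B hB.mem).imp fun Q hQ => ⟨hQ.1, hB.prop.trans_le hQ.2.1⟩
      obtain ⟨l, r, hlr, hrx, t, ht, h⟩ := ih L'.length (by omega) L' ⟨R, hR, hRx⟩ hr' rfl
      obtain ⟨t', ht', h'⟩ := hpre (.ifFalse (.var rfl) (.var rfl) hAB (.call (.pair (.var rfl)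
        (.call (.pair (.var rfl) (.pair (.var rfl) (.var rfl))) rfl hd)) rfl h))
      exact ⟨l, r, .of_dominates_right hA hB hBA hsub hdom hlr hrx, hrx, t', by omega, h'⟩

theorem steps_interpolate {μ : ℝ} {l r : Pt} (h : l.x < r.x) :
    Steps .interpolate (.pair (.real μ) (.pair (ptVal l) (ptVal r)))
      (ptVal (GameTree.interpolate μ l r)) 40 :=
  ⟨_, by norm_num, .casePair (.var rfl) (.casePair (.var rfl) (.casePair (.var rfl)
    (.casePair (.var rfl) (.casePair (.var rfl) (.casePair (.var rfl) (.pair (.var rfl)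
    (.pair (.add (.var rfl) (.mul (.sub (.var rfl) (.var rfl))
      (.div (.sub (.var rfl) (.var rfl)) (.sub (.var rfl) (.var rfl)) (sub_pos.2 h).ne')))
    .zero)))))))⟩

/-- A bridge is needed only if there are points on both sides; the other two cases are a plain
filter and the identity. -/
theorem steps_clip (μ : ℝ) (K : List Pt) : ∃ K', IsClip μ K K' ∧
    Steps .clip (.pair (.real μ) (ptsVal K)) (ptsVal K') (120100 * K.length + 150) := by
  obtain ⟨t₁, ht₁, h₁⟩ := steps_filterGt (key := Pt.x)
    (rest := fun P => .pair (.real P.y) (.real P.tag)) μ K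
  obtain ⟨t₂, ht₂, h₂⟩ := steps_filterLe (key := Pt.x)
    (rest := fun P => .pair (.real P.y) (.real P.tag)) μ K
  obtain ⟨t₃, ht₃, h₃⟩ := steps_filterGe (key := Pt.x)
    (rest := fun P => .pair (.real P.y) (.real P.tag)) μ K
  by_cases hr : ∃ P ∈ K, μ < P.x
  · obtain ⟨A, as, hhi⟩ := List.exists_cons_of_ne_nil (l := K.filter fun P => μ < P.x) (by
      obtain ⟨P, hP, h⟩ := hr
      exact List.ne_nil_of_mem (List.mem_filter.2 ⟨hP, decide_eq_true h⟩))
    by_cases hl : ∃ P ∈ K, P.x ≤ μ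
    · obtain ⟨B, bs, hlo⟩ := List.exists_cons_of_ne_nil (l := K.filter fun P => P.x ≤ μ) (by
        obtain ⟨P, hP, h⟩ := hl
        exact List.ne_nil_of_mem (List.mem_filter.2 ⟨hP, decide_eq_true h⟩))
      obtain ⟨l, r, hb, hrx, t, ht, h⟩ := steps_bridge μ K hl hr
      have hlr := hb.left_le.trans_lt hrx
      obtain ⟨t', ht', h'⟩ := steps_interpolate (μ := μ) hlr
      refine ⟨_, isClip_of_isBridge hb hrx, ?_⟩
      rw [hhi] at h₁ ⊢
      rw [hlo] at h₂
      exact ⟨_, by omega, .casePair (.var rfl) (.letIn (.call (.pair (.var rfl) (.var rfl)) rfl h₁)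
        (.casePair (.var rfl) (.letIn (.call (.pair (.var rfl) (.var rfl)) rfl h₂)
        (.casePair (.var rfl) (.letIn (.call (.pair (.var rfl) (.var rfl)) rfl h)
        (.pair (.call (.pair (.var rfl) (.var rfl)) rfl h') (.var rfl)))))))⟩
    · push Not at hl
      have hhi' : K.filter (fun P => μ < P.x) = K :=
        List.filter_eq_self.2 fun P hP => decide_eq_true (hl P hP)
      have hlo : K.filter (fun P => P.x ≤ μ) = [] :=
        List.filter_eq_nil_iff.2 fun P hP h => not_lt.2 (of_decide_eq_true h) (hl P hP)
      rw [hhi'] at hhi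
      rw [hhi'] at h₁
      rw [hlo] at h₂
      refine ⟨K, isClip_of_forall_lt hl, ?_⟩
      subst hhi
      exact ⟨_, by omega, .casePair (.var rfl) (.letIn (.call (.pair (.var rfl) (.var rfl)) rfl h₁)
        (.casePair (.var rfl) (.letIn (.call (.pair (.var rfl) (.var rfl)) rfl h₂)
        (.caseNil (.var rfl) (.var rfl)))))⟩
  · push Not at hr
    have hhi : K.filter (fun P => μ < P.x) = [] :=
      List.filter_eq_nil_iff.2 fun P hP h => not_le.2 (of_decide_eq_true h) (hr P hP)
    rw [hhi] at h₁
    exact ⟨_, isClip_of_forall_le hr, _, by omega,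
      .casePair (.var rfl) (.letIn (.call (.pair (.var rfl) (.var rfl)) rfl h₁)
        (.caseNil (.var rfl) (.call (.pair (.var rfl) (.var rfl)) rfl h₃)))⟩

end RealMachine

/-! ### Nonempty frontiers and weights on a bridge -/

namespace GameTree

/-- The cut never removes everything: a child that attains the value of the node has a pair to the
right of that value. -/
theorem IsFrontier.exists_below {G : GameTree} {L : List Pt} (h : IsFrontier G L) :
    ∃ x y, value G ≤ x ∧ Below L 1 x y := by
  induction h with
  | leaf u v => exact ⟨v, u, le_rfl, .of_mem (P := ⟨v, u, 0⟩) List.mem_cons_self⟩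
  | @node p n c Ls L _ h ih =>
    obtain ⟨x, y, hx, hB⟩ := ih (optAction p c)
    rw [value_optAction] at hx
    exact ⟨x, y, hx, h.complete _ 1 x y zero_le_one (by rwa [mul_one]) hB⟩

theorem IsFrontier.ne_nil {G : GameTree} {L : List Pt} (h : IsFrontier G L) : L ≠ [] := by
  obtain ⟨x, y, -, hB⟩ := h.exists_below
  obtain ⟨P, hP, -⟩ := hB.exists_x_le
  exact List.ne_nil_of_mem hP

theorem Below.mono {L L' : List Pt} {w x y : ℝ} (h : Below L w x y)
    (hL : ∀ P ∈ L, ∃ Q ∈ L', Q.x = P.x ∧ Q.y = P.y) : Below L' w x y := by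
  intro α β k hα hk
  refine h α β k hα fun P hP => ?_
  obtain ⟨Q, hQ, hx, hy⟩ := hL P hP
  rw [← hx, ← hy]
  exact hk Q hQ

theorem IsBridge.exists_weight {μ : ℝ} {L : List Pt} {l r : Pt} (h : IsBridge μ L l r) :
    ∃ w, 0 ≤ w ∧ w ≤ 1 ∧ w * l.x + (1 - w) * r.x = μ := by
  rcases (h.left_le.trans h.le_right).eq_or_lt with he | hlt
  · exact ⟨1, zero_le_one, le_rfl, by linarith [h.left_le, h.le_right]⟩
  · have hd := sub_pos.2 hlt
    refine ⟨(r.x - μ) / (r.x - l.x), div_nonneg (sub_nonneg.2 h.le_right) hd.le, ?_, ?_⟩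
    · rw [div_le_one hd]
      linarith [h.left_le]
    · field_simp
      ring

/-- The probability of the action `i` at the root and the utility of the follower behind it, in a
strategy profile that uses the bridge between `l` and `r` at `t`.  If the action is not used, the
utility is `d`. -/
noncomputable def assign (t : ℝ) (l r : Pt) (i d : ℝ) : ℝ × ℝ :=
  if l.tag = i then
    if r.tag = i then (1, t) else ((r.x - t) / (r.x - l.x), l.x)
  else if r.tag = i then ((t - l.x) / (r.x - l.x), r.x) else (0, d)

end GameTree

namespace RealMachine

open GameTree

/-! ## Annotated games -/

/-- `v` is the game `G`, annotated with minmax values and frontiers.  The frontier at the root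
is `L`. -/
inductive IsAnnotation : GameTree → List Pt → Val → Prop
  | leaf (u v : ℝ) : IsAnnotation (.leaf u v) [⟨v, u, 0⟩]
      (.pair (.real v) (.pair (ptsVal [⟨v, u, 0⟩]) .nil))
  | node {p : Player} {n : ℕ} {c : Fin (n + 1) → GameTree} {Ls : Fin (n + 1) → List Pt}
      {vs : Fin (n + 1) → Val} {L : List Pt} (hs : ∀ i, IsAnnotation (c i) (Ls i) (vs i))
      (h : IsNodeFrontier (value (.node p n c)) Ls L)
      (hlen : L.length ≤ Fintype.card (Terminal (.node p n c))) :
      IsAnnotation (.node p n c) L (.pair (.real (value (.node p n c)))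
        (.pair (ptsVal L) (.ofList (List.ofFn vs))))

theorem IsAnnotation.isFrontier {G : GameTree} {L : List Pt} {v : Val} (h : IsAnnotation G L v) :
    IsFrontier G L := by
  induction h with
  | leaf u v => exact .leaf u v
  | node _ h _ ih => exact .node ih h

theorem IsAnnotation.length_le {G : GameTree} {L : List Pt} {v : Val} (h : IsAnnotation G L v) :
    L.length ≤ Fintype.card G.Terminal := by
  cases h with
  | leaf u v => exact card_terminal_pos (.leaf u v)
  | node _ _ h => exact h

theorem IsAnnotation.exists_eq {G : GameTree} {L : List Pt} {v : Val} (h : IsAnnotation G L v) :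
    ∃ w, v = .pair (.real (value G)) (.pair (ptsVal L) w) := by
  cases h with
  | leaf u v => exact ⟨_, rfl⟩
  | node _ _ _ => exact ⟨_, rfl⟩

theorem steps_annotateAll {n : ℕ} {gs vs : Fin n → Val} {ts : Fin n → ℕ}
    (h : ∀ i, Steps .annotate (gs i) (vs i) (ts i)) :
    Steps .annotateAll (.ofList (List.ofFn gs)) (.ofList (List.ofFn vs))
      (∑ i, ts i + 10 * n + 5) := by
  induction n with
  | zero =>
    rw [List.ofFn_zero, List.ofFn_zero]
    exact ⟨_, by omega, .caseNil (.var rfl) .nil⟩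
  | succ n ih =>
    obtain ⟨t, ht, h'⟩ := ih fun i => h i.succ
    obtain ⟨t', ht', h''⟩ := h 0
    rw [List.ofFn_succ, List.ofFn_succ, Fin.sum_univ_succ]
    exact ⟨_, by omega, .casePair (.var rfl)
      (.pair (.call (.var rfl) rfl h'') (.call (.var rfl) rfl h'))⟩

theorem steps_minValue {n : ℕ} (ms : Fin (n + 1) → ℝ) (ws : Fin (n + 1) → Val) :
    ∃ x, (∀ i, x ≤ ms i) ∧ (∃ i, ms i = x) ∧
      Steps .minValue (.ofList (List.ofFn fun i => .pair (.real (ms i)) (ws i))) (.real x)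
        (20 * (n + 1)) := by
  induction n with
  | zero =>
    refine ⟨ms 0, fun i => by rw [Fin.fin_one_eq_zero i], ⟨0, rfl⟩, ?_⟩
    rw [List.ofFn_succ, List.ofFn_zero]
    exact ⟨_, by norm_num, .casePair (.var rfl) (.casePair (.var rfl)
      (.caseNil (.var rfl) (.var rfl)))⟩
  | succ n ih =>
    obtain ⟨x, hx, ⟨j, hj⟩, t, ht, h⟩ := ih (fun i => ms i.succ) fun i => ws i.succ
    rw [List.ofFn_succ]
    rw [List.ofFn_succ] at h ⊢
    by_cases hc : ms 0 ≤ x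
    · exact ⟨ms 0, Fin.cases le_rfl fun i => hc.trans (hx i), ⟨0, rfl⟩, _, by omega,
        .casePair (.var rfl) (.casePair (.var rfl) (.casePair (.var rfl)
        (.letIn (.call (.var rfl) rfl h) (.ifTrue (.var rfl) (.var rfl) hc (.var rfl)))))⟩
    · exact ⟨x, Fin.cases (not_le.1 hc).le hx, ⟨j.succ, hj⟩, _, by omega,
        .casePair (.var rfl) (.casePair (.var rfl) (.casePair (.var rfl)
        (.letIn (.call (.var rfl) rfl h) (.ifFalse (.var rfl) (.var rfl) hc (.var rfl)))))⟩

theorem steps_maxValue {n : ℕ} (ms : Fin (n + 1) → ℝ) (ws : Fin (n + 1) → Val) :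
    ∃ x, (∀ i, ms i ≤ x) ∧ (∃ i, ms i = x) ∧
      Steps .maxValue (.ofList (List.ofFn fun i => .pair (.real (ms i)) (ws i))) (.real x)
        (20 * (n + 1)) := by
  induction n with
  | zero =>
    refine ⟨ms 0, fun i => by rw [Fin.fin_one_eq_zero i], ⟨0, rfl⟩, ?_⟩
    rw [List.ofFn_succ, List.ofFn_zero]
    exact ⟨_, by norm_num, .casePair (.var rfl) (.casePair (.var rfl)
      (.caseNil (.var rfl) (.var rfl)))⟩
  | succ n ih =>
    obtain ⟨x, hx, ⟨j, hj⟩, t, ht, h⟩ := ih (fun i => ms i.succ) fun i => ws i.succ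
    rw [List.ofFn_succ]
    rw [List.ofFn_succ] at h ⊢
    by_cases hc : ms 0 ≤ x
    · exact ⟨x, Fin.cases hc hx, ⟨j.succ, hj⟩, _, by omega,
        .casePair (.var rfl) (.casePair (.var rfl) (.casePair (.var rfl)
        (.letIn (.call (.var rfl) rfl h) (.ifTrue (.var rfl) (.var rfl) hc (.var rfl)))))⟩
    · exact ⟨ms 0, Fin.cases le_rfl fun i => (hx i).trans (not_le.1 hc).le, ⟨0, rfl⟩, _, by omega,
        .casePair (.var rfl) (.casePair (.var rfl) (.casePair (.var rfl)
        (.letIn (.call (.var rfl) rfl h) (.ifFalse (.var rfl) (.var rfl) hc (.var rfl)))))⟩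

/-- Tags of the child level are overwritten, so the tag 0 given to leaves and interpolated points is
only a placeholder. -/
theorem steps_retag (i : ℝ) (L L' : List Pt) :
    Steps .retag (.pair (.real i) (.pair (ptsVal L) (ptsVal L')))
      (ptsVal (L.map (fun P => ⟨P.x, P.y, i⟩) ++ L')) (40 * L.length + 10) := by
  induction L with
  | nil =>
    exact ⟨_, by simp, .casePair (.var rfl) (.casePair (.var rfl) (.caseNil (.var rfl) (.var rfl)))⟩
  | cons P L ih =>
    obtain ⟨t, ht, h⟩ := ih
    exact ⟨_, by simp only [List.length_cons]; omega, .casePair (.var rfl) (.casePair (.var rfl)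
      (.casePair (.var rfl) (.casePair (.var rfl) (.casePair (.var rfl)
      (.pair (.pair (.var rfl) (.pair (.var rfl) (.var rfl)))
      (.call (.pair (.var rfl) (.pair (.var rfl) (.var rfl))) rfl h))))))⟩

/-- The first two properties are those of `IsNodeFrontier` with tags shifted by `i₀`, as the
recursion over the children requires. The hull of the union is never computed; the lists are just
concatenated. -/
theorem steps_clipAll (m : ℝ) {n : ℕ} (ms : Fin n → ℝ) (Ls : Fin n → List Pt) (ws : Fin n → Val)
    (i₀ : ℝ) : ∃ L : List Pt,
    (∀ P ∈ L, ∃ i : Fin n, P.tag = i₀ + (i : ℕ) ∧ m ≤ P.x ∧ Below (Ls i) 1 P.x P.y) ∧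
    (∀ i w x y, 0 ≤ w → m * w ≤ x → Below (Ls i) w x y → Below L w x y) ∧
    L.length ≤ ∑ i, (Ls i).length ∧
    Steps .clipAll (.pair (.real m) (.pair (.real i₀) (.ofList (List.ofFn fun i =>
      .pair (.real (ms i)) (.pair (ptsVal (Ls i)) (ws i)))))) (ptsVal L)
      (120200 * ∑ i, (Ls i).length + 300 * n + 10) := by
  induction n generalizing i₀ with
  | zero =>
    refine ⟨[], by simp, fun i => i.elim0, by simp, ?_⟩
    rw [List.ofFn_zero]
    exact ⟨_, by omega, .casePair (.var rfl) (.casePair (.var rfl) (.caseNil (.var rfl) .nil))⟩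
  | succ n ih =>
    obtain ⟨L, hs, hc, hlen, t, ht, h⟩ := ih (fun i => ms i.succ) (fun i => Ls i.succ)
      (fun i => ws i.succ) (i₀ + 1)
    obtain ⟨K, hK, t₁, ht₁, h₁⟩ := steps_clip m (Ls 0)
    obtain ⟨t₂, ht₂, h₂⟩ := steps_retag i₀ K L
    have hKlen := hK.length_le
    rw [List.ofFn_succ, Fin.sum_univ_succ]
    refine ⟨K.map (fun P => ⟨P.x, P.y, i₀⟩) ++ L, ?_, ?_, ?_, _, ?_, .casePair (.var rfl)
      (.casePair (.var rfl) (.casePair (.var rfl) (.casePair (.var rfl) (.casePair (.var rfl)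
      (.call (.pair (.var rfl) (.pair (.call (.pair (.var rfl) (.var rfl)) rfl h₁)
      (.call (.pair (.var rfl) (.pair (.add (.var rfl) .one) (.var rfl))) rfl h))) rfl h₂)))))⟩
    · intro P hP
      rcases List.mem_append.1 hP with hP | hP
      · obtain ⟨Q, hQ, rfl⟩ := List.mem_map.1 hP
        exact ⟨0, by simp, hK.sound Q hQ⟩
      · obtain ⟨i, hi, h'⟩ := hs P hP
        refine ⟨i.succ, ?_, h'⟩
        rw [hi, Fin.val_succ]
        push_cast
        ring
    · intro i w x y hw hx hB
      refine Fin.cases (fun hB => ?_) (fun i hB => ?_) i hB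
      · exact (hK.complete w x y hw hx hB).mono fun P hP =>
          ⟨_, List.mem_append_left _ (List.mem_map.2 ⟨P, hP, rfl⟩), rfl, rfl⟩
      · exact (hc i w x y hw hx hB).mono fun P hP => ⟨P, List.mem_append_right _ hP, rfl, rfl⟩
    · rw [List.length_append, List.length_map]
      omega
    · omega

/-- The complexity recurrence: a node is one further state, which pays `k` per terminal state below
it, and the terminal states of a child are among those of the node. The constant `b` accounts for
leaves, which have no states. -/
theorem sum_card_mul_card_le {p : Player} {n : ℕ} (c : Fin (n + 1) → GameTree) (k b : ℕ) :
    ∑ i, (k * (Fintype.card (c i).State * Fintype.card (c i).Terminal) + b) +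
        k * Fintype.card (Terminal (.node p n c)) ≤
      k * (Fintype.card (State (.node p n c)) * Fintype.card (Terminal (.node p n c))) +
        b * (n + 1) := by
  have h : ∑ i, Fintype.card (c i).State * Fintype.card (c i).Terminal ≤
      (∑ i, Fintype.card (c i).State) * Fintype.card (Terminal (.node p n c)) := by
    rw [Finset.sum_mul]
    refine Finset.sum_le_sum fun i _ => Nat.mul_le_mul_left _ ?_
    rw [card_terminal]
    exact Finset.single_le_sum (f := fun i => Fintype.card (c i).Terminal)
      (fun _ _ => Nat.zero_le _) (Finset.mem_univ i)
  rw [Finset.sum_add_distrib, ← Finset.mul_sum, card_state, Finset.sum_const, Finset.card_univ,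
    Fintype.card_fin, smul_eq_mul]
  have := Nat.mul_le_mul_left k h
  linarith

theorem succ_le_card_terminal {p : Player} {n : ℕ} (c : Fin (n + 1) → GameTree) :
    n + 1 ≤ Fintype.card (Terminal (.node p n c)) := by
  rw [card_terminal]
  calc n + 1 = ∑ _i : Fin (n + 1), 1 := by simp
    _ ≤ _ := Finset.sum_le_sum fun i _ => card_terminal_pos (c i)

theorem steps_annotate (G : GameTree) : ∃ L v, IsAnnotation G L v ∧
    Steps .annotate (gameVal G) v
      (125000 * (Fintype.card G.State * Fintype.card G.Terminal) + 30) := by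
  induction G with
  | leaf u v =>
    exact ⟨_, _, .leaf u v, _, by omega, .casePair (.var rfl) (.caseNil (.var rfl)
      (.casePair (.var rfl) (.pair (.var rfl) (.pair (.pair (.pair (.var rfl)
      (.pair (.var rfl) .zero)) .nil) .nil))))⟩
  | node p n c ih =>
    choose Ls vs hs hsteps using ih
    choose ws hws using fun i => (hs i).exists_eq
    obtain ⟨t₁, ht₁, h₁⟩ := steps_annotateAll hsteps
    have hvs : vs = fun i => .pair (.real (value (c i))) (.pair (ptsVal (Ls i)) (ws i)) :=
      funext hws
    have hvalue : ∃ t ≤ 20 * (n + 1) + 10, ∃ a b, playerVal p = .pair a b ∧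
        Eval prog [.ofList (List.ofFn vs), a, b, playerVal p,
            .ofList (List.ofFn fun i => gameVal (c i)), gameVal (.node p n c)]
          (.casePair (.var 1) (.call 3 (.var 0)) (.call 4 (.var 2)))
          (.real (value (.node p n c))) t := by
      cases p
      · obtain ⟨x, hx, ⟨i, hi⟩, t, ht, h⟩ := steps_minValue (fun i => value (c i))
          fun i => .pair (ptsVal (Ls i)) (ws i)
        have : value (.node .leader n c) = x :=
          le_antisymm (hi ▸ value_leader_le c i) (Finset.le_inf' _ _ fun i _ => hx i)
        rw [← hvs, ← this] at h
        exact ⟨_, by omega, _, _, rfl, .caseNil (.var rfl) (.call (.var rfl) rfl h)⟩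
      · obtain ⟨x, hx, ⟨i, hi⟩, t, ht, h⟩ := steps_maxValue (fun i => value (c i))
          fun i => .pair (ptsVal (Ls i)) (ws i)
        have : value (.node .follower n c) = x :=
          le_antisymm (Finset.sup'_le _ _ fun i _ => hx i) (hi ▸ le_value_follower c i)
        rw [← hvs, ← this] at h
        exact ⟨_, by omega, _, _, rfl, .casePair (.var rfl) (.call (.var rfl) rfl h)⟩
    obtain ⟨t₂, ht₂, a, b, hab, h₂⟩ := hvalue
    obtain ⟨L, hsound, hcomplete, hlen, t₃, ht₃, h₃⟩ := steps_clipAll (value (.node p n c))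
      (fun i => value (c i)) Ls ws 0
    rw [← hvs] at h₃
    have hsum : ∑ i, (Ls i).length ≤ Fintype.card (Terminal (.node p n c)) := by
      rw [card_terminal]
      exact Finset.sum_le_sum fun i _ => (hs i).length_le
    refine ⟨L, _, .node hs ⟨fun P hP => ?_, hcomplete⟩ (hlen.trans hsum), _, ?_,
      .casePair (.var rfl) (.casePair (.var (congrArg some hab)) (.letIn (.call (.var rfl) rfl h₁)
      (.letIn h₂ (.pair (.var rfl)
      (.pair (.call (.pair (.var rfl) (.pair .zero (.var rfl))) rfl h₃) (.var rfl))))))⟩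
    · obtain ⟨i, hi, h⟩ := hsound P hP
      exact ⟨i, by rw [hi, zero_add], h⟩
    · have h₄ := sum_card_mul_card_le (p := p) c 125000 30
      have h₅ := succ_le_card_terminal (p := p) c
      omega

/-! ## Realization of a point -/

theorem eval_ifEq {ρ : List Val} {a b e₁ e₂ : Expr} {x y : ℝ} {w : Val} {T : ℕ}
    (ha : Eval prog ρ a (.real x) 1) (hb : Eval prog ρ b (.real y) 1)
    (h₁ : x = y → ∃ t ≤ T, Eval prog ρ e₁ w t) (h₂ : x ≠ y → ∃ t ≤ T, Eval prog ρ e₂ w t) :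
    ∃ t ≤ T + 6, Eval prog ρ (.ifEq a b e₁ e₂) w t := by
  by_cases hxy : x ≤ y
  · by_cases hyx : y ≤ x
    · obtain ⟨t, ht, h⟩ := h₁ (le_antisymm hxy hyx)
      exact ⟨_, by omega, .ifTrue ha hb hxy (.ifTrue hb ha hyx h)⟩
    · obtain ⟨t, ht, h⟩ := h₂ fun h => hyx h.ge
      exact ⟨_, by omega, .ifTrue ha hb hxy (.ifFalse hb ha hyx h)⟩
  · obtain ⟨t, ht, h⟩ := h₂ fun h => hxy h.le
    exact ⟨_, by omega, .ifFalse ha hb hxy h⟩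

/-- The hypothesis rules out division by zero, since the program divides only when the two tags
differ. The head `P` of the child's frontier supplies the target of an unused child. -/
theorem steps_assign {t : ℝ} {l r : Pt} (h : l.tag = r.tag ∨ l.x < r.x) (i m : ℝ) (P : Pt)
    (L : List Pt) (w : Val) :
    Steps .assign (.pair (.real i) (.pair (.pair (.real t) (.pair (ptVal l) (ptVal r)))
        (.pair (.real m) (.pair (ptsVal (P :: L)) w))))
      (.pair (.real (GameTree.assign t l r i P.x).1) (.real (GameTree.assign t l r i P.x).2)) 80 := by
  have hbody : ∃ t' ≤ 32, Eval prog [.real r.y, .real r.tag, .real r.x,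
      .pair (.real r.y) (.real r.tag), .real l.y, .real l.tag, .real l.x,
      .pair (.real l.y) (.real l.tag), ptVal l, ptVal r, .real t, .pair (ptVal l) (ptVal r),
      .pair (.real t) (.pair (ptVal l) (ptVal r)),
      .pair (.real m) (.pair (ptsVal (P :: L)) w), .real i,
      .pair (.pair (.real t) (.pair (ptVal l) (ptVal r)))
        (.pair (.real m) (.pair (ptsVal (P :: L)) w)),
      .pair (.real i) (.pair (.pair (.real t) (.pair (ptVal l) (ptVal r)))
        (.pair (.real m) (.pair (ptsVal (P :: L)) w)))]
      (.ifEq (.var 5) (.var 14)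
        (.ifEq (.var 1) (.var 14) (.pair .one (.var 10))
          (.pair (.div (.sub (.var 2) (.var 10)) (.sub (.var 2) (.var 6))) (.var 6)))
        (.ifEq (.var 1) (.var 14)
          (.pair (.div (.sub (.var 10) (.var 6)) (.sub (.var 2) (.var 6))) (.var 2))
          (.casePair (.var 13) .nil <| .casePair (.var 1) .nil <| .casePair (.var 0) .nil <|
            .casePair (.var 0) .nil <| .pair .zero (.var 0))))
      (.pair (.real (GameTree.assign t l r i P.x).1)
        (.real (GameTree.assign t l r i P.x).2)) t' := by
    refine eval_ifEq (T := 26) (.var rfl) (.var rfl) (fun hl => ?_) fun hl => ?_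
    · refine eval_ifEq (T := 20) (.var rfl) (.var rfl) (fun hr => ?_) fun hr => ?_
      · rw [GameTree.assign, if_pos hl, if_pos hr]
        exact ⟨_, by norm_num, .pair .one (.var rfl)⟩
      · have hd : r.x - l.x ≠ 0 :=
          (sub_pos.2 (h.resolve_left fun he => hr (he.symm.trans hl))).ne'
        rw [GameTree.assign, if_pos hl, if_neg hr]
        exact ⟨_, by norm_num, .pair (.div (.sub (.var rfl) (.var rfl))
          (.sub (.var rfl) (.var rfl)) hd) (.var rfl)⟩
    · refine eval_ifEq (T := 20) (.var rfl) (.var rfl) (fun hr => ?_) fun hr => ?_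
      · have hd : r.x - l.x ≠ 0 :=
          (sub_pos.2 (h.resolve_left fun he => hl (he.trans hr))).ne'
        rw [GameTree.assign, if_neg hl, if_pos hr]
        exact ⟨_, by norm_num, .pair (.div (.sub (.var rfl) (.var rfl))
          (.sub (.var rfl) (.var rfl)) hd) (.var rfl)⟩
      · rw [GameTree.assign, if_neg hl, if_neg hr]
        exact ⟨_, by norm_num, .casePair (.var rfl) (.casePair (.var rfl) (.casePair (.var rfl)
          (.casePair (.var rfl) (.pair .zero (.var rfl)))))⟩
  obtain ⟨t', ht', h'⟩ := hbody
  exact ⟨_, by omega, .casePair (.var rfl) (.casePair (.var rfl) (.casePair (.var rfl)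
    (.casePair (.var rfl) (.casePair (.var rfl) (.casePair (.var rfl) (.casePair (.var rfl)
    (.casePair (.var rfl) h')))))))⟩

theorem steps_realizeAll {n : ℕ} {vs outs : Fin n → Val} {pr tg : Fin n → ℝ} {ts : Fin n → ℕ}
    {info : Val} {i₀ : ℝ}
    (ha : ∀ i : Fin n, Steps .assign (.pair (.real (i₀ + (i : ℕ))) (.pair info (vs i)))
      (.pair (.real (pr i)) (.real (tg i))) 80)
    (h : ∀ i, Steps .realize (.pair (vs i) (.real (tg i))) (outs i) (ts i)) :
    Steps .realizeAll (.pair (.ofList (List.ofFn vs)) (.pair (.real i₀) info))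
      (.ofList (List.ofFn fun i => .pair (.real (pr i)) (outs i))) (∑ i, ts i + 120 * n + 10) := by
  induction n generalizing i₀ with
  | zero =>
    rw [List.ofFn_zero, List.ofFn_zero]
    exact ⟨_, by omega, .casePair (.var rfl) (.caseNil (.var rfl) .nil)⟩
  | succ n ih =>
    obtain ⟨t, ht, h'⟩ := ih (i₀ := i₀ + 1) (fun i => by
      have := ha i.succ
      rwa [Fin.val_succ, Nat.cast_succ, add_comm (i : ℝ), ← add_assoc] at this)
      fun i => h i.succ
    obtain ⟨t₁, ht₁, h₁⟩ := ha 0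
    obtain ⟨t₂, ht₂, h₂⟩ := h 0
    rw [Fin.val_zero, Nat.cast_zero, add_zero] at h₁
    rw [List.ofFn_succ, List.ofFn_succ, Fin.sum_univ_succ]
    exact ⟨_, by omega, .casePair (.var rfl) (.casePair (.var rfl) (.casePair (.var rfl)
      (.letIn (.call (.pair (.var rfl) (.pair (.var rfl) (.var rfl))) rfl h₁)
      (.casePair (.var rfl) (.pair (.pair (.var rfl) (.call (.pair (.var rfl) (.var rfl)) rfl h₂))
      (.call (.pair (.var rfl) (.pair (.add (.var rfl) .one) (.var rfl))) rfl h'))))))⟩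

end RealMachine

/-! ### Optimal realization of points on the upper boundary -/

namespace GameTree

/-- A strategy profile that is optimal for the leader among those that give the follower the
utility `t`. -/
structure IsRealization {G : GameTree} (L : List Pt) (t : ℝ) (σ : Weights G) : Prop where
  isBehavioral : IsBehavioral σ
  obedient : Obedient σ
  card_le : ∀ s, (Finset.univ.filter fun a => σ s a ≠ 0).card ≤ 2
  expU₂_eq : expU₂ σ = t
  exists_slope : ∃ a, ∀ P ∈ L, P.ht a ≤ expU₁ σ - a * t

/-- The supporting line in `exists_slope` is a dual certificate of optimality at the abscissa `t`.
-/
theorem IsRealization.le_expU₁ {G : GameTree} {L : List Pt} {t y : ℝ} {σ : Weights G}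
    (h : IsRealization L t σ) (hB : Below L 1 t y) : y ≤ expU₁ σ := by
  obtain ⟨a, ha⟩ := h.exists_slope
  have := hB 1 (-a) (expU₁ σ - a * t) zero_le_one fun P hP => by
    have := ha P hP
    rw [Pt.ht] at this
    linarith
  linarith

/-- The number `t` lies in the range of the abscissas of `L`. -/
def InRange (L : List Pt) (t : ℝ) : Prop := (∃ P ∈ L, P.x ≤ t) ∧ ∃ P ∈ L, t ≤ P.x

theorem Below.inRange {L : List Pt} {x y : ℝ} (h : Below L 1 x y) : InRange L x :=
  ⟨h.exists_x_le, h.exists_le_x⟩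

section Assign

variable {n : ℕ} {v t : ℝ} {Ls : Fin (n + 1) → List Pt} {L : List Pt} {l r : Pt}

theorem cast_fin_inj {i j : Fin (n + 1)} : ((i : ℕ) : ℝ) = (j : ℕ) ↔ i = j := by
  rw [Nat.cast_inj, Fin.val_inj]

/-- Targets passed down stay feasible: an endpoint lies below its child's frontier, and if both
endpoints belong to one child, `t` lies between them. -/
theorem assign_inRange (h : IsNodeFrontier v Ls L) (hb : IsBridge t L l r) (i : Fin (n + 1))
    {P : Pt} (hP : P ∈ Ls i) : InRange (Ls i) (assign t l r (i : ℕ) P.x).2 := by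
  obtain ⟨il, hil, -, hBl⟩ := h.sound l hb.mem_left
  obtain ⟨ir, hir, -, hBr⟩ := h.sound r hb.mem_right
  unfold assign
  simp only [hil, hir, cast_fin_inj]
  split_ifs with h₁ h₂ h₂
  · subst h₁ h₂
    obtain ⟨Q, hQ, hQx⟩ := hBl.exists_x_le
    obtain ⟨R, hR, hRx⟩ := hBr.exists_le_x
    exact ⟨⟨Q, hQ, hQx.trans hb.left_le⟩, R, hR, hb.le_right.trans hRx⟩
  · subst h₁
    exact hBl.inRange
  · subst h₂
    exact hBr.inRange
  · exact ⟨⟨P, hP, le_rfl⟩, P, hP, le_rfl⟩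

/-- Strategy profiles in the subtrees that realize the assigned utilities make up one that
realizes the bridge. -/
theorem IsRealization.glue {p : Player} {c : Fin (n + 1) → GameTree}
    (h : IsNodeFrontier (value (.node p n c)) Ls L) (hb : IsBridge t L l r)
    (hlr : l.tag = r.tag ∨ l.x < r.x) {d : Fin (n + 1) → ℝ} {f : ∀ i, Weights (c i)}
    (hf : ∀ i, IsRealization (Ls i) (assign t l r (i : ℕ) (d i)).2 (f i)) :
    IsRealization L t
      (Weights.glue (p := p) (fun i => (assign t l r (i : ℕ) (d i)).1) f) := by
  obtain ⟨il, hil, hvl, hBl⟩ := h.sound l hb.mem_left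
  obtain ⟨ir, hir, hvr, hBr⟩ := h.sound r hb.mem_right
  obtain ⟨a, hlra, ha⟩ := hb.exists_slope
  have hval (i : Fin (n + 1)) : assign t l r (i : ℕ) (d i) = if il = i then
      if ir = i then (1, t) else ((r.x - t) / (r.x - l.x), l.x)
      else if ir = i then ((t - l.x) / (r.x - l.x), r.x) else (0, d i) := by
    unfold assign
    simp only [hil, hir, cast_fin_inj]
  rw [hil, hir, cast_fin_inj] at hlr
  simp only [hval] at hf ⊢
  clear hval
  have hcard (w : Fin (n + 1) → ℝ) (hw : ∀ i, il ≠ i → ir ≠ i → w i = 0) (s) :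
      (Finset.univ.filter fun a => Weights.glue (p := p) w f s a ≠ 0).card ≤ 2 := by
    cases s with
    | here =>
      have hsub : (Finset.univ.filter fun i => w i ≠ 0) ⊆ {il, ir} := fun i hi => by
        by_contra hni
        simp only [Finset.mem_insert, Finset.mem_singleton, not_or] at hni
        exact (Finset.mem_filter.1 hi).2 (hw i (Ne.symm hni.1) (Ne.symm hni.2))
      exact (Finset.card_le_card hsub).trans Finset.card_le_two
    | there i s => exact (hf i).card_le s
  have hob (w : Fin (n + 1) → ℝ) (hw : ∀ i, il ≠ i → ir ≠ i → w i = 0) :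
      Obedient (Weights.glue (p := p) w f) := by
    intro i hi
    refine ⟨(hf i).obedient, fun _ => ?_⟩
    change _ ≤ expU₂ (f i)
    rw [(hf i).expU₂_eq]
    split_ifs with h₁ h₂ h₂
    · exact hvl.trans hb.left_le
    · exact hvl
    · exact hvr
    · exact absurd (hw i h₁ h₂) hi.ne'
  -- With a common child the mixing is left to that child: it receives the target `t` itself and all
  -- the probability.
  by_cases he : il = ir
  · subst he
    have hsum (g : Fin (n + 1) → ℝ) : ∑ i, (if il = i then if il = i then ((1 : ℝ), t) else
        ((r.x - t) / (r.x - l.x), l.x) else if il = i then ((t - l.x) / (r.x - l.x), r.x)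
        else (0, d i)).1 * g i = g il := by
      rw [Finset.sum_eq_single il]
      · simp
      · intro i _ hi
        simp [Ne.symm hi]
      · simp
    have hfl := hf il
    simp only [if_true] at hfl
    refine ⟨isBehavioral_node.2 ⟨⟨fun i => ?_, ?_⟩, fun i => (hf i).isBehavioral⟩,
      hob _ fun i h₁ _ => by simp [h₁], hcard _ fun i h₁ _ => by simp [h₁], ?_, a, fun P hP => ?_⟩
    · simp only [Weights.root_glue]
      split_ifs
      · exact zero_le_one
      · exact le_rfl
    · have := hsum fun _ => 1
      simp only [mul_one] at this
      exact this
    · rw [expU₂_node]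
      exact (hsum _).trans hfl.expU₂_eq
    · refine (ha P hP).trans ?_
      have hU : expU₁ (Weights.glue (p := p) (fun i => (if il = i then if il = i then ((1 : ℝ), t)
          else ((r.x - t) / (r.x - l.x), l.x) else if il = i then ((t - l.x) / (r.x - l.x), r.x)
          else (0, d i)).1) f) = expU₁ (f il) := by
        rw [expU₁_node]
        exact hsum _
      obtain ⟨w, hw₀, hw₁, hw⟩ := hb.exists_weight
      -- The point of the bridge above `t` is a convex combination of pairs attainable in this
      -- child, whose realization is therefore at least as good for the leader.
      have hB : Below (Ls il) 1 t (w * l.y + (1 - w) * r.y) := by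
        intro α β k hα hk
        have h₁ := mul_le_mul_of_nonneg_left (hBl α β k hα hk) hw₀
        have h₂ := mul_le_mul_of_nonneg_left (hBr α β k hα hk) (sub_nonneg.2 hw₁)
        rw [← hw]
        linarith
      have := hfl.le_expU₁ hB
      rw [hU]
      have h₁ : w * l.ht a + (1 - w) * r.ht a = l.ht a := by rw [← hlra]; ring
      rw [← h₁, ← hw]
      simp only [Pt.ht]
      linarith
  · have hlt := hlr.resolve_left he
    have hd := sub_pos.2 hlt
    have hsum (g : Fin (n + 1) → ℝ) : ∑ i, (if il = i then if ir = i then ((1 : ℝ), t) else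
        ((r.x - t) / (r.x - l.x), l.x) else if ir = i then ((t - l.x) / (r.x - l.x), r.x)
        else (0, d i)).1 * g i =
        (r.x - t) / (r.x - l.x) * g il + (t - l.x) / (r.x - l.x) * g ir := by
      rw [Finset.sum_eq_add il ir he]
      · simp [he, Ne.symm he]
      · intro i _ hi
        simp [Ne.symm hi.1, Ne.symm hi.2]
      · simp
      · simp
    have hfl := hf il
    have hfr := hf ir
    simp only [if_true, if_neg he, if_neg (Ne.symm he)] at hfl hfr
    refine ⟨isBehavioral_node.2 ⟨⟨fun i => ?_, ?_⟩, fun i => (hf i).isBehavioral⟩,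
      hob _ fun i h₁ h₂ => by simp [h₁, h₂], hcard _ fun i h₁ h₂ => by simp [h₁, h₂], ?_, a,
      fun P hP => ?_⟩
    · simp only [Weights.root_glue]
      split_ifs
      · exact zero_le_one
      · exact div_nonneg (sub_nonneg.2 hb.le_right) hd.le
      · exact div_nonneg (sub_nonneg.2 hb.left_le) hd.le
      · exact le_rfl
    · have := hsum fun _ => 1
      simp only [mul_one] at this
      refine this.trans ?_
      field_simp
      ring
    · rw [expU₂_node]
      refine (hsum _).trans ?_
      simp only [Weights.sub_glue]
      rw [hfl.expU₂_eq, hfr.expU₂_eq]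
      field_simp
      ring
    · refine (ha P hP).trans ?_
      have hU : expU₁ (Weights.glue (p := p) (fun i => (if il = i then if ir = i then ((1 : ℝ), t)
          else ((r.x - t) / (r.x - l.x), l.x) else if ir = i then ((t - l.x) / (r.x - l.x), r.x)
          else (0, d i)).1) f) =
          (r.x - t) / (r.x - l.x) * expU₁ (f il) + (t - l.x) / (r.x - l.x) * expU₁ (f ir) := by
        rw [expU₁_node]
        exact hsum _
      have hl := mul_le_mul_of_nonneg_left (hfl.le_expU₁ hBl)
        (div_nonneg (sub_nonneg.2 hb.le_right) hd.le)
      have hr := mul_le_mul_of_nonneg_left (hfr.le_expU₁ hBr)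
        (div_nonneg (sub_nonneg.2 hb.left_le) hd.le)
      -- The mixture of the endpoints lies on the bridge's line, which supports the whole frontier.
      have hw : (r.x - t) / (r.x - l.x) * l.y + (t - l.x) / (r.x - l.x) * r.y =
          l.ht a + a * t := by
        have : r.y = l.y + a * (r.x - l.x) := by
          simp only [Pt.ht] at hlra
          linarith
        rw [this, Pt.ht]
        field_simp
        ring
      rw [hU]
      linarith

end Assign

end GameTree

/-! ### Cost of the top-down pass and assembly -/

namespace RealMachine

open GameTree

theorem strategyVal_glue {p : Player} {n : ℕ} {c : Fin (n + 1) → GameTree}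
    (w : Fin (n + 1) → ℝ) (f : ∀ i, Weights (c i)) :
    strategyVal (Weights.glue (p := p) w f) =
      .ofList (List.ofFn fun i => .pair (.real (w i)) (strategyVal (f i))) := rfl

/-- One bridge search per node, linear in its frontier, so the recurrence of the bottom-up pass
applies again. Unused children are processed too, because the output must specify a strategy in
every state. -/
theorem steps_realize {G : GameTree} {L : List Pt} {v : Val} (h : IsAnnotation G L v) {t : ℝ}
    (ht : InRange L t) : ∃ σ : G.Weights, IsRealization L t σ ∧
      Steps .realize (.pair v (.real t)) (strategyVal σ)
        (125000 * (Fintype.card G.State * Fintype.card G.Terminal) + 30) := by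
  induction h generalizing t with
  | leaf u v =>
    obtain ⟨⟨P, hP, hPt⟩, Q, hQ, hQt⟩ := ht
    rw [List.mem_singleton] at hP hQ
    subst hP hQ
    obtain rfl := le_antisymm hQt hPt
    refine ⟨fun s => (nomatch s), ⟨fun s => (nomatch s), trivial, fun s => (nomatch s), expU₂_leaf _,
      0, fun P hP => ?_⟩, _, by omega, .casePair (.var rfl) (.casePair (.var rfl)
      (.casePair (.var rfl) (.caseNil (.var rfl) .nil)))⟩
    rw [List.mem_singleton.1 hP, expU₁_leaf, Pt.ht]
  | @node p n c Ls vs L hs hF hlen ih =>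
    obtain ⟨t₁, ht₁, h₁⟩ := steps_filterGt (key := Pt.x)
      (rest := fun P => .pair (.real P.y) (.real P.tag)) t L
    have hvs : List.ofFn vs = vs 0 :: List.ofFn fun i => vs i.succ := List.ofFn_succ
    have hbridge : ∃ l r, IsBridge t L l r ∧ (l.tag = r.tag ∨ l.x < r.x) ∧
        ∀ w T, Steps .realizeAll (.pair (.ofList (List.ofFn vs)) (.pair (.real 0)
          (.pair (.real t) (.pair (ptVal l) (ptVal r))))) w T →
        Steps .realize (.pair (.pair (.real (value (.node p n c)))
          (.pair (ptsVal L) (.ofList (List.ofFn vs)))) (.real t)) w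
          (T + 120100 * L.length + 150) := by
      rw [hvs]
      by_cases hr : ∃ P ∈ L, t < P.x
      · obtain ⟨l, r, hb, hrx, t₂, ht₂, h₂⟩ := steps_bridge t L ht.1 hr
        obtain ⟨A, as, hhi⟩ := List.exists_cons_of_ne_nil (l := L.filter fun P => t < P.x) (by
          obtain ⟨P, hP, h⟩ := hr
          exact List.ne_nil_of_mem (List.mem_filter.2 ⟨hP, decide_eq_true h⟩))
        rw [hhi] at h₁
        refine ⟨l, r, hb, .inr (hb.left_le.trans_lt hrx), fun w T ⟨t₃, ht₃, h₃⟩ => ?_⟩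
        exact ⟨_, by omega, .casePair (.var rfl) (.casePair (.var rfl) (.casePair (.var rfl)
          (.casePair (.var rfl) (.letIn (.call (.pair (.var rfl) (.var rfl)) rfl h₁)
          (.casePair (.var rfl) (.call (.pair (.var rfl) (.pair .zero (.pair (.var rfl)
          (.call (.pair (.var rfl) (.var rfl)) rfl h₂)))) rfl h₃))))))⟩
      -- The target is the right end of the frontier, where the bridge search does not apply; a
      -- highest point there serves as a degenerate bridge with one tag.
      · push Not at hr
        have hhi : L.filter (fun P => t < P.x) = [] :=
          List.filter_eq_nil_iff.2 fun P hP h => not_le.2 (of_decide_eq_true h) (hr P hP)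
        rw [hhi] at h₁
        obtain ⟨Z, hZ, t₂, ht₂, h₂⟩ := steps_best_filter (f := 10) rfl 0 t L (fun P => t ≤ P.x)
          (steps_filterGe t L) ht.2 (i := .zero) (j := .var 8) (k := .var 3)
          (ρ := [.nil, vs 0, .ofList (List.ofFn fun i => vs i.succ), ptsVal L,
            .ofList (vs 0 :: List.ofFn fun i => vs i.succ), .real (value (.node p n c)),
            .pair (ptsVal L) (.ofList (vs 0 :: List.ofFn fun i => vs i.succ)),
            .pair (.real (value (.node p n c)))
              (.pair (ptsVal L) (.ofList (vs 0 :: List.ofFn fun i => vs i.succ))), .real t,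
            .pair (.pair (.real (value (.node p n c)))
              (.pair (ptsVal L) (.ofList (vs 0 :: List.ofFn fun i => vs i.succ)))) (.real t)])
          .zero (.var rfl) (.var rfl)
        refine ⟨Z, Z, isBridge_of_forall_le hr hZ, .inl rfl, fun w T ⟨t₃, ht₃, h₃⟩ => ?_⟩
        exact ⟨_, by omega, .casePair (.var rfl) (.casePair (.var rfl) (.casePair (.var rfl)
          (.casePair (.var rfl) (.letIn (.call (.pair (.var rfl) (.var rfl)) rfl h₁)
          (.caseNil (.var rfl) (.letIn h₂ (.call (.pair (.var rfl) (.pair .zero (.pair (.var rfl)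
          (.pair (.var rfl) (.var rfl))))) rfl h₃)))))))⟩
    obtain ⟨l, r, hb, hlr, hsteps⟩ := hbridge
    have hcons (i) : ∃ P K, Ls i = P :: K := List.exists_cons_of_ne_nil (hs i).isFrontier.ne_nil
    choose P K hPK using hcons
    choose ws hws using fun i => (hs i).exists_eq
    choose f hf hfsteps using fun i => ih i
      (assign_inRange hF hb i (P := P i) (by rw [hPK]; exact List.mem_cons_self))
    refine ⟨_, .glue hF hb hlr hf, ?_⟩
    rw [strategyVal_glue]
    obtain ⟨T, hT, h'⟩ := hsteps _ _ (steps_realizeAll (vs := vs) (i₀ := 0) (fun i => by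
      rw [zero_add, hws, hPK]
      exact steps_assign hlr (i : ℕ) _ (P i) (K i) (ws i)) hfsteps)
    have h₄ := sum_card_mul_card_le (p := p) c 125000 30
    have h₅ := succ_le_card_terminal (p := p) c
    exact ⟨T, by omega, h'⟩

end RealMachine

theorem mainTheorem2 :
    ∃ (P : RealMachine.Program) (C : ℕ), ∀ G : GameTree, 0 < Fintype.card G.State →
      ∃ (σ : G.Weights) (t : ℕ),
        RealMachine.Runs P (RealMachine.gameVal G) (RealMachine.strategyVal σ) t ∧
        t ≤ C * (Fintype.card G.State * Fintype.card G.Terminal) ∧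
        (∃ φ : G.Profile → ℝ, GameTree.IsSEFCE φ ∧ GameTree.IsCompactRep σ φ) ∧
        ∀ s : G.State, (Finset.univ.filter fun a => σ s a ≠ 0).card ≤ 2 := by
  -- Twice 125000 for the two passes; the rest covers the choice of the best root point and the
  -- additive constants, which are absorbed because there is at least one state and one terminal
  -- state.
  refine ⟨RealMachine.prog, 251000, fun G hG => ?_⟩
  obtain ⟨L, v, hv, t₁, ht₁, h₁⟩ := RealMachine.steps_annotate G
  obtain ⟨w, hw⟩ := hv.exists_eq
  -- Height with respect to slope 0 is the leader's utility.
  obtain ⟨A, hA, hmax, t₂, ht₂, h₂⟩ := RealMachine.steps_best 0 L hv.isFrontier.ne_nil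
  have hlen := hv.length_le
  obtain ⟨σ, hσ, t₃, ht₃, h₃⟩ := RealMachine.steps_realize hv (t := A.x)
    ⟨⟨A, hA, le_rfl⟩, A, hA, le_rfl⟩
  have hpos : Fintype.card G.Terminal ≤ Fintype.card G.State * Fintype.card G.Terminal :=
    Nat.le_mul_of_pos_left _ hG
  have hpos' := GameTree.card_terminal_pos G
  subst hw
  refine ⟨σ, _, .call (.var rfl) rfl (.letIn (.call (.var rfl) rfl h₁) (.casePair (.var rfl)
    (.casePair (.var rfl) (.letIn (.call (.pair .zero (.var rfl)) rfl h₂) (.casePair (.var rfl)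
    (.call (.pair (.var rfl) (.var rfl)) rfl h₃)))))), by omega, ?_, hσ.card_le⟩
  refine hσ.obedient.exists_isSEFCE hv.isFrontier hσ.isBehavioral fun P hP => ?_
  refine le_trans ?_ (hσ.le_expU₁ (.of_mem hA))
  simpa only [GameTree.Pt.ht, zero_mul, sub_zero] using hmax P hP
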